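/- **Setting.** Let $k$ be a field and $C$ a coalgebra over $k$, with Sweedler notation $\Delta^{(n-1)}(c)=c_{(1)}\otimes\cdots\otimes c_{(n)}$. The dual algebra $C^*$ has the product $(gh)(c)=g(c_{(1)})h(c_{(2)})$ and acts on $C$ by $g\rightharpoonup c=c_{(1)}g(c_{(2)})$ and $c\leftharpoonup g=g(c_{(1)})c_{(2)}$. A *twist oriented quantum coalgebra* $(C,b,T_{\sf d},T_{\sf u},G)$ consists of a bilinear form $b:C\times C\to k$ with inverse $b^{-1}$, that is $$b^{-1}(c_{(1)},d_{(1)})\,b(c_{(2)},d_{(2)})=\epsilon(c)\epsilon(d)=b(c_{(1)},d_{(1)})\,b^{-1}(c_{(2)},d_{(2)}),$$ commuting coalgebra automorphisms $T_{\sf d},T_{\sf u}$ of $C$ and an invertible $G\in C^*$, such that for all $c,d,e\in C$ 1. $b(c_{(1)},T_{\sf u}(d_{(2)}))\,b^{-1}(T_{\sf d}(c_{(2)}),d_{(1)})=\epsilon(c)\epsilon(d)=b^{-1}(T_{\sf d}(c_{(1)}),d_{(2)})\,b(c_{(2)},T_{\sf u}(d_{(1)}))$; 2. $b(c,d)=b(T_{\sf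 d}(c),T_{\sf d}(d))=b(T_{\sf u}(c),T_{\sf u}(d))$; 3. $b(c_{(1)},d_{(1)})\,b(c_{(2)},e_{(1)})\,b(d_{(2)},e_{(2)})=b(c_{(2)},d_{(2)})\,b(c_{(1)},e_{(2)})\,b(d_{(1)},e_{(1)})$; 4. $G\circ T_{\sf d}=G\circ T_{\sf u}=G$ and $T_{\sf d}(T_{\sf u}(c))=G^{-1}\rightharpoonup c\leftharpoonup G$. **Diagrams.** Oriented link diagrams are taken in the plane with respect to the vertical direction; they are made of crossings (whose two lines are transverse to the horizontal), local maxima, local minima and vertical lines. Two diagrams are *regularly isotopic* if they are related by a finite sequence of: planar isotopies that only exchange the heights of pieces lying side by side; straightening of a zigzag (a local maximum next to a local minimum); cancellation of two consecutive opposite crossings of two lines; the braid relation for three crossings of the same type; sliding a line over or under a local maximum or minimum; in all versions, with all compatible orientations. **The scalar.** Let ${\sf c}\in C$ be cocommutative with $T_{\sf d}(T_{\sf u}({\sf c}))={\sf c}$. Let ${\bf L}$ be an oriented link diagram with components ${\bf L}_1,\dots,{\bf L}_r$. Let $d_\ell$ be the Whitney degree of ${\bf L}_\ell$: $2d_\ell$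 is the number of local extrema of ${\bf L}_\ell$ with clockwise orientation minus the number of those with counterclockwise orientation. Put ${\sf c}(\ell)={\sf c}\leftharpoonup G^{d_\ell}$. Choose on a vertical line of each component a starting point; call the choice *admissible* if all starting points lie on lines with the same vertical direction (all upward or all downward), or if $T_{\sf u}({\sf c})={\sf c}$. Traverse ${\bf L}_\ell$ from its starting point in the direction of the orientation and number its crossing lines $(\ell{:}1),(\ell{:}2),\dots,(\ell{:}m_\ell)$ in the order encountered. For a crossing line $x=(\ell{:}i)$ let $u_{\sf d}(x)$ be the number of local maxima traversed from right to left minus the number of local minima traversed from right to left, and $u_{\sf u}(x)$ the number of local minima traversed from left to right minus the number of local maxima traversed from left to right, on the portion of the traversal from $x$ to the return to the starting point; write $\langle x\rangle=T_{\sf d}^{u_{\sf d}(x)}T_{\sf u}^{u_{\sf u}(x)}({\sf c}(\ell)_{(i)})$, where ${\sf c}(\ell)_{(1)}\otimes\cdots\otimes{\sf c}(\ell)_{(m_\ell)}=\Delta^{(m_\ell-1)}({\sf c}(\ell))$. A crossing with over line $x$ and under line $y$ contributes a factor as follows. * The over line runs from lower left to upper right, disregarding orientation: $b(\langle x\rangle,\langle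 y\rangle)$ if both lines point up or both point down; $b^{-1}(T_{\sf u}\langle x\rangle,\langle y\rangle)$ if $x$ points up and $y$ down; $b^{-1}(T_{\sf d}\langle x\rangle,\langle y\rangle)$ if $x$ points down and $y$ up. * The over line runs from lower right to upper left, disregarding orientation: $b^{-1}(\langle x\rangle,\langle y\rangle)$ if both lines point up or both point down; $b(\langle x\rangle,T_{\sf u}\langle y\rangle)$ if $y$ points up and $x$ down; $b(\langle x\rangle,T_{\sf d}\langle y\rangle)$ if $y$ points down and $x$ up. Let ${\bf f}'_{C,{\sf c}}({\bf L})$ be the sum, over the coproducts of all components, of the products of these factors over all crossings ($1$ if there are no crossings), let $\omega$ be the product of the $G^{d_\ell}({\sf c})$ over the components without crossing lines, and let ${\bf f}_{C,{\sf c}}({\bf L})=\omega\,{\bf f}'_{C,{\sf c}}({\bf L})$. **Theorem.** Let $(C,b,T_{\sf d},T_{\sf u},G)$ be a twist oriented quantum coalgebra over $k$ and let ${\sf c}\in C$ be a cocommutative element with $T_{\sf d}(T_{\sf u}({\sf c}))={\sf c}$. Every oriented link diagram has an admissible choice of starting points (with all of them on upward lines). The scalar ${\bf f}_{C,{\sf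 c}}({\bf L})$ is the same for all admissible choices of starting points, so ${\bf f}_{C,{\sf c}}$ is a well-defined function on oriented link diagrams. If ${\bf L}$ and ${\bf L}'$ are regularly isotopic, then ${\bf f}_{C,{\sf c}}({\bf L})={\bf f}_{C,{\sf c}}({\bf L}')$. -/

import Mathlib

open scoped TensorProduct
open Coalgebra

noncomputable section

namespace OQC

/-! ### Sweedler sums, oriented quantum coalgebras -/

section Algebra

variable {k C : Type*} [Field k] [AddCommGroup C] [Module k C] [Coalgebra k C]

/-- The Sweedler sum `∑ F(c₍₁₎, c₍₂₎)`, computed from some expression of `Δ(c)` as a sum of pure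
tensors. It is only used for `F` which are linear in both arguments, so that the value does not
depend on that expression (see `sweedler_eq_lift`). -/
def sweedler (k : Type*) {C : Type*} [Field k] [AddCommGroup C] [Module k C] [Coalgebra k C]
    (c : C) (F : C → C → k) : k :=
  ∑ i ∈ (ℛ k c).index, F ((ℛ k c).left i) ((ℛ k c).right i)

theorem sweedler_eq_lift (c : C) (B : C →ₗ[k] C →ₗ[k] k) :
    sweedler k c (fun x y => B x y) = TensorProduct.lift B (comul (R := k) c) := by
  rw [sweedler, ← (ℛ k c).eq, map_sum]
  simp

/-- `c` is cocommutative: `Δ(c) = Δᶜᵒᵖ(c)`. -/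
def IsCocommutative (k : Type*) {C : Type*} [Field k] [AddCommGroup C] [Module k C]
    [Coalgebra k C] (c : C) : Prop :=
  TensorProduct.comm k C C (comul (R := k) c) = comul (R := k) c

/-- The right action `c ↼ g = g(c₍₁₎) c₍₂₎` of the dual algebra `C*` on `C`. -/
def actR (c : C) (g : WithConv (C →ₗ[k] k)) : C :=
  TensorProduct.lid k C (LinearMap.rTensor C g.ofConv (comul (R := k) c))

/-- The left action `g ⇀ c = c₍₁₎ g(c₍₂₎)` of the dual algebra `C*` on `C`. -/
def actL (g : WithConv (C →ₗ[k] k)) (c : C) : C :=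
  TensorProduct.rid k C (LinearMap.lTensor C g.ofConv (comul (R := k) c))

/-- A strict oriented quantum coalgebra structure `(b, T_d, T_u)` on the coalgebra `C`. The form
`bInv` is the (unique) inverse of the bilinear form `b`. -/
structure StrictOrientedQuantumCoalgebra (k C : Type*) [Field k] [AddCommGroup C] [Module k C]
    [Coalgebra k C] where
  b : C →ₗ[k] C →ₗ[k] k
  bInv : C →ₗ[k] C →ₗ[k] k
  bInv_b : ∀ c d : C,
    (sweedler k c fun c₁ c₂ => sweedler k d fun d₁ d₂ => bInv c₁ d₁ * b c₂ d₂)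
      = counit (R := k) c * counit (R := k) d
  b_bInv : ∀ c d : C,
    (sweedler k c fun c₁ c₂ => sweedler k d fun d₁ d₂ => b c₁ d₁ * bInv c₂ d₂)
      = counit (R := k) c * counit (R := k) d
  Td : C ≃ₗc[k] C
  Tu : C ≃ₗc[k] C
  commute : ∀ c, Td (Tu c) = Tu (Td c)
  qc1 : ∀ c d : C,
    (sweedler k c fun c₁ c₂ => sweedler k d fun d₁ d₂ => b c₁ (Tu d₂) * bInv (Td c₂) d₁)
      = counit (R := k) c * counit (R := k) d
  qc1' : ∀ c d : C,
    (sweedler k c fun c₁ c₂ => sweedler k d fun d₁ d₂ => bInv (Td c₁) d₂ * b c₂ (Tu d₁))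
      = counit (R := k) c * counit (R := k) d
  qc2_d : ∀ c d : C, b c d = b (Td c) (Td d)
  qc2_u : ∀ c d : C, b c d = b (Tu c) (Tu d)
  qc3 : ∀ c d e : C,
    (sweedler k c fun c₁ c₂ => sweedler k d fun d₁ d₂ => sweedler k e fun e₁ e₂ =>
        b c₁ d₁ * b c₂ e₁ * b d₂ e₂)
      = sweedler k c fun c₁ c₂ => sweedler k d fun d₁ d₂ => sweedler k e fun e₁ e₂ =>
        b c₂ d₂ * b c₁ e₂ * b d₁ e₁

/-- A twist oriented quantum coalgebra structure `(b, T_d, T_u, G)` on `C`. Here `G` is a unit of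
the dual algebra `C*`, whose product is the convolution product. -/
structure TwistOrientedQuantumCoalgebra (k C : Type*) [Field k] [AddCommGroup C] [Module k C]
    [Coalgebra k C] extends StrictOrientedQuantumCoalgebra k C where
  G : (WithConv (C →ₗ[k] k))ˣ
  G_Td : ∀ c, (G : WithConv (C →ₗ[k] k)).ofConv (Td c) = (G : WithConv (C →ₗ[k] k)).ofConv c
  G_Tu : ∀ c, (G : WithConv (C →ₗ[k] k)).ofConv (Tu c) = (G : WithConv (C →ₗ[k] k)).ofConv c
  Td_Tu : ∀ c, Td (Tu c) = actL ((G⁻¹ : (WithConv (C →ₗ[k] k))ˣ) : WithConv (C →ₗ[k] k))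
    (actR c (G : WithConv (C →ₗ[k] k)))

/-- `T_d^m ∘ T_u^n (c)` for integers `m`, `n`. -/
def StrictOrientedQuantumCoalgebra.pow (Q : StrictOrientedQuantumCoalgebra k C) (m n : ℤ)
    (c : C) : C :=
  (Q.Td.toLinearEquiv ^ m : C ≃ₗ[k] C) ((Q.Tu.toLinearEquiv ^ n : C ≃ₗ[k] C) c)

end Algebra

/-! ### Oriented link diagrams with respect to the vertical direction

A diagram is cut by horizontal lines into slices, read from bottom to top. A slice consists of
vertical lines and exactly one local maximum, local minimum or crossing. A horizontal line between
two slices meets the diagram in a finite sequence of points on vertical lines; it is recorded by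
the list of the vertical directions there, from left to right (`true` is up, `false` is down). -/

/-- The oriented pieces.
* `cap ltr`: a local maximum, traversed from left to right iff `ltr = true`;
* `cup ltr`: a local minimum, traversed from left to right iff `ltr = true`;
* `cross o a b`: a crossing of the line `/` (lower left to upper right), which has vertical
  direction `a`, and the line `\`, which has vertical direction `b`;
  the line `/` is the over crossing line iff `o = true`. -/
inductive Piece
  | cap (ltr : Bool)
  | cup (ltr : Bool)
  | cross (o a b : Bool)

/-- Directions at the lower end points of a piece, from left to right. -/
def Piece.bot : Piece → List Bool
  | .cap ltr => [ltr, !ltr]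
  | .cup _ => []
  | .cross _ a b => [a, b]

/-- Directions at the upper end points of a piece, from left to right. -/
def Piece.top : Piece → List Bool
  | .cap _ => []
  | .cup ltr => [!ltr, ltr]
  | .cross _ a b => [b, a]

/-- A piece with vertical lines (of given directions) to the left and to the right of it. -/
structure Slice where
  left : List Bool
  piece : Piece
  right : List Bool

def Slice.bot (s : Slice) : List Bool := s.left ++ s.piece.bot ++ s.right

def Slice.top (s : Slice) : List Bool := s.left ++ s.piece.top ++ s.right

/-- Place further vertical lines to the left and to the right. -/
def Slice.pad (l r : List Bool) (s : Slice) : Slice := ⟨l ++ s.left, s.piece, s.right ++ r⟩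

/-- The slices of `w` fit together, from the lower boundary `u` to the upper boundary `v`. -/
def Fits : List Bool → List Slice → List Bool → Prop
  | u, [], v => u = v
  | u, s :: w, v => u = s.bot ∧ Fits s.top w v

/-- Oriented link diagrams: no end points at the bottom or at the top. -/
structure OrientedLinkDiagram where
  word : List Slice
  fits : Fits [] word []

/-! ### Regular isotopy -/

/-- The local moves. Directions are arbitrary subject to compatibility, and the parameter `o`
covers a move together with its version with over and under crossings exchanged. -/
inductive LocalMove : List Slice → List Slice → Prop
  /-- Straightening a zigzag, both versions. -/
  | zigzag_left (a : Bool) :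
      LocalMove [⟨[a], .cup a, []⟩, ⟨[], .cap a, [a]⟩] []
  | zigzag_right (a : Bool) :
      LocalMove [⟨[], .cup (!a), [a]⟩, ⟨[a], .cap (!a), []⟩] []
  /-- Cancelling two opposite crossings of two lines. -/
  | two (o a b : Bool) :
      LocalMove [⟨[], .cross o a b, []⟩, ⟨[], .cross (!o) b a, []⟩] []
  /-- The braid relation. -/
  | three (o a b c : Bool) :
      LocalMove
        [⟨[], .cross o a b, [c]⟩, ⟨[b], .cross o a c, []⟩, ⟨[], .cross o b c, [a]⟩]
        [⟨[a], .cross o b c, []⟩, ⟨[], .cross o a c, [b]⟩, ⟨[c], .cross o a b, []⟩]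
  /-- Sliding a line past a local maximum. -/
  | slide_max (o a b : Bool) :
      LocalMove
        [⟨[], .cross o a b, [!a]⟩, ⟨[b], .cap a, []⟩]
        [⟨[a], .cross (!o) b (!a), []⟩, ⟨[], .cap a, [b]⟩]
  /-- Sliding a line past a local minimum. -/
  | slide_min (o a b : Bool) :
      LocalMove
        [⟨[b], .cup a, []⟩, ⟨[], .cross (!o) b (!a), [a]⟩]
        [⟨[], .cup a, [b]⟩, ⟨[!a], .cross o a b, []⟩]
  /-- Planar isotopy: two pieces side by side, separated by vertical lines `m`, may exchange
  their heights. -/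
  | exchange (p q : Piece) (m : List Bool) :
      LocalMove
        [⟨[], p, m ++ q.bot⟩, ⟨p.top ++ m, q, []⟩]
        [⟨p.bot ++ m, q, []⟩, ⟨[], p, m ++ q.top⟩]

/-- `D'` arises from `D` by replacing a local part by its equivalent. -/
def Move (D D' : OrientedLinkDiagram) : Prop :=
  ∃ (v v' : List Slice) (l r : List Bool) (below above : List Slice), LocalMove v v' ∧
    D.word = below ++ v.map (Slice.pad l r) ++ above ∧
    D'.word = below ++ v'.map (Slice.pad l r) ++ above

/-- Regular isotopy: the equivalence relation generated by the moves. -/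
def RegularlyIsotopic : OrientedLinkDiagram → OrientedLinkDiagram → Prop := Relation.EqvGen Move

/-! ### Traversal of a diagram -/

/-- The directions along the horizontal line below the slice with index `h`. -/
def level (w : List Slice) (h : ℕ) : List Bool := ((w[h]?).map Slice.bot).getD []

/-- `(h, j)` is the `j`-th point (from the left, counting from `0`) of the diagram on the
horizontal line below the slice with index `h`. -/
def IsPoint (w : List Slice) (p : ℕ × ℕ) : Prop := p.2 < (level w p.1).length

/-- The vertical direction of the diagram at a point. -/
def direction (w : List Slice) (p : ℕ × ℕ) : Bool := (level w p.1).getD p.2 false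

/-- What is met between two consecutive points of a traversal: nothing, a crossing line (that of
the slice with index `h`; the line `/` iff `slash = true`), or a local extremum. -/
inductive Event
  | plain
  | line (h : ℕ) (slash : Bool)
  | localMax (ltr : Bool)
  | localMin (ltr : Bool)

/-- Entering the slice `s` with index `h` from below at position `j`. -/
def Slice.enterBelow (s : Slice) (h j : ℕ) : (ℕ × ℕ) × Event :=
  let n := s.left.length
  if j < n then ((h + 1, j), .plain) else
  match s.piece with
  | .cap _ =>
      if j = n then ((h, n + 1), .localMax true)
      else if j = n + 1 then ((h, n), .localMax false)
      else ((h + 1, j - 2), .plain)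
  | .cup _ => ((h + 1, j + 2), .plain)
  | .cross _ _ _ =>
      if j = n then ((h + 1, n + 1), .line h true)
      else if j = n + 1 then ((h + 1, n), .line h false)
      else ((h + 1, j), .plain)

/-- Entering the slice `s` with index `h` from above at position `j`. -/
def Slice.enterAbove (s : Slice) (h j : ℕ) : (ℕ × ℕ) × Event :=
  let n := s.left.length
  if j < n then ((h, j), .plain) else
  match s.piece with
  | .cap _ => ((h, j + 2), .plain)
  | .cup _ =>
      if j = n then ((h + 1, n + 1), .localMin true)
      else if j = n + 1 then ((h + 1, n), .localMin false)
      else ((h, j - 2), .plain)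
  | .cross _ _ _ =>
      if j = n then ((h, n + 1), .line h false)
      else if j = n + 1 then ((h, n), .line h true)
      else ((h, j), .plain)

/-- One step of the traversal in the direction of the orientation: the next point and what is met
on the way there. -/
def step (w : List Slice) (p : ℕ × ℕ) : (ℕ × ℕ) × Event :=
  if direction w p then
    match w[p.1]? with
    | some s => s.enterBelow p.1 p.2
    | none => (p, .plain)
  else
    match p.1 with
    | 0 => (p, .plain)
    | h + 1 =>
      match w[h]? with
      | some s => s.enterAbove h p.2
      | none => (p, .plain)

/-- The next point of the traversal. -/
def next (w : List Slice) (p : ℕ × ℕ) : ℕ × ℕ := (step w p).1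

/-- What is met, in this order, on the traversal of the whole component through `p`, starting at
`p` and ending with the first return to `p`. -/
def events (w : List Slice) (p : ℕ × ℕ) : List Event :=
  (List.range (Function.minimalPeriod (next w) p)).map fun t => (step w ((next w)^[t] p)).2

/-- Contribution to `u_d`: `+1` for a local maximum traversed from right to left (type `d₊`),
`-1` for a local minimum traversed from right to left (type `d₋`). -/
def Event.d : Event → ℤ
  | .localMax false => 1
  | .localMin false => -1
  | _ => 0

/-- Contribution to `u_u`: `+1` for a local minimum traversed from left to right (type `u₊`),
`-1` for a local maximum traversed from left to right (type `u₋`). -/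
def Event.u : Event → ℤ
  | .localMin true => 1
  | .localMax true => -1
  | _ => 0

/-- `1` for a local extremum with clockwise orientation, `-1` for one with counterclockwise
orientation. -/
def Event.clockwise : Event → ℤ
  | .localMax true => 1
  | .localMin false => 1
  | .localMax false => -1
  | .localMin true => -1
  | _ => 0

/-- The crossing lines in the order encountered, each with the exponents `u_d`, `u_u` counted on
the portion of the traversal from that line to its end. -/
def crossingLines : List Event → List ((ℕ × Bool) × ℤ × ℤ)
  | [] => []
  | .line h slash :: E =>
      ((h, slash), (E.map Event.d).sum, (E.map Event.u).sum) :: crossingLines E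
  | _ :: E => crossingLines E

/-- The Whitney degree of the component through `p`: half of the number of local extrema with
clockwise orientation minus the number of those with counterclockwise orientation. -/
def whitneyDegree (w : List Slice) (p : ℕ × ℕ) : ℤ :=
  ((events w p).map Event.clockwise).sum / 2

/-- `S` lists starting points, exactly one on each component of the diagram. -/
structure IsStartingList (D : OrientedLinkDiagram) (S : List (ℕ × ℕ)) : Prop where
  isPoint : ∀ p ∈ S, IsPoint D.word p
  nodup : S.Nodup
  existsUnique : ∀ q, IsPoint D.word q → ∃! p, p ∈ S ∧ ∃ t : ℕ, (next D.word)^[t] p = q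

/-! ### The scalar associated with a link diagram -/

section Scalar

variable {k C : Type*} [Field k] [AddCommGroup C] [Module k C] [Coalgebra k C]

/-- The factor of a crossing, where the lines `/` and `\` carry `x` and `y`, which already contain
the powers `T_d^{u_d} ∘ T_u^{u_u}`. -/
def crossingFactor (Q : StrictOrientedQuantumCoalgebra k C) : (o a b : Bool) → (x y : C) → k
  | true, true, true, x, y => Q.b x y
  | true, false, false, x, y => Q.b x y
  | true, true, false, x, y => Q.bInv (Q.Tu x) y
  | true, false, true, x, y => Q.bInv (Q.Td x) y
  | false, true, true, x, y => Q.bInv y x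
  | false, false, false, x, y => Q.bInv y x
  | false, true, false, x, y => Q.b y (Q.Tu x)
  | false, false, true, x, y => Q.b y (Q.Td x)

/-- The product of the factors of all crossings, where the crossing line `(h, slash)` carries
`x (h, slash)`. -/
def crossingProduct (Q : StrictOrientedQuantumCoalgebra k C) (w : List Slice)
    (x : ℕ × Bool → C) : k :=
  ∏ h ∈ Finset.range w.length,
    match (w[h]?).map Slice.piece with
    | some (.cross o a b) => crossingFactor Q o a b (x (h, true)) (x (h, false))
    | _ => 1

/-- For crossing lines `ℓ₁, …, ℓₘ` with exponents `(m₁, n₁), …`, sum `F` over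
`Δ^{(m-1)}(c) = c₍₁₎ ⊗ ⋯ ⊗ c₍ₘ₎`, where the line `ℓᵢ` carries `T_d^{mᵢ} ∘ T_u^{nᵢ} (c₍ᵢ₎)`.
Lines which are not listed carry what `x` says. -/
def sweedlerLines (Q : StrictOrientedQuantumCoalgebra k C) :
    List ((ℕ × Bool) × ℤ × ℤ) → C → ((ℕ × Bool → C) → k) → (ℕ × Bool → C) → k
  | [], _, F, x => F x
  | [(ℓ, m, n)], c, F, x => F (Function.update x ℓ (Q.pow m n c))
  | (ℓ, m, n) :: ℓ' :: L, c, F, x =>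
      sweedler k c fun c₁ c₂ =>
        sweedlerLines Q (ℓ' :: L) c₂ F (Function.update x ℓ (Q.pow m n c₁))

variable (Q : TwistOrientedQuantumCoalgebra k C) (c : C) (w : List Slice)

/-- The functional `G^d`, where `d` is the Whitney degree of the component through `p`. -/
def twistPower (p : ℕ × ℕ) : WithConv (C →ₗ[k] k) :=
  ((Q.G ^ whitneyDegree w p : (WithConv (C →ₗ[k] k))ˣ) : WithConv (C →ₗ[k] k))

/-- The sum of products, component by component: the crossing lines of the component with starting
point `p` receive the tensor factors of the iterated coproduct of `c ↼ G^d`. -/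
def sumOfProducts : List (ℕ × ℕ) → (ℕ × Bool → C) → k
  | [], x => crossingProduct Q.toStrictOrientedQuantumCoalgebra w x
  | p :: S, x =>
      sweedlerLines Q.toStrictOrientedQuantumCoalgebra (crossingLines (events w p))
        (actR c (twistPower Q w p)) (sumOfProducts S) x

/-- The product of the `G^d(c)` over the components without crossing lines. -/
def omega (S : List (ℕ × ℕ)) : k :=
  (S.map fun p =>
    if (crossingLines (events w p)).isEmpty then (twistPower Q w p).ofConv c else 1).prod

/-- The scalar of the diagram `D`, computed from the starting points `S`. Every crossing line lies
on exactly one component, so the initial assignment `0` is overwritten everywhere. -/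
def linkScalar (D : OrientedLinkDiagram) (S : List (ℕ × ℕ)) : k :=
  omega Q c D.word S * sumOfProducts Q c D.word S 0

end Scalar

end OQC

end

open scoped TensorProduct
open Coalgebra

noncomputable section

namespace OQC

-- The state sum is rewritten as a functional of a product taken along the components. In this form
-- moving a starting point is a cyclic rotation, and a local move is a substitution.
--
-- Beads. For a commutative `k`-algebra `R`, precomposition with `T_d^m T_u^n` respects the
-- convolution product of linear maps `C → R`. Hence pairs (linear map, exponents) form a monoid
-- `Bead` with a twisted multiplication. The product of the beads met along a component gives every
-- crossing line the powers picked up after it, and evaluating it at `c ↼ G^d` is the iterated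
-- coproduct of the definition. A crossing couples two lines, possibly of different components. A
-- `Model` therefore lets each crossing line take values in a commutative algebra of its own
-- diagram, with one functional which turns the product of all lines into the product of the
-- crossing factors. So the scalar is the functional applied to a product of closed components
-- (`linkScalar_eq`).
--
-- Starting points. Evaluation at a cocommutative element is a trace on the convolution algebra.
-- Rotating a bead from the front to the end also changes the exponents of the others, but on a
-- closed component the total exponents of `T_d` and `T_u` agree. By the twist axiom the resulting
-- diagonal shift is conjugation by a power of `G`, and the factor `G^d` with the Whitney degree `d`
-- absorbs it (`close_mul_comm`). One extra `T_u` compensates for a downward starting point. The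
-- corrected quantity `linkValue` does not depend on the starting points (`linkValue_eq`), and it
-- equals the scalar for admissible ones (`linkScalar_eq_linkValue`): if all starting points go
-- down, `T_u` can be applied to the whole diagram, under which all crossing factors are invariant.
--
-- Local moves. A diagram is cut into a window and its surroundings, a `Frame`. The traversal is
-- reduced to the points outside the window, with each strand of the window shrunk to one jump
-- carrying the product of its beads. By `prod_close_cycleProd_eq` the value only depends on how the
-- strands connect their end points, on their degrees, and on the functional at products of beads
-- evaluated at independent elements of `C`. So a move needs only the same connections, the same
-- degrees and an identity in independent elements (`LocalEquiv.linkValue_eq`).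
--
-- The identities. Treat a downward strand as the co-opposite coalgebra. Cancelling opposite
-- crossings says that the crossing forms have the expected convolution inverses
-- (`crossForm_mul_inv`). The braid relation is the Yang-Baxter equation, which for all eight
-- patterns of directions follows from the third axiom by inserting automorphisms and moving
-- inverses (`ybe`). A slide past an extremum is invariance of `b` under `T_d` or `T_u`. In a zigzag
-- the exponents of the two extrema cancel, and an exchange of heights leaves all beads as they are.

universe u v w

/-! ### Convolution functionals under powers of `T_d`, `T_u` and the twist element `G`. -/

section Beads

open WithConv

variable {k C : Type*} [Field k] [AddCommGroup C] [Module k C] [Coalgebra k C]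
variable {R : Type*} [CommRing R] [Algebra k R]

/-- The coalgebra automorphisms among the linear automorphisms. -/
def coalgAut (k C : Type*) [Field k] [AddCommGroup C] [Module k C] [Coalgebra k C] :
    Subgroup (C ≃ₗ[k] C) where
  carrier := {e | counit (R := k) ∘ₗ e.toLinearMap = counit ∧
    TensorProduct.map e.toLinearMap e.toLinearMap ∘ₗ comul = comul (R := k) ∘ₗ e.toLinearMap}
  mul_mem' := by
    rintro a b ⟨ha, ha'⟩ ⟨hb, hb'⟩
    have h : (a * b).toLinearMap = a.toLinearMap ∘ₗ b.toLinearMap := rfl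
    refine ⟨?_, ?_⟩
    · rw [h, ← LinearMap.comp_assoc, ha, hb]
    · rw [h, TensorProduct.map_comp, LinearMap.comp_assoc, hb', ← LinearMap.comp_assoc, ha',
        LinearMap.comp_assoc]
  one_mem' := by
    refine ⟨rfl, ?_⟩
    have h : (1 : C ≃ₗ[k] C).toLinearMap = LinearMap.id := rfl
    rw [h, TensorProduct.map_id]; rfl
  inv_mem' := by
    rintro a ⟨ha, ha'⟩
    have h : a.toLinearMap ∘ₗ (a⁻¹).toLinearMap = LinearMap.id := by
      ext x; exact a.apply_symm_apply x
    have h' : (a⁻¹).toLinearMap ∘ₗ a.toLinearMap = LinearMap.id := by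
      ext x; exact a.symm_apply_apply x
    refine ⟨?_, ?_⟩
    · nth_rw 1 [← ha]
      rw [LinearMap.comp_assoc, h, LinearMap.comp_id]
    · have : TensorProduct.map (a⁻¹).toLinearMap (a⁻¹).toLinearMap ∘ₗ
          (TensorProduct.map a.toLinearMap a.toLinearMap ∘ₗ comul (R := k)) ∘ₗ (a⁻¹).toLinearMap
          = comul ∘ₗ (a⁻¹).toLinearMap := by
        rw [← LinearMap.comp_assoc, ← LinearMap.comp_assoc, ← TensorProduct.map_comp, h',
          TensorProduct.map_id, LinearMap.id_comp]
      rw [← this, ha', LinearMap.comp_assoc, h, LinearMap.comp_id]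

theorem coalgEquiv_mem_coalgAut (e : C ≃ₗc[k] C) : e.toLinearEquiv ∈ coalgAut k C :=
  ⟨e.counit_comp, e.map_comp_comul⟩

namespace StrictOrientedQuantumCoalgebra

variable (Q : StrictOrientedQuantumCoalgebra k C)

/-- The automorphism `T_d^m ∘ T_u^n` for `t = (m, n)`. -/
def powEquiv (t : ℤ × ℤ) : C ≃ₗ[k] C := Q.Td.toLinearEquiv ^ t.1 * Q.Tu.toLinearEquiv ^ t.2

theorem commute_Td_Tu : Commute Q.Td.toLinearEquiv Q.Tu.toLinearEquiv := by
  ext c; exact Q.commute c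

theorem powEquiv_add (s t : ℤ × ℤ) : Q.powEquiv (s + t) = Q.powEquiv s * Q.powEquiv t := by
  have h : Commute (Q.Td.toLinearEquiv ^ t.1) (Q.Tu.toLinearEquiv ^ s.2) :=
    (Q.commute_Td_Tu.zpow_left t.1).zpow_right s.2
  simp only [powEquiv, Prod.fst_add, Prod.snd_add, zpow_add]
  rw [mul_assoc, ← mul_assoc (Q.Td.toLinearEquiv ^ t.1), h.eq]
  simp only [mul_assoc]

@[simp] theorem powEquiv_zero : Q.powEquiv 0 = 1 := by simp [powEquiv]

theorem powEquiv_mem (t : ℤ × ℤ) : Q.powEquiv t ∈ coalgAut k C :=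
  mul_mem (zpow_mem (coalgEquiv_mem_coalgAut _) _) (zpow_mem (coalgEquiv_mem_coalgAut _) _)

/-- Composition of a linear map on `C` with `T_d^m ∘ T_u^n`. -/
def shift (t : ℤ × ℤ) (f : WithConv (C →ₗ[k] R)) : WithConv (C →ₗ[k] R) :=
  toConv (f.ofConv ∘ₗ (Q.powEquiv t).toLinearMap)

theorem shift_apply (t : ℤ × ℤ) (f : WithConv (C →ₗ[k] R)) (c : C) :
    Q.shift t f c = f (Q.powEquiv t c) := rfl

@[simp] theorem shift_zero (f : WithConv (C →ₗ[k] R)) : Q.shift 0 f = f := by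
  ext c; simp [shift_apply]

theorem shift_shift (s t : ℤ × ℤ) (f : WithConv (C →ₗ[k] R)) :
    Q.shift s (Q.shift t f) = Q.shift (s + t) f := by
  ext c
  rw [shift_apply, shift_apply, shift_apply, add_comm, powEquiv_add]; rfl

@[simp] theorem shift_one (t : ℤ × ℤ) : Q.shift t (1 : WithConv (C →ₗ[k] R)) = 1 := by
  ext c
  have := LinearMap.congr_fun (Q.powEquiv_mem t).1 c
  simp only [LinearMap.comp_apply, LinearEquiv.coe_coe] at this
  simp [shift_apply, LinearMap.convOne_def, this]

/-- `T_d`, `T_u` and their inverses are coalgebra maps, so precomposition passes through the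
coproduct. This makes the twisted multiplication of beads associative. -/
theorem shift_mul (t : ℤ × ℤ) (f g : WithConv (C →ₗ[k] R)) :
    Q.shift t (f * g) = Q.shift t f * Q.shift t g := by
  ext c
  have := LinearMap.congr_fun (Q.powEquiv_mem t).2 c
  simp only [LinearMap.comp_apply, LinearEquiv.coe_coe] at this
  rw [shift_apply, LinearMap.convMul_apply, ← this, LinearMap.convMul_apply, shift, shift,
    TensorProduct.map_comp]
  rfl

end StrictOrientedQuantumCoalgebra

/-- Extension of scalars for functionals. -/
def scalarExt (R : Type*) [CommRing R] [Algebra k R] :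
    WithConv (C →ₗ[k] k) →* WithConv (C →ₗ[k] R) where
  toFun f := toConv ((Algebra.ofId k R).toLinearMap ∘ₗ f.ofConv)
  map_one' := by ext c; simp [LinearMap.convOne_def, Algebra.ofId_apply]
  map_mul' f g := by rw [LinearMap.algHom_comp_convMul_distrib]

/-- The left leg of the coproduct is consumed by `g`. Thus the correction `c ↼ G^d` becomes left
multiplication by `G^d` in the convolution algebra. -/
theorem scalarExt_mul_apply (g : WithConv (C →ₗ[k] k)) (f : WithConv (C →ₗ[k] R)) (c : C) :
    (scalarExt R g * f) c = f (actR c g) := by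
  rw [(ℛ k c).convMul_apply, actR, ← (ℛ k c).eq]
  simp [scalarExt, Algebra.ofId_apply, Algebra.smul_def]

theorem mul_scalarExt_apply (g : WithConv (C →ₗ[k] k)) (f : WithConv (C →ₗ[k] R)) (c : C) :
    (f * scalarExt R g) c = f (actL g c) := by
  rw [(ℛ k c).convMul_apply, actL, ← (ℛ k c).eq]
  simp [scalarExt, Algebra.ofId_apply, Algebra.smul_def, mul_comm]

/-- Swapping the legs of `Δ(c)` swaps the factors, because `R` is commutative: evaluation at a
cocommutative element is a trace. -/
theorem IsCocommutative.mul_apply_comm {c : C} (hc : IsCocommutative k c)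
    (f g : WithConv (C →ₗ[k] R)) : (f * g) c = (g * f) c := by
  rw [LinearMap.convMul_apply, ← (show _ = _ from hc), TensorProduct.map_comm,
    LinearMap.mul'_comm, LinearMap.convMul_apply]

namespace TwistOrientedQuantumCoalgebra

variable (Q : TwistOrientedQuantumCoalgebra k C)

/-- The unit `G` with scalars extended. -/
def unitG (R : Type*) [CommRing R] [Algebra k R] : (WithConv (C →ₗ[k] R))ˣ :=
  Units.map (scalarExt R) Q.G

theorem unitG_zpow (d : ℤ) : ((Q.unitG R ^ d : (WithConv (C →ₗ[k] R))ˣ) : WithConv (C →ₗ[k] R)) =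
    scalarExt R ((Q.G ^ d : (WithConv (C →ₗ[k] k))ˣ) : WithConv (C →ₗ[k] k)) := by
  rw [unitG, ← map_zpow]; rfl

theorem shift_unitG (t : ℤ × ℤ) : Q.shift t (Q.unitG R : WithConv (C →ₗ[k] R)) = Q.unitG R := by
  -- The automorphisms preserving `G` form a subgroup, so negative powers need no separate argument.
  let S : Subgroup (C ≃ₗ[k] C) :=
    { carrier := {e | ∀ c, (Q.G : WithConv (C →ₗ[k] k)).ofConv (e c) =
        (Q.G : WithConv (C →ₗ[k] k)).ofConv c}
      mul_mem' := fun {a b} ha hb c => (ha (b c)).trans (hb c)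
      one_mem' := fun _ => rfl
      inv_mem' := fun {a} ha c => by
        rw [← ha]; congr 1; exact a.apply_symm_apply c }
  have h : Q.powEquiv t ∈ S := mul_mem (zpow_mem (show Q.Td.toLinearEquiv ∈ S from Q.G_Td) _)
    (zpow_mem (show Q.Tu.toLinearEquiv ∈ S from Q.G_Tu) _)
  ext c
  have h' := h c
  simp only [StrictOrientedQuantumCoalgebra.shift_apply, unitG, Units.coe_map, scalarExt,
    MonoidHom.coe_mk, OneHom.coe_mk, LinearMap.comp_apply]
  rw [h']

theorem shift_unitG_zpow (t : ℤ × ℤ) (d : ℤ) :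
    Q.shift t ((Q.unitG R ^ d : (WithConv (C →ₗ[k] R))ˣ) : WithConv (C →ₗ[k] R)) =
      ((Q.unitG R ^ d : (WithConv (C →ₗ[k] R))ˣ) : WithConv (C →ₗ[k] R)) := by
  let φ : WithConv (C →ₗ[k] R) →* WithConv (C →ₗ[k] R) :=
    ⟨⟨Q.shift t, Q.shift_one t⟩, Q.shift_mul t⟩
  have h : Units.map φ (Q.unitG R) = Q.unitG R := Units.ext (Q.shift_unitG t)
  calc _ = ((Units.map φ (Q.unitG R ^ d) : (WithConv (C →ₗ[k] R))ˣ) : WithConv (C →ₗ[k] R)) := rfl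
    _ = _ := by rw [map_zpow, h]

/-- The dual form of the twist axiom: the right action on `C` turns into multiplication from the
left and the left action into multiplication from the right. -/
theorem shift_diag_one (f : WithConv (C →ₗ[k] R)) :
    Q.shift (1, 1) f = (Q.unitG R : WithConv (C →ₗ[k] R)) * f * ((Q.unitG R)⁻¹ :
      (WithConv (C →ₗ[k] R))ˣ) := by
  have h1 : ((Q.unitG R)⁻¹ : (WithConv (C →ₗ[k] R))ˣ).val = scalarExt R (Q.G⁻¹).val := rfl
  have h2 : (Q.unitG R).val = scalarExt R Q.G.val := rfl
  ext c
  rw [mul_assoc, h1, h2]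
  have := scalarExt_mul_apply (R := R) Q.G.val (f * scalarExt R (Q.G⁻¹).val) c
  refine Eq.trans ?_ this.symm
  rw [mul_scalarExt_apply, ← Q.Td_Tu]
  simp only [StrictOrientedQuantumCoalgebra.shift_apply, StrictOrientedQuantumCoalgebra.powEquiv,
    zpow_one]
  rfl

theorem shift_diag (s : ℤ) (f : WithConv (C →ₗ[k] R)) :
    Q.shift (s, s) f = ((Q.unitG R ^ s : (WithConv (C →ₗ[k] R))ˣ) : WithConv (C →ₗ[k] R)) * f *
      ((Q.unitG R ^ (-s) : (WithConv (C →ₗ[k] R))ˣ) : WithConv (C →ₗ[k] R)) := by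
  induction s using Int.induction_on generalizing f with
  | zero => 
    have : ((0 : ℤ), (0 : ℤ)) = 0 := rfl
    rw [this]; simp
  | succ n ih =>
    have : ((n : ℤ) + 1, (n : ℤ) + 1) = ((n : ℤ), (n : ℤ)) + (1, 1) := rfl
    rw [this, ← Q.shift_shift, shift_diag_one, ih, neg_add, add_comm (-(n : ℤ)), zpow_add,
      zpow_add, zpow_one, zpow_neg_one]
    simp only [Units.val_mul, mul_assoc]
  | pred n ih =>
    have h1 : (-(n : ℤ) - 1, -(n : ℤ) - 1) + (1, 1) = (-(n : ℤ), -(n : ℤ)) := by simp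
    -- For negative powers the induction runs backwards: `f` is the diagonal shift of `G⁻¹ f G`, and
    -- this shift cancels one `(-1, -1)`.
    have key : f = Q.shift (1, 1) (((Q.unitG R)⁻¹ : (WithConv (C →ₗ[k] R))ˣ).val * f *
        (Q.unitG R).val) := by
      rw [shift_diag_one]
      simp [mul_assoc]
    have h2 : Q.unitG R ^ (-(n : ℤ) - 1) = Q.unitG R ^ (-(n : ℤ)) * (Q.unitG R)⁻¹ :=
      zpow_sub_one _ _
    have h3 : Q.unitG R ^ (-(-(n : ℤ) - 1)) = Q.unitG R * Q.unitG R ^ (- -(n : ℤ)) := by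
      rw [← zpow_one_add]; congr 1; ring
    conv_lhs => rw [key]
    rw [Q.shift_shift, h1, ih, h2, h3]
    simp only [Units.val_mul, mul_assoc]

end TwistOrientedQuantumCoalgebra

end Beads

/-! ### The bead monoid and the cyclic invariance of a closed product. -/

section Beads

open WithConv

variable {k C : Type*} [Field k] [AddCommGroup C] [Module k C] [Coalgebra k C]
variable {R : Type v} [CommRing R] [Algebra k R]

/-- A bead: a linear map on `C` together with the exponents of `T_d` and `T_u` picked up when the
traversal passes it. -/
@[ext] structure Bead (Q : StrictOrientedQuantumCoalgebra k C) (R : Type*) [CommRing R]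
    [Algebra k R] where
  val : WithConv (C →ₗ[k] R)
  deg : ℤ × ℤ

namespace Bead

variable {Q : StrictOrientedQuantumCoalgebra k C}

instance : One (Bead Q R) := ⟨⟨1, 0⟩⟩
-- The traversal meets `x` before `y`, and exponents are counted from a line to the end of the
-- traversal; hence `x` is shifted by the degree of `y` and not conversely.
instance : Mul (Bead Q R) := ⟨fun x y => ⟨Q.shift y.deg x.val * y.val, x.deg + y.deg⟩⟩

@[simp] theorem one_val : (1 : Bead Q R).val = 1 := rfl
@[simp] theorem one_deg : (1 : Bead Q R).deg = 0 := rfl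
theorem mul_val (x y : Bead Q R) : (x * y).val = Q.shift y.deg x.val * y.val := rfl
@[simp] theorem mul_deg (x y : Bead Q R) : (x * y).deg = x.deg + y.deg := rfl

instance : Monoid (Bead Q R) where
  mul_assoc x y z := by
    ext1
    · simp only [mul_val, Q.shift_mul, Q.shift_shift, mul_deg, mul_assoc, add_comm]
    · simp [add_assoc]
  one_mul x := by ext1 <;> simp [mul_val]
  mul_one x := by ext1 <;> simp [mul_val]

theorem prod_deg (L : List (Bead Q R)) : L.prod.deg = (L.map Bead.deg).sum := by
  induction L with
  | nil => rfl
  | cons x L ih => simp [ih]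

end Bead

/-- Exponent of `T_u` compensating for the vertical direction at a starting point. -/
def dirExp : Bool → ℤ
  | true => 0
  | false => 1

namespace TwistOrientedQuantumCoalgebra

variable (Q : TwistOrientedQuantumCoalgebra k C)

/-- The contribution of a component whose beads, read from a starting point of direction `a`,
multiply to `x`. -/
def close (c : C) (a : Bool) (x : Bead Q.toStrictOrientedQuantumCoalgebra R) : R :=
  Q.shift (0, dirExp a)
    (((Q.unitG R ^ (-x.deg.1) : (WithConv (C →ₗ[k] R))ˣ) : WithConv (C →ₗ[k] R)) * x.val) c

/-- Think of `x` as leading from a point of direction `a` to one of direction `b`, and of `y` as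
leading back. Once the shifts by the directions are split off, the remaining ones are diagonal,
hence conjugations by powers of `G`. These cancel against the prefactor and leave `(G^(-s₁) F)
(G^(-t₁) H)`, to which the trace property applies. -/
theorem close_mul_comm {c : C} (hc : IsCocommutative k c) {a b : Bool}
    {x y : Bead Q.toStrictOrientedQuantumCoalgebra R}
    (hx : x.deg.1 - x.deg.2 = dirExp b - dirExp a) (hxy : (x * y).deg.1 = (x * y).deg.2) :
    Q.close c a (x * y) = Q.close c b (y * x) := by
  obtain ⟨f, s⟩ := x
  obtain ⟨g, t⟩ := y
  obtain ⟨s₁, s₂⟩ := s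
  obtain ⟨t₁, t₂⟩ := t
  simp only [Bead.mul_deg, Prod.fst_add, Prod.snd_add] at hx hxy
  -- The diagonal entry is `t₁`. The second coordinates match because `hx` fixes `s₁ - s₂`, and then
  -- `hxy` fixes `t₁ - t₂`.
  have h1 : (0, dirExp a) + (t₁, t₂) = (-s₁ + (s₁ + t₁), -s₁ + (s₁ + t₁)) + (0, dirExp b) := by
    ext <;> simp; omega
  have h2 : (0, dirExp b) + (s₁, s₂) = (s₁, s₁) + (0, dirExp a) := by
    ext <;> simp; omega
  simp only [close, Bead.mul_deg, Bead.mul_val, Q.shift_mul, Q.shift_unitG_zpow, Q.shift_shift,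
    h1, h2, Prod.fst_add]
  rw [← Q.shift_shift (_, _) (0, dirExp b), ← Q.shift_shift (s₁, s₁), Q.shift_diag, Q.shift_diag]
  set F := Q.shift (0, dirExp b) f
  set H := Q.shift (0, dirExp a) g
  have e1 : Q.unitG R ^ (-(s₁ + t₁)) * Q.unitG R ^ (-s₁ + (s₁ + t₁)) = Q.unitG R ^ (-s₁) := by
    rw [← zpow_add]; congr 1; ring
  have e2 : Q.unitG R ^ (-(t₁ + s₁)) * Q.unitG R ^ s₁ = Q.unitG R ^ (-t₁) := by
    rw [← zpow_add]; congr 1; ring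
  have e3 : -(-s₁ + (s₁ + t₁)) = -t₁ := by ring
  rw [e3]
  calc _ = (((Q.unitG R ^ (-s₁)).val * F) * ((Q.unitG R ^ (-t₁)).val * H)) c := by
        rw [← e1]; simp only [Units.val_mul, mul_assoc]
    _ = (((Q.unitG R ^ (-t₁)).val * H) * ((Q.unitG R ^ (-s₁)).val * F)) c := hc.mul_apply_comm _ _
    _ = _ := by rw [← e2]; simp only [Units.val_mul, mul_assoc]

end TwistOrientedQuantumCoalgebra

/-! ### Comparison of two evaluations -/

section Compare

variable {Q : StrictOrientedQuantumCoalgebra k C} {R' : Type v} [CommRing R'] [Algebra k R']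
  {U : Type*}

/-- The product of shifted beads, read as an iterated coproduct: two families of beads which agree
on all pure tensors agree on it. -/
theorem functional_eq_of_pure [DecidableEq U] {w : U → WithConv (C →ₗ[k] R)}
    {w' : U → WithConv (C →ₗ[k] R')}
    (us : List (U × (ℤ × ℤ))) (L : List U) (hnd : (us.map Prod.fst ++ L).Nodup) (x : C)
    (Φ : R →ₗ[k] k) (Φ' : R' →ₗ[k] k)
    (h : ∀ c : U → C, Φ (((us.map Prod.fst ++ L).map fun u => w u (c u)).prod) =
      Φ' (((us.map Prod.fst ++ L).map fun u => w' u (c u)).prod)) (c : U → C) :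
    Φ (((us.map fun u => Q.shift u.2 (w u.1)).prod x) * (L.map fun u => w u (c u)).prod) =
      Φ' (((us.map fun u => Q.shift u.2 (w' u.1)).prod x) *
        (L.map fun u => w' u (c u)).prod) := by
  induction us generalizing x Φ Φ' with
  | nil =>
    have := h c
    simp only [List.map_nil, List.nil_append, List.prod_nil] at this ⊢
    simp only [LinearMap.convOne_apply, ← Algebra.smul_def, map_smul, this]
  | cons u us ih =>
    simp only [List.map_cons, List.prod_cons, (ℛ k x).convMul_apply, Finset.sum_mul, map_sum]
    refine Finset.sum_congr rfl fun i _ => ?_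
    simp only [List.map_cons, List.cons_append, List.nodup_cons] at hnd
    -- The leg which is already evaluated goes into both functionals; this is why they are general
    -- in the induction.
    have := ih hnd.2 ((ℛ k x).right i)
      (Φ ∘ₗ LinearMap.mulLeft k (Q.shift u.2 (w u.1) ((ℛ k x).left i)))
      (Φ' ∘ₗ LinearMap.mulLeft k (Q.shift u.2 (w' u.1) ((ℛ k x).left i))) ?_
    · simpa [mul_assoc] using this
    · intro d
      -- As the labels are distinct, the value at `u.1` can be prescribed without disturbing the
      -- others.
      have := h (Function.update d u.1 (Q.powEquiv u.2 ((ℛ k x).left i)))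
      simp only [List.map_cons, List.cons_append, List.prod_cons, Function.update_self] at this
      have e : ∀ {S : Type v} (v : U → C → S), (us.map Prod.fst ++ L).map (fun z => v z
          (Function.update d u.1 (Q.powEquiv u.2 ((ℛ k x).left i)) z)) =
          (us.map Prod.fst ++ L).map (fun z => v z (d z)) := by
        intro S v
        refine List.map_congr_left fun z hz => ?_
        rw [Function.update_of_ne]
        rintro rfl
        exact hnd.1 hz
      rw [e fun z => w z, e fun z => w' z] at this
      simpa [StrictOrientedQuantumCoalgebra.shift_apply] using this

/-- A product of beads is a product of shifted maps, with shifts depending only on degrees. -/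
theorem exists_prod_val_eq (t : U → ℤ × ℤ) (us : List U) :
    ∃ vs : List (U × (ℤ × ℤ)), vs.map Prod.fst = us ∧
      ∀ {S : Type v} [CommRing S] [Algebra k S] (w : U → Bead Q S), (∀ u, (w u).deg = t u) →
        ((us.map w).prod).val = (vs.map fun u => Q.shift u.2 (w u.1).val).prod := by
  induction us with
  | nil => exact ⟨[], rfl, fun w _ => rfl⟩
  | cons u us ih =>
    obtain ⟨vs, h1, h2⟩ := ih
    refine ⟨(u, (us.map t).sum) :: vs, by simp [h1], fun w hw => ?_⟩
    simp only [List.map_cons, List.prod_cons, Bead.mul_val, h2 w hw, Bead.prod_deg, List.map_map]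
    congr 4
    exact funext hw

end Compare

/-- If two families of beads of equal degrees agree on pure tensors, then the products of the
contributions of the components agree. -/
theorem prod_close_eq_of_pure (Q : TwistOrientedQuantumCoalgebra k C) {R' : Type v} [CommRing R']
    [Algebra k R'] {U : Type*} [DecidableEq U]
    {w : U → Bead Q.toStrictOrientedQuantumCoalgebra R}
    {w' : U → Bead Q.toStrictOrientedQuantumCoalgebra R'}
    (ht : ∀ u, (w u).deg = (w' u).deg) (x : C) (comps : List (Bool × List U))
    (hnd : (comps.flatMap Prod.snd).Nodup)
    (Φ : R →ₗ[k] k) (Φ' : R' →ₗ[k] k)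
    (h : ∀ c : U → C, Φ (((comps.flatMap Prod.snd).map fun u => (w u).val (c u)).prod) =
      Φ' (((comps.flatMap Prod.snd).map fun u => (w' u).val (c u)).prod)) :
    Φ ((comps.map fun p => Q.close x p.1 (p.2.map w).prod).prod) =
      Φ' ((comps.map fun p => Q.close x p.1 (p.2.map w').prod).prod) := by
  induction comps generalizing Φ Φ' with
  | nil => simpa using h fun _ => 0
  | cons p comps ih =>
    obtain ⟨a, us⟩ := p
    obtain ⟨vs, rfl, hvs⟩ := exists_prod_val_eq (Q := Q.toStrictOrientedQuantumCoalgebra)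
      (fun u => (w u).deg) us
    have hd : ((vs.map Prod.fst).map w').prod.deg = ((vs.map Prod.fst).map w).prod.deg := by
      simp only [Bead.prod_deg, List.map_map]
      congr 1
      exact List.map_congr_left fun u _ => (ht u.1).symm
    simp only [List.map_cons, List.prod_cons]
    simp only [List.flatMap_cons] at hnd h
    -- The closed first component is absorbed into the functionals. The hypothesis left to check
    -- concerns this component alone, with pure values on all the others.
    have := ih hnd.of_append_right
      (Φ ∘ₗ LinearMap.mulLeft k (Q.close x a ((vs.map Prod.fst).map w).prod))
      (Φ' ∘ₗ LinearMap.mulLeft k (Q.close x a ((vs.map Prod.fst).map w').prod)) ?_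
    · simpa using this
    · intro c
      have key := fun y => functional_eq_of_pure (Q := Q.toStrictOrientedQuantumCoalgebra)
        vs _ hnd y Φ Φ' h c
      have e : ∀ {S : Type v} [CommRing S] [Algebra k S]
          (z : U → Bead Q.toStrictOrientedQuantumCoalgebra S), (∀ u, (z u).deg = (w u).deg) →
          Q.close x a ((vs.map Prod.fst).map z).prod =
          ((vs.map fun u => Q.shift u.2 (z u.1).val).prod)
            (actR (Q.powEquiv (0, dirExp a) x) ((Q.G ^ (-((vs.map Prod.fst).map z).prod.deg.1) :
              (WithConv (C →ₗ[k] k))ˣ) : WithConv (C →ₗ[k] k))) := by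
        intro S _ _ z hz
        rw [TwistOrientedQuantumCoalgebra.close, Q.unitG_zpow, hvs z hz,
          StrictOrientedQuantumCoalgebra.shift_apply, scalarExt_mul_apply]
      simp only [LinearMap.comp_apply, LinearMap.mulLeft_apply]
      -- By `hd` both products carry the same power of `G`, so they are evaluated at the same
      -- element of `C`.
      rw [e w fun _ => rfl, e w' fun u => (ht u).symm, hd]
      exact key _

end Beads

/-! ### Cycles of permutations of finite sets, and passing to part of the points. -/

section Systems

open Function

variable {P U M : Type*} [Monoid M]

/-- The product of the labels of the first `n` points of a trajectory. -/
def pathProd (σ : P → P) (lab : P → M) (p : P) (n : ℕ) : M :=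
  ((List.range n).map fun t => lab (σ^[t] p)).prod

/-- The points of the cycle through `p`, starting from `p`. -/
def cycleList (σ : P → P) (p : P) : List P :=
  (List.range (minimalPeriod σ p)).map fun t => σ^[t] p

/-- The product of the labels along the cycle through `p`, starting from `p`. -/
def cycleProd (σ : P → P) (lab : P → M) (p : P) : M := pathProd σ lab p (minimalPeriod σ p)

theorem cycleProd_eq (σ : P → P) (lab : P → M) (p : P) :
    cycleProd σ lab p = ((cycleList σ p).map lab).prod := by
  simp only [cycleProd, pathProd, cycleList, List.map_map, Function.comp_def]

@[simp] theorem pathProd_zero (σ : P → P) (lab : P → M) (p : P) : pathProd σ lab p 0 = 1 := rfl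

@[simp] theorem pathProd_one (σ : P → P) (lab : P → M) (p : P) : pathProd σ lab p 1 = lab p := by
  simp [pathProd]

theorem pathProd_add (σ : P → P) (lab : P → M) (p : P) (m n : ℕ) :
    pathProd σ lab p (m + n) = pathProd σ lab p m * pathProd σ lab (σ^[m] p) n := by
  simp only [pathProd, List.range_add, List.map_append, List.prod_append, List.map_map]
  congr 3
  funext t
  simp [Function.comp, add_comm m t, iterate_add_apply]

/-- `σ` permutes the finite set `X`. -/
structure PermOn (X : Set P) (σ : P → P) : Prop where
  finite : X.Finite
  maps : Set.MapsTo σ X X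
  inj : Set.InjOn σ X

/-- `S` lists points of `X`, exactly one on each cycle of `σ`. -/
structure IsTransversal (X : Set P) (σ : P → P) (S : List P) : Prop where
  mem : ∀ p ∈ S, p ∈ X
  nodup : S.Nodup
  existsUnique : ∀ q ∈ X, ∃! p, p ∈ S ∧ ∃ t : ℕ, σ^[t] p = q

namespace PermOn

variable {X : Set P} {σ : P → P} (h : PermOn X σ)
include h

theorem iterate_mem {p : P} (hp : p ∈ X) (t : ℕ) : σ^[t] p ∈ X := h.maps.iterate t hp

theorem mem_periodicPts {p : P} (hp : p ∈ X) : p ∈ periodicPts σ := by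
  have : Finite X := h.finite
  have hinj : Injective (h.maps.restrict σ X X) := h.maps.restrict_inj.2 h.inj
  obtain ⟨n, hn, hper⟩ := hinj.mem_periodicPts ⟨p, hp⟩
  refine ⟨n, hn, ?_⟩
  have h2 : ∀ (n : ℕ) (x : X), ((h.maps.restrict σ X X)^[n] x : P) = σ^[n] x := by
    intro n x
    induction n generalizing x with
    | zero => rfl
    | succ n ih => rw [iterate_succ_apply, ih]; rfl
  have := h2 n ⟨p, hp⟩
  rw [hper.eq] at this
  exact this.symm

theorem minimalPeriod_pos {p : P} (hp : p ∈ X) : 0 < minimalPeriod σ p :=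
  minimalPeriod_pos_of_mem_periodicPts (h.mem_periodicPts hp)

theorem reach_symm {p q : P} (hp : p ∈ X) {t : ℕ} (ht : σ^[t] p = q) : ∃ s, σ^[s] q = p := by
  obtain ⟨n, hn, hper⟩ := h.mem_periodicPts hp
  -- After `n * t` steps the trajectory is back at `p`, and `t` of them lead to `q`.
  refine ⟨n * t - t, ?_⟩
  rw [← ht, ← iterate_add_apply, Nat.sub_add_cancel (Nat.le_mul_of_pos_left t hn)]
  exact (hper.mul_const t).eq

theorem mem_cycleList {p q : P} (hp : p ∈ X) : q ∈ cycleList σ p ↔ ∃ t, σ^[t] p = q := by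
  simp only [cycleList, List.mem_map, List.mem_range]
  constructor
  · rintro ⟨t, -, ht⟩; exact ⟨t, ht⟩
  · rintro ⟨t, ht⟩
    exact ⟨t % minimalPeriod σ p, Nat.mod_lt _ (h.minimalPeriod_pos hp),
      by rw [iterate_mod_minimalPeriod_eq, ht]⟩

/-- Moving the starting point one step along the cycle rotates the list of points. Invariance under
this single rotation will suffice for independence of the starting point. -/
theorem exists_cycleList {p : P} (hp : p ∈ X) :
    ∃ L, cycleList σ p = p :: L ∧ cycleList σ (σ p) = L ++ [p] := by
  obtain ⟨n, hn⟩ : ∃ n, minimalPeriod σ p = n + 1 :=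
    ⟨_, (Nat.succ_pred_eq_of_pos (h.minimalPeriod_pos hp)).symm⟩
  refine ⟨(List.range n).map fun t => σ^[t + 1] p, ?_, ?_⟩
  · rw [cycleList, hn, List.range_succ_eq_map]
    simp [Function.comp_def]
  · rw [cycleList, minimalPeriod_apply (h.mem_periodicPts hp), hn, List.range_succ]
    have : σ^[n + 1] p = p := by rw [← hn]; exact iterate_minimalPeriod
    simp only [List.map_append, List.map_cons, List.map_nil, ← iterate_succ_apply, this,
      Nat.succ_eq_add_one]

/-- A product over a transversal of a function constant on cycles does not depend on the
transversal. -/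
theorem prod_transversal_eq {R : Type*} [CommMonoid R] {g : P → R}
    (hg : ∀ p ∈ X, g (σ p) = g p) {S S' : List P} (hS : IsTransversal X σ S)
    (hS' : IsTransversal X σ S') : (S.map g).prod = (S'.map g).prod := by
  classical
  have hg' : ∀ p ∈ X, ∀ t, g (σ^[t] p) = g p := by
    intro p hp t
    induction t with
    | zero => rfl
    | succ t ih => rw [iterate_succ_apply', hg _ (h.iterate_mem hp t), ih]
  rw [← List.prod_toFinset g hS.nodup, ← List.prod_toFinset g hS'.nodup]
  have hex : ∀ p, p ∈ S.toFinset → ∃ q, q ∈ S' ∧ ∃ t, σ^[t] q = p := fun p hp =>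
    (hS'.existsUnique p (hS.mem p (List.mem_toFinset.1 hp))).exists
  choose i hi hi' using hex
  refine Finset.prod_bij i (fun p hp => List.mem_toFinset.2 (hi p hp)) ?_ ?_ ?_
  · intro p hp q hq e
    obtain ⟨t, ht⟩ := hi' p hp
    obtain ⟨s, hs⟩ := hi' q hq
    have hm := hS'.mem _ (hi p hp)
    refine (hS.existsUnique _ hm).unique ⟨List.mem_toFinset.1 hp, h.reach_symm hm ht⟩
      ⟨List.mem_toFinset.1 hq, ?_⟩
    rw [e]
    exact h.reach_symm (hS'.mem _ (hi q hq)) hs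
  · intro q hq
    have hq' := List.mem_toFinset.1 hq
    obtain ⟨p, ⟨hp, t, ht⟩, -⟩ := hS.existsUnique q (hS'.mem q hq')
    have hp' := List.mem_toFinset.2 hp
    refine ⟨p, hp', (hS'.existsUnique p (hS.mem p hp)).unique ⟨hi p hp', hi' p hp'⟩ ⟨hq', ?_⟩⟩
    exact h.reach_symm (hS.mem p hp) ht
  · intro p hp
    obtain ⟨t, ht⟩ := hi' p hp
    conv_lhs => rw [← ht]
    exact hg' _ (hS'.mem _ (hi p hp)) t

theorem flatMap_cycleList {S : List P} (hS : IsTransversal X σ S) :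
    (S.flatMap (cycleList σ)).Nodup ∧ ∀ q, q ∈ S.flatMap (cycleList σ) ↔ q ∈ X := by
  refine ⟨?_, fun q => ?_⟩
  · rw [List.nodup_flatMap]
    refine ⟨fun p hp => ?_, ?_⟩
    · rw [cycleList, List.nodup_map_iff_inj_on List.nodup_range]
      intro a ha b hb e
      exact (iterate_eq_iterate_iff_of_lt_minimalPeriod (List.mem_range.1 ha)
        (List.mem_range.1 hb)).1 e
    · refine List.Pairwise.imp_of_mem ?_ hS.nodup
      intro p q hp hq hne r hr hr'
      rw [h.mem_cycleList (hS.mem p hp)] at hr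
      rw [h.mem_cycleList (hS.mem q hq)] at hr'
      obtain ⟨t, ht⟩ := hr
      have hrX : r ∈ X := ht ▸ h.iterate_mem (hS.mem p hp) t
      exact hne ((hS.existsUnique r hrX).unique ⟨hp, t, ht⟩ ⟨hq, hr'⟩)
  · rw [List.mem_flatMap]
    constructor
    · rintro ⟨p, hp, hq⟩
      obtain ⟨t, rfl⟩ := (h.mem_cycleList (hS.mem p hp)).1 hq
      exact h.iterate_mem (hS.mem p hp) t
    · intro hq
      obtain ⟨p, ⟨hp, ht⟩, -⟩ := hS.existsUnique q hq
      exact ⟨p, hp, (h.mem_cycleList (hS.mem p hp)).2 ht⟩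

/-- There is a transversal inside every set which meets all cycles. -/
theorem exists_transversal {A : P → Prop} (hA : ∀ p ∈ X, ∃ t, A (σ^[t] p)) :
    ∃ S, IsTransversal X σ S ∧ ∀ p ∈ S, A p := by
  classical
  let r : Setoid X := 
    { r := fun p q => ∃ t, σ^[t] (p : P) = q
      iseqv := 
        { refl := fun p => ⟨0, rfl⟩
          symm := fun {p q} ⟨t, ht⟩ => h.reach_symm p.2 ht
          trans := fun {p q s} ⟨t, ht⟩ ⟨u, hu⟩ => ⟨u + t, by rw [iterate_add_apply, ht, hu]⟩ } }
  have : Finite X := h.finite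
  have : Fintype (Quotient r) := Fintype.ofFinite _
  have hex : ∀ c : Quotient r, ∃ p : X, (⟦p⟧ : Quotient r) = c ∧ A p := by
    intro c
    obtain ⟨p, rfl⟩ := Quotient.exists_rep c
    obtain ⟨t, ht⟩ := hA p p.2
    refine ⟨⟨σ^[t] p, h.iterate_mem p.2 t⟩, Quotient.sound ?_, ht⟩
    exact h.reach_symm (t := t) p.2 rfl
  choose f hf hfA using hex
  refine ⟨(Finset.univ : Finset (Quotient r)).toList.map fun c => (f c : P), ⟨?_, ?_, ?_⟩, ?_⟩
  · intro p hp
    obtain ⟨c, -, rfl⟩ := List.mem_map.1 hp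
    exact (f c).2
  · refine (Finset.nodup_toList _).map fun c d e => ?_
    rw [← hf c, ← hf d, Subtype.ext e]
  · intro q hq
    obtain ⟨t, ht⟩ : r (f ⟦⟨q, hq⟩⟧) ⟨q, hq⟩ := Quotient.exact (hf _)
    refine ⟨f ⟦⟨q, hq⟩⟧, ⟨List.mem_map.2 ⟨_, by simp, rfl⟩, t, ht⟩, ?_⟩
    rintro p ⟨hp, s, hs⟩
    obtain ⟨c, -, rfl⟩ := List.mem_map.1 hp
    have : c = ⟦⟨q, hq⟩⟧ := by
      rw [← hf c]
      exact Quotient.sound ⟨s, hs⟩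
    rw [this]
  · intro p hp
    obtain ⟨c, -, rfl⟩ := List.mem_map.1 hp
    exact hfA c

end PermOn

/-- The system `(X, ρ, labU)` is obtained from `(Y, σ, lab)` by keeping, along `φ`, only some of the
points; the next kept point after `φ u` is reached after `cnt u` steps. -/
structure Coarsens (X : Set U) (ρ : U → U) (labU : U → M) (Y : Set P) (σ : P → P) (lab : P → M)
    (φ : U → P) (cnt : U → ℕ) : Prop where
  mem : ∀ u ∈ X, φ u ∈ Y
  maps : ∀ u ∈ X, ρ u ∈ X
  cnt_pos : ∀ u ∈ X, 0 < cnt u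
  iter : ∀ u ∈ X, σ^[cnt u] (φ u) = φ (ρ u)
  ne : ∀ u ∈ X, ∀ t, 0 < t → t < cnt u → ∀ u' ∈ X, σ^[t] (φ u) ≠ φ u'
  inj : Set.InjOn φ X
  lab_eq : ∀ u ∈ X, labU u = pathProd σ lab (φ u) (cnt u)
  meets : ∀ q ∈ Y, ∃ t, ∃ u ∈ X, σ^[t] q = φ u

namespace Coarsens

variable {X : Set U} {ρ : U → U} {labU : U → M} {Y : Set P} {σ : P → P} {lab : P → M}
  {φ : U → P} {cnt : U → ℕ} (h : Coarsens X ρ labU Y σ lab φ cnt)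
include h

/-- Suppose two kept points have the same successor. Going back the smaller number of steps along
the injective `σ` finds one of them strictly between the other and its successor, where no kept
point lies, unless the two coincide. -/
theorem injOn_next (hY : PermOn Y σ) : Set.InjOn ρ X := by
  have key : ∀ u ∈ X, ∀ u' ∈ X, ρ u = ρ u' → cnt u ≤ cnt u' → u = u' := by
    intro u hu u' hu' e hle
    have h1 : σ^[cnt u] (φ u) = σ^[cnt u] (σ^[cnt u' - cnt u] (φ u')) := by
      rw [← iterate_add_apply, Nat.add_sub_cancel' hle, h.iter u hu, h.iter u' hu', e]
    have h2 : ∀ n, Set.InjOn σ^[n] Y := fun n => by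
      induction n with
      | zero => exact Set.injOn_id _
      | succ n ih => rw [iterate_succ]; exact ih.comp hY.inj hY.maps
    have h3 := h2 _ (h.mem u hu) (hY.iterate_mem (h.mem u' hu') _) h1
    rcases Nat.eq_zero_or_pos (cnt u' - cnt u) with h0 | h0
    · rw [h0] at h3
      exact h.inj hu hu' h3
    · exact absurd h3.symm (h.ne u' hu' _ h0 (by have := h.cnt_pos u hu; omega) u hu)
  intro u hu u' hu' e
  rcases le_total (cnt u) (cnt u') with hle | hle
  · exact key u hu u' hu' e hle
  · exact (key u' hu' u hu e.symm hle).symm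

theorem permOn (hY : PermOn Y σ) : PermOn X ρ :=
  ⟨Set.Finite.of_finite_image (hY.finite.subset (Set.image_subset_iff.2 h.mem)) h.inj, h.maps,
    h.injOn_next hY⟩

omit h in
/-- The number of steps for the first `m` kept points. -/
theorem pathProd_sum (h : Coarsens X ρ labU Y σ lab φ cnt) {u : U} (hu : u ∈ X) (m : ℕ) :
    σ^[∑ t ∈ Finset.range m, cnt (ρ^[t] u)] (φ u) = φ (ρ^[m] u) ∧
      pathProd σ lab (φ u) (∑ t ∈ Finset.range m, cnt (ρ^[t] u)) = pathProd ρ labU u m := by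
  have hX : ∀ t, ρ^[t] u ∈ X := fun t => Set.MapsTo.iterate h.maps t hu
  induction m with
  | zero => exact ⟨rfl, rfl⟩
  | succ m ih =>
    rw [Finset.sum_range_succ]
    refine ⟨?_, ?_⟩
    · rw [add_comm, iterate_add_apply, ih.1, h.iter _ (hX m), ← iterate_succ_apply' ρ m u]
    · rw [pathProd_add, ih.1, ih.2, ← h.lab_eq _ (hX m), pathProd_add, pathProd_one]

/-- The steps over one `ρ`-cycle add up to exactly one `σ`-cycle. An earlier return of `σ` to `φ u`
would either occur at a kept point, giving `ρ` a shorter period, or put the kept point `φ u` inside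
a gap. -/
theorem cycleProd_eq (hY : PermOn Y σ) {u : U} (hu : u ∈ X) :
    cycleProd σ lab (φ u) = cycleProd ρ labU u := by
  have hX := h.permOn hY
  obtain ⟨h1, h2⟩ := h.pathProd_sum hu (minimalPeriod ρ u)
  rw [cycleProd, cycleProd, ← h2]
  congr 1
  rw [iterate_minimalPeriod] at h1
  set N : ℕ → ℕ := fun m => ∑ t ∈ Finset.range m, cnt (ρ^[t] u) with hN
  have hpos : 0 < N (minimalPeriod ρ u) :=
    Finset.sum_pos (fun t _ => h.cnt_pos _ (hX.iterate_mem hu t))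
      ⟨0, Finset.mem_range.2 (hX.minimalPeriod_pos hu)⟩
  have hle : minimalPeriod σ (φ u) ≤ N (minimalPeriod ρ u) :=
    IsPeriodicPt.minimalPeriod_le hpos h1
  by_contra hne
  have hlt := lt_of_le_of_ne hle hne
  have hs := hY.minimalPeriod_pos (h.mem u hu)
  set s := minimalPeriod σ (φ u) with hs_def
  have hper : σ^[s] (φ u) = φ u := iterate_minimalPeriod
  have hex : ∃ i, s < N (i + 1) := by
    refine ⟨minimalPeriod ρ u - 1, ?_⟩
    rwa [Nat.sub_add_cancel (hX.minimalPeriod_pos hu)]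
  classical
  -- The index `i` locates the early return between two kept points: `N i ≤ s < N (i + 1)`.
  obtain ⟨i, hi, hmin⟩ : ∃ i, s < N (i + 1) ∧ ∀ j < i, ¬ s < N (j + 1) :=
    ⟨Nat.find hex, Nat.find_spec hex, fun j => Nat.find_min hex⟩
  have hlow : N i ≤ s := by
    rcases i with _ | i
    · simp [hN]
    · exact not_lt.1 (hmin i (Nat.lt_succ_self i))
  have hip : i < minimalPeriod ρ u := by
    by_contra hcon
    have : N (minimalPeriod ρ u) ≤ N i :=
      Finset.sum_le_sum_of_subset (Finset.range_subset_range.2 (not_lt.1 hcon))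
    omega
  have e1 : N (i + 1) = N i + cnt (ρ^[i] u) := Finset.sum_range_succ _ _
  have e2 : σ^[s - N i] (φ (ρ^[i] u)) = φ u := by
    rw [← (h.pathProd_sum hu i).1, ← iterate_add_apply]
    change σ^[s - N i + N i] (φ u) = φ u
    rw [Nat.sub_add_cancel hlow, hper]
  rcases Nat.eq_zero_or_pos (s - N i) with h0 | h0
  · rw [h0] at e2
    have e3 : ρ^[i] u = u := h.inj (hX.iterate_mem hu i) hu e2
    rcases Nat.eq_zero_or_pos i with rfl | hi0
    · simp [hN] at h0; omega
    · exact absurd (IsPeriodicPt.minimalPeriod_le hi0 e3) (by omega)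
  · exact h.ne _ (hX.iterate_mem hu i) _ h0 (by omega) u hu e2

/-- Every `σ`-cycle meets the kept points. Two kept points on one `σ`-cycle are on one `ρ`-cycle,
since the stretches between consecutive kept points can be removed one by one. -/
theorem transversal_map (hY : PermOn Y σ) {S : List U} (hS : IsTransversal X ρ S) :
    IsTransversal Y σ (S.map φ) := by
  refine ⟨?_, ?_, ?_⟩
  · intro p hp
    obtain ⟨u, hu, rfl⟩ := List.mem_map.1 hp
    exact h.mem u (hS.mem u hu)
  · exact List.Nodup.map_on (fun u hu v hv e => h.inj (hS.mem u hu) (hS.mem v hv) e) hS.nodup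
  · have hX := h.permOn hY
    have key : ∀ u ∈ X, ∀ t, ∀ v ∈ X, σ^[t] (φ u) = φ v → ∃ s, ρ^[s] u = v := by
      intro u hu t
      induction t using Nat.strong_induction_on generalizing u with
      | _ t ih =>
        intro v hv e
        rcases Nat.eq_zero_or_pos t with rfl | h0
        · exact ⟨0, h.inj hu hv e⟩
        · by_cases hlt : t < cnt u
          · exact absurd e (h.ne u hu t h0 hlt v hv)
          · have e' : σ^[t - cnt u] (φ (ρ u)) = φ v := by
              rw [← h.iter u hu, ← iterate_add_apply, Nat.sub_add_cancel (not_lt.1 hlt), e]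
            obtain ⟨s, hs⟩ := ih _ (by have := h.cnt_pos u hu; omega) (ρ u) (h.maps u hu) v hv e'
            exact ⟨s + 1, hs⟩
    intro q hq
    obtain ⟨t, v, hv, ht⟩ := h.meets q hq
    obtain ⟨t', ht'⟩ := hY.reach_symm hq ht
    obtain ⟨u, ⟨hu, s, hs⟩, huniq⟩ := hS.existsUnique v hv
    refine ⟨φ u, ⟨List.mem_map_of_mem hu, t' + ∑ t ∈ Finset.range s, cnt (ρ^[t] u), ?_⟩, ?_⟩
    · rw [iterate_add_apply, (h.pathProd_sum (hS.mem u hu) s).1, hs, ht']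
    · rintro p ⟨hp, r, hr⟩
      obtain ⟨u', hu', rfl⟩ := List.mem_map.1 hp
      rw [huniq u' ⟨hu', key u' (hS.mem u' hu') (t + r) v hv ?_⟩]
      rw [iterate_add_apply, hr, ht]

end Coarsens

end Systems

/-! ### Traversal of a diagram as a permutation of its points. -/

section Diagrams

theorem getD_append_add {α : Type*} (l x : List α) (i : ℕ) (a : α) :
    (l ++ x).getD (l.length + i) a = x.getD i a := by
  rw [List.getD_append_right _ _ _ _ (Nat.le_add_right _ _), Nat.add_sub_cancel_left]

/-! ### Passing a slice -/

namespace Slice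

theorem enterBelow_left {s : Slice} {h j : ℕ} (hj : j < s.left.length) :
    s.enterBelow h j = ((h + 1, j), .plain) := by
  simp [enterBelow, hj]

theorem enterAbove_left {s : Slice} {h j : ℕ} (hj : j < s.left.length) :
    s.enterAbove h j = ((h, j), .plain) := by
  simp [enterAbove, hj]

theorem enterBelow_right (s : Slice) (h i : ℕ) :
    s.enterBelow h (s.left.length + s.piece.bot.length + i) =
      ((h + 1, s.left.length + s.piece.top.length + i), .plain) := by
  obtain ⟨l, p, r⟩ := s
  rcases p with _ | _ | _
  · have h1 : ¬ l.length + 2 + i < l.length := by omega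
    have h2 : ¬ l.length + 2 + i = l.length := by omega
    have h3 : ¬ l.length + 2 + i = l.length + 1 := by omega
    have h4 : l.length + 2 + i - 2 = l.length + i := by omega
    simp [enterBelow, Piece.bot, Piece.top, h1, h2, h3, h4]
  · have h4 : l.length + i + 2 = l.length + 2 + i := by omega
    simp [enterBelow, Piece.bot, Piece.top, h4]
  · have h1 : ¬ l.length + 2 + i < l.length := by omega
    have h2 : ¬ l.length + 2 + i = l.length := by omega
    have h3 : ¬ l.length + 2 + i = l.length + 1 := by omega
    simp [enterBelow, Piece.bot, Piece.top, h1, h2, h3]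

theorem enterAbove_right (s : Slice) (h i : ℕ) :
    s.enterAbove h (s.left.length + s.piece.top.length + i) =
      ((h, s.left.length + s.piece.bot.length + i), .plain) := by
  obtain ⟨l, p, r⟩ := s
  rcases p with _ | _ | _
  · have h4 : l.length + i + 2 = l.length + 2 + i := by omega
    simp [enterAbove, Piece.bot, Piece.top, h4]
  · have h1 : ¬ l.length + 2 + i < l.length := by omega
    have h2 : ¬ l.length + 2 + i = l.length := by omega
    have h3 : ¬ l.length + 2 + i = l.length + 1 := by omega
    have h4 : l.length + 2 + i - 2 = l.length + i := by omega
    simp [enterAbove, Piece.bot, Piece.top, h1, h2, h3, h4]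
  · have h1 : ¬ l.length + 2 + i < l.length := by omega
    have h2 : ¬ l.length + 2 + i = l.length := by omega
    have h3 : ¬ l.length + 2 + i = l.length + 1 := by omega
    simp [enterAbove, Piece.bot, Piece.top, h1, h2, h3]

theorem bot_getD_left {s : Slice} {j : ℕ} (hj : j < s.left.length) :
    s.bot.getD j false = s.left.getD j false := by
  rw [bot, List.append_assoc, List.getD_append _ _ _ _ hj]

theorem top_getD_left {s : Slice} {j : ℕ} (hj : j < s.left.length) :
    s.top.getD j false = s.left.getD j false := by
  rw [top, List.append_assoc, List.getD_append _ _ _ _ hj]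

theorem bot_getD_right (s : Slice) (i : ℕ) :
    s.bot.getD (s.left.length + s.piece.bot.length + i) false = s.right.getD i false := by
  rw [bot, ← List.length_append, getD_append_add]

theorem top_getD_right (s : Slice) (i : ℕ) :
    s.top.getD (s.left.length + s.piece.top.length + i) false = s.right.getD i false := by
  rw [top, ← List.length_append, getD_append_add]

theorem bot_length (s : Slice) :
    s.bot.length = s.left.length + s.piece.bot.length + s.right.length := by simp [bot, add_assoc]

theorem top_length (s : Slice) :
    s.top.length = s.left.length + s.piece.top.length + s.right.length := by simp [top, add_assoc]

/-- Every position of a slice is in the left part, the piece or the right part. -/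
theorem position_cases {l m r j : ℕ} (hj : j < l + m + r) :
    j < l ∨ (∃ i < m, j = l + i) ∨ ∃ i < r, j = l + m + i := by
  by_cases h1 : j < l
  · exact .inl h1
  by_cases h2 : j < l + m
  · exact .inr (.inl ⟨j - l, by omega, by omega⟩)
  · exact .inr (.inr ⟨j - (l + m), by omega, by omega⟩)

/-- The first alternative is a passage through the slice, the second a turn at a local maximum.
Either can be retraced, and for a line coming from below the last entry is the change of `dirExp`.
The global properties of the traversal come from this and its mirror image. -/
theorem enterBelow_spec (s : Slice) (h : ℕ) {j : ℕ} (hj : j < s.bot.length) :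
    ((s.enterBelow h j).1.1 = h + 1 ∧ (s.enterBelow h j).1.2 < s.top.length ∧
      s.top.getD (s.enterBelow h j).1.2 false = s.bot.getD j false ∧
      (s.enterAbove h (s.enterBelow h j).1.2).1 = (h, j) ∧
      (s.enterBelow h j).2.d - (s.enterBelow h j).2.u = 0) ∨
    ((s.enterBelow h j).1.1 = h ∧ (s.enterBelow h j).1.2 < s.bot.length ∧
      s.bot.getD (s.enterBelow h j).1.2 false = !s.bot.getD j false ∧
      (s.enterBelow h (s.enterBelow h j).1.2).1 = (h, j) ∧
      (s.enterBelow h j).2.d - (s.enterBelow h j).2.u = 1) := by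
  rw [bot_length] at hj
  rcases position_cases hj with hl | ⟨i, hi, rfl⟩ | ⟨i, hi, rfl⟩
  · left
    rw [enterBelow_left hl]
    refine ⟨rfl, by rw [top_length]; dsimp only; omega, ?_, by rw [enterAbove_left hl], rfl⟩
    rw [top_getD_left hl, bot_getD_left hl]
  · obtain ⟨l, p, r⟩ := s
    rcases p with a | a | ⟨o, a, b⟩
    · right
      have hi2 : i = 0 ∨ i = 1 := by simp [Piece.bot] at hi; omega
      rcases hi2 with rfl | rfl
      · cases a <;> simp [enterBelow, bot, Event.d, Event.u, Piece.bot]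
      · cases a <;> simp [enterBelow, bot, Event.d, Event.u, Piece.bot]
    · simp [Piece.bot] at hi
    · left
      have hi2 : i = 0 ∨ i = 1 := by simp [Piece.bot] at hi; omega
      rcases hi2 with rfl | rfl
      · simp [enterBelow, enterAbove, bot, top, Event.d, Event.u, Piece.bot, Piece.top]
      · simp [enterBelow, enterAbove, bot, top, Event.d, Event.u, Piece.bot, Piece.top]
  · left
    rw [enterBelow_right]
    refine ⟨rfl, by rw [top_length]; dsimp only; omega, ?_, by rw [enterAbove_right], rfl⟩
    rw [top_getD_right, bot_getD_right]

theorem enterAbove_spec (s : Slice) (h : ℕ) {j : ℕ} (hj : j < s.top.length) :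
    ((s.enterAbove h j).1.1 = h ∧ (s.enterAbove h j).1.2 < s.bot.length ∧
      s.bot.getD (s.enterAbove h j).1.2 false = s.top.getD j false ∧
      (s.enterBelow h (s.enterAbove h j).1.2).1 = (h + 1, j) ∧
      (s.enterAbove h j).2.d - (s.enterAbove h j).2.u = 0) ∨
    ((s.enterAbove h j).1.1 = h + 1 ∧ (s.enterAbove h j).1.2 < s.top.length ∧
      s.top.getD (s.enterAbove h j).1.2 false = !s.top.getD j false ∧
      (s.enterAbove h (s.enterAbove h j).1.2).1 = (h + 1, j) ∧
      (s.enterAbove h j).2.d - (s.enterAbove h j).2.u = -1) := by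
  rw [top_length] at hj
  rcases position_cases hj with hl | ⟨i, hi, rfl⟩ | ⟨i, hi, rfl⟩
  · left
    rw [enterAbove_left hl]
    refine ⟨rfl, by rw [bot_length]; dsimp only; omega, ?_, by rw [enterBelow_left hl], rfl⟩
    rw [top_getD_left hl, bot_getD_left hl]
  · obtain ⟨l, p, r⟩ := s
    rcases p with a | a | ⟨o, a, b⟩
    · simp [Piece.top] at hi
    · right
      have hi2 : i = 0 ∨ i = 1 := by simp [Piece.top] at hi; omega
      rcases hi2 with rfl | rfl
      · cases a <;> simp [enterAbove, top, Event.d, Event.u, Piece.top]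
      · cases a <;> simp [enterAbove, top, Event.d, Event.u, Piece.top]
    · left
      have hi2 : i = 0 ∨ i = 1 := by simp [Piece.top] at hi; omega
      rcases hi2 with rfl | rfl
      · simp [enterBelow, enterAbove, bot, top, Event.d, Event.u, Piece.bot, Piece.top]
      · simp [enterBelow, enterAbove, bot, top, Event.d, Event.u, Piece.bot, Piece.top]
  · left
    rw [enterAbove_right]
    refine ⟨rfl, by rw [bot_length]; dsimp only; omega, ?_, by rw [enterBelow_right], rfl⟩
    rw [top_getD_right, bot_getD_right]

end Slice

/-! ### Levels -/

theorem fits_append {u v : List Bool} {a b : List Slice} :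
    Fits u (a ++ b) v ↔ ∃ m, Fits u a m ∧ Fits m b v := by
  induction a generalizing u with
  | nil => simp [Fits]
  | cons s a ih => simp [Fits, ih, and_assoc]

theorem level_of_getElem? {w : List Slice} {h : ℕ} {s : Slice} (hs : w[h]? = some s) :
    level w h = s.bot := by simp [level, hs]

theorem level_of_length_le {w : List Slice} {h : ℕ} (hh : w.length ≤ h) : level w h = [] := by
  simp [level, hh]

theorem Fits.bot_eq {u v : List Bool} {w : List Slice} {s : Slice} (hw : Fits u w v)
    (hs : w[0]? = some s) : s.bot = u := by
  cases w with
  | nil => simp at hs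
  | cons t w => simp at hs; rw [← hs]; exact hw.1.symm

theorem Fits.succ {u v : List Bool} {w : List Slice} {s : Slice} {h : ℕ} (hw : Fits u w v)
    (hs : w[h]? = some s) : ((w[h + 1]?).map Slice.bot).getD v = s.top := by
  induction w generalizing u h with
  | nil => simp at hs
  | cons t w ih =>
    cases h with
    | zero =>
      simp at hs
      subst hs
      cases w with
      | nil => simpa using hw.2.symm
      | cons t' w => simpa using hw.2.1.symm
    | succ h => simpa using ih hw.2 (by simpa using hs)

theorem Fits.level_succ {u : List Bool} {w : List Slice} {s : Slice} {h : ℕ} (hw : Fits u w [])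
    (hs : w[h]? = some s) : level w (h + 1) = s.top := hw.succ hs

theorem Fits.level_zero {v : List Bool} {w : List Slice} (hw : Fits [] w v) : level w 0 = [] := by
  cases h : w[0]? with
  | none => simp [level, h]
  | some s => rw [level_of_getElem? h, hw.bot_eq h]

/-- One step of the traversal from a point at which the traversal has direction `d`. -/
def dirStep (w : List Slice) (d : Bool) (p : ℕ × ℕ) : (ℕ × ℕ) × Event :=
  if d then
    match w[p.1]? with
    | some s => s.enterBelow p.1 p.2
    | none => (p, .plain)
  else
    match p.1 with
    | 0 => (p, .plain)
    | h + 1 =>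
      match w[h]? with
      | some s => s.enterAbove h p.2
      | none => (p, .plain)

theorem step_eq (w : List Slice) (p : ℕ × ℕ) : step w p = dirStep w (direction w p) p := rfl

theorem dirStep_up {w : List Slice} {h j : ℕ} {s : Slice} (hs : w[h]? = some s) :
    dirStep w true (h, j) = s.enterBelow h j := by simp [dirStep, hs]

theorem dirStep_down {w : List Slice} {h j : ℕ} {s : Slice} (hs : w[h]? = some s) :
    dirStep w false (h + 1, j) = s.enterAbove h j := by simp [dirStep, hs]

/-- The direction after a step of the traversal from height `h` with direction `d` to
height `h'`. -/
def newDir (d : Bool) (h h' : ℕ) : Bool := if d then decide (h < h') else decide (h ≤ h')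

/-- The direction `d` is a parameter, not that of the diagram, so that stepping back against the
orientation is expressed by the same function. This yields injectivity of the traversal. -/
theorem dirStep_spec {w : List Slice} (hw : Fits [] w []) {d : Bool} {p : ℕ × ℕ}
    (hp : IsPoint w p) :
    IsPoint w (dirStep w d p).1 ∧
    direction w (dirStep w d p).1 =
      xor (direction w p) (xor d (newDir d p.1 (dirStep w d p).1.1)) ∧
    (dirStep w (!newDir d p.1 (dirStep w d p).1.1) (dirStep w d p).1).1 = p ∧
    (dirStep w d p).2.d - (dirStep w d p).2.u =
      dirExp (newDir d p.1 (dirStep w d p).1.1) - dirExp d := by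
  obtain ⟨h, j⟩ := p
  have hp' : j < (level w h).length := hp
  cases d with
  | true =>
    cases hs : w[h]? with
    | none => simp [level, hs] at hp'
    | some s =>
      rw [level_of_getElem? hs] at hp'
      rw [dirStep_up hs]
      rcases s.enterBelow_spec h hp' with ⟨h1, h2, h3, h4, h5⟩ | ⟨h1, h2, h3, h4, h5⟩
      · have hn : newDir true h (s.enterBelow h j).1.1 = true := by simp [newDir, h1]
        generalize s.enterBelow h j = E at h1 h2 h3 h4 h5 hn ⊢
        obtain ⟨⟨a, b⟩, e⟩ := E
        simp only at h1 h2 h3 h4 h5 hn ⊢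
        subst h1
        rw [hn]
        refine ⟨?_, ?_, ?_, ?_⟩
        · simpa [IsPoint, hw.level_succ hs] using h2
        · simpa [direction, hw.level_succ hs, level_of_getElem? hs] using h3
        · simpa [dirStep_down hs] using h4
        · simpa using h5
      · have hn : newDir true h (s.enterBelow h j).1.1 = false := by simp [newDir, h1]
        generalize s.enterBelow h j = E at h1 h2 h3 h4 h5 hn ⊢
        obtain ⟨⟨a, b⟩, e⟩ := E
        simp only at h1 h2 h3 h4 h5 hn ⊢
        subst h1
        rw [hn]
        refine ⟨?_, ?_, ?_, ?_⟩
        · simpa [IsPoint, level_of_getElem? hs] using h2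
        · simpa [direction, level_of_getElem? hs] using h3
        · simpa [dirStep_up hs] using h4
        · simpa [dirExp] using h5
  | false =>
    cases h with
    | zero => simp [hw.level_zero] at hp'
    | succ h =>
      cases hs : w[h]? with
      | none => 
        rw [level_of_length_le] at hp'
        · simp at hp'
        · simp at hs; omega
      | some s =>
        rw [hw.level_succ hs] at hp'
        rw [dirStep_down hs]
        rcases s.enterAbove_spec h hp' with ⟨h1, h2, h3, h4, h5⟩ | ⟨h1, h2, h3, h4, h5⟩
        · have hn : newDir false (h + 1) (s.enterAbove h j).1.1 = false := by simp [newDir, h1]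
          generalize s.enterAbove h j = E at h1 h2 h3 h4 h5 hn ⊢
          obtain ⟨⟨a, b⟩, e⟩ := E
          simp only at h1 h2 h3 h4 h5 hn ⊢
          subst h1
          rw [hn]
          refine ⟨?_, ?_, ?_, ?_⟩
          · simpa [IsPoint, level_of_getElem? hs] using h2
          · simpa [direction, hw.level_succ hs, level_of_getElem? hs] using h3
          · simpa [dirStep_up hs] using h4
          · simpa using h5
        · have hn : newDir false (h + 1) (s.enterAbove h j).1.1 = true := by simp [newDir, h1]
          generalize s.enterAbove h j = E at h1 h2 h3 h4 h5 hn ⊢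
          obtain ⟨⟨a, b⟩, e⟩ := E
          simp only at h1 h2 h3 h4 h5 hn ⊢
          subst h1
          rw [hn]
          refine ⟨?_, ?_, ?_, ?_⟩
          · simpa [IsPoint, hw.level_succ hs] using h2
          · simpa [direction, hw.level_succ hs] using h3
          · simpa [dirStep_down hs] using h4
          · simpa [dirExp] using h5

section

variable {w : List Slice} (hw : Fits [] w []) {p : ℕ × ℕ}
include hw

theorem isPoint_next (hp : IsPoint w p) : IsPoint w (next w p) := (dirStep_spec hw hp).1

theorem direction_next (hp : IsPoint w p) :
    direction w (next w p) = newDir (direction w p) p.1 (next w p).1 := by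
  have := (dirStep_spec hw (d := direction w p) hp).2.1
  rw [next, step_eq, this]
  simp

/-- Only an extremum contributes, and it contributes the change of vertical direction. So the
difference of the exponents of `T_d` and `T_u` telescopes along the traversal and vanishes on a
whole component, which makes the twist axiom applicable. -/
theorem step_degree (hp : IsPoint w p) :
    (step w p).2.d - (step w p).2.u =
      dirExp (direction w (next w p)) - dirExp (direction w p) := by
  rw [direction_next hw hp]
  exact (dirStep_spec hw (d := direction w p) hp).2.2.2

theorem permOn_next : PermOn {p | IsPoint w p} (next w) := by
  refine ⟨?_, fun p hp => isPoint_next hw hp, ?_⟩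
  · refine Set.Finite.subset ((Finset.range w.length).biUnion fun h =>
      (Finset.range (level w h).length).map ⟨fun j => (h, j), fun a b e => by simpa using e⟩).finite_toSet ?_
    rintro ⟨h, j⟩ hp
    have hp' : j < (level w h).length := hp
    simp only [Finset.coe_biUnion, Set.mem_iUnion]
    refine ⟨h, ?_, Finset.mem_coe.2 (Finset.mem_map.2 ⟨j, Finset.mem_range.2 hp', rfl⟩)⟩
    by_contra hc
    rw [level_of_length_le] at hp'
    · simp at hp'
    · simpa using hc
  -- Stepping from the next point in the direction opposite to its own retraces the step.
  · have key : ∀ p, IsPoint w p → (dirStep w (!direction w (next w p)) (next w p)).1 = p := by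
      intro p hp
      rw [direction_next hw hp]
      exact (dirStep_spec hw (d := direction w p) hp).2.2.1
    intro p hp q hq e
    rw [← key p hp, ← key q hq, e]

/-- From every point the traversal reaches a point at which the diagram goes up. -/
theorem exists_direction_up (hp : IsPoint w p) :
    ∃ t, direction w ((next w)^[t] p) = true := by
  obtain ⟨h, j⟩ := p
  induction h using Nat.strong_induction_on generalizing j with
  | _ h ih =>
    by_cases hd : direction w (h, j) = true
    · exact ⟨0, hd⟩
    · rw [Bool.not_eq_true] at hd
      have h1 := direction_next hw hp
      rw [hd, newDir] at h1
      -- A downward step either turns at a local minimum, after which the direction is up, or loses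
      -- height; the latter cannot go on forever.
      by_cases hle : h ≤ (next w (h, j)).1
      · exact ⟨1, by simpa [hle] using h1⟩
      · obtain ⟨t, ht⟩ := ih (next w (h, j)).1 (by omega) (next w (h, j)).2
          (isPoint_next hw hp)
        exact ⟨t + 1, ht⟩

end

theorem isStartingList_iff {D : OrientedLinkDiagram} {S : List (ℕ × ℕ)} :
    IsStartingList D S ↔ IsTransversal {p | IsPoint D.word p} (next D.word) S :=
  ⟨fun h => ⟨h.isPoint, h.nodup, h.existsUnique⟩, fun h => ⟨h.mem, h.nodup, h.existsUnique⟩⟩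

theorem exists_startingList_up (D : OrientedLinkDiagram) :
    ∃ S, IsStartingList D S ∧ ∀ p ∈ S, direction D.word p = true := by
  obtain ⟨S, h1, h2⟩ := (permOn_next D.fits).exists_transversal
    (A := fun p => direction D.word p = true) fun p hp => exists_direction_up D.fits hp
  exact ⟨S, isStartingList_iff.2 h1, h2⟩

end Diagrams

/-! ### The link scalar as a functional of a product of beads. -/

section Values

open WithConv

variable {k C : Type*} [Field k] [AddCommGroup C] [Module k C] [Coalgebra k C]
variable {R : Type v} [CommRing R] [Algebra k R]

/-- The linear map contributed by an event. -/
def Event.map (χ : ℕ × Bool → WithConv (C →ₗ[k] R)) : Event → WithConv (C →ₗ[k] R)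
  | .line h s => χ (h, s)
  | _ => 1

/-- The bead contributed by an event. -/
def Event.bead (Q : StrictOrientedQuantumCoalgebra k C) (χ : ℕ × Bool → WithConv (C →ₗ[k] R))
    (e : Event) : Bead Q R := ⟨e.map χ, (e.d, e.u)⟩

/-- The crossing line met in an event. -/
def Event.crossingLine : Event → Option (ℕ × Bool)
  | .line h s => some (h, s)
  | _ => none

theorem crossingLines_fst (E : List Event) :
    (crossingLines E).map Prod.fst = E.filterMap Event.crossingLine := by
  induction E with
  | nil => rfl
  | cons e E ih => cases e <;> simp [crossingLines, Event.crossingLine, List.filterMap_cons, ih]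

theorem prod_bead_deg (Q : StrictOrientedQuantumCoalgebra k C)
    (χ : ℕ × Bool → WithConv (C →ₗ[k] R)) (E : List Event) :
    (E.map (Event.bead Q χ)).prod.deg = ((E.map Event.d).sum, (E.map Event.u).sum) := by
  induction E with
  | nil => rfl
  | cons e E ih => simp [ih, Event.bead]

/-- Unrolling the twisted product shifts each crossing line by the total degree of the events after
it, which is what `crossingLines` records; all other events carry the unit. -/
theorem prod_bead_val (Q : StrictOrientedQuantumCoalgebra k C)
    (χ : ℕ × Bool → WithConv (C →ₗ[k] R)) (E : List Event) :
    (E.map (Event.bead Q χ)).prod.val =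
      ((crossingLines E).map fun u => Q.shift u.2 (χ u.1)).prod := by
  induction E with
  | nil => rfl
  | cons e E ih =>
    rw [List.map_cons, List.prod_cons, Bead.mul_val, ih, prod_bead_deg]
    cases e <;> simp [crossingLines, Event.bead, Event.map]

/-- Replace the values of `x` on the list `L` by those of `c`. -/
def overwrite {ι : Type*} [DecidableEq ι] (x c : ι → C) (L : List ι) : ι → C :=
  fun i => if i ∈ L then c i else x i

theorem overwrite_update {ι C : Type*} [DecidableEq ι] (x c : ι → C) {L : List ι} {i : ι}
    (hi : i ∉ L) (v : C) :
    overwrite x (Function.update c i v) (i :: L) = overwrite (Function.update x i v) c L := by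
  funext j
  by_cases hj : j = i
  · subst hj; simp [overwrite, hi]
  · simp [overwrite, hj]

theorem sweedlerLines_cons_cons (Q : StrictOrientedQuantumCoalgebra k C)
    (u u' : (ℕ × Bool) × ℤ × ℤ) (L : List ((ℕ × Bool) × ℤ × ℤ)) (c : C)
    (F : (ℕ × Bool → C) → k) (x : ℕ × Bool → C) :
    sweedlerLines Q (u :: u' :: L) c F x = ∑ i ∈ (ℛ k c).index,
      sweedlerLines Q (u' :: L) ((ℛ k c).right i) F
        (Function.update x u.1 (Q.powEquiv u.2 ((ℛ k c).left i))) := rfl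

/-- Each line takes one leg of the coproduct, and its value is absorbed into the functional and into
the assignment `x`. Since `sweedlerLines` stops splitting at the last line there are three cases.
Only an empty list leaves a counit behind, which becomes a factor of `omega`. The element `Z` stands
for the components still to come. -/
theorem functional_eq_sweedlerLines (Q : StrictOrientedQuantumCoalgebra k C)
    (χ : ℕ × Bool → WithConv (C →ₗ[k] R)) (cp F : (ℕ × Bool → C) → k) (Z : R) (ω : k)
    (Lr : List (ℕ × Bool))
    (hF : ∀ (y : ℕ × Bool → C) (Ψ : R →ₗ[k] k),
      (∀ c : ℕ × Bool → C, Ψ ((Lr.map fun u => χ u (c u)).prod) = cp (overwrite y c Lr)) →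
      Ψ Z = ω * F y)
    (L : List ((ℕ × Bool) × ℤ × ℤ)) (hnd : (L.map Prod.fst ++ Lr).Nodup) (c₀ : C)
    (x : ℕ × Bool → C) (Φ : R →ₗ[k] k)
    (hΦ : ∀ c : ℕ × Bool → C, Φ (((L.map Prod.fst ++ Lr).map fun u => χ u (c u)).prod) =
      cp (overwrite x c (L.map Prod.fst ++ Lr))) :
    Φ ((L.map fun u => Q.shift u.2 (χ u.1)).prod c₀ * Z) =
      (if L.isEmpty then counit (R := k) c₀ else 1) * ω * sweedlerLines Q L c₀ F x := by
  induction L generalizing c₀ x Φ with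
  | nil =>
    have := hF x Φ hΦ
    simp only [List.map_nil, List.prod_nil, LinearMap.convOne_apply, ← Algebra.smul_def, map_smul,
      this, List.isEmpty_nil, if_true, smul_eq_mul, mul_assoc]
    rfl
  | cons u L ih =>
    simp only [List.map_cons, List.cons_append, List.nodup_cons] at hnd
    have step : ∀ v : C, ∀ c : ℕ × Bool → C,
        (Φ ∘ₗ LinearMap.mulLeft k (χ u.1 v))
          (((L.map Prod.fst ++ Lr).map fun u => χ u (c u)).prod) =
        cp (overwrite (Function.update x u.1 v) c (L.map Prod.fst ++ Lr)) := by
      intro v c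
      have := hΦ (Function.update c u.1 v)
      rw [List.map_cons, List.cons_append, overwrite_update _ _ hnd.1, List.map_cons,
        List.prod_cons, Function.update_self] at this
      rw [← this, LinearMap.comp_apply, LinearMap.mulLeft_apply]
      congr 3
      refine List.map_congr_left fun z hz => ?_
      rw [Function.update_of_ne]
      rintro rfl
      exact hnd.1 hz
    cases L with
    | nil =>
      have := hF _ _ (step (Q.powEquiv u.2 c₀))
      simp only [List.map_cons, List.map_nil, List.prod_cons, List.prod_nil, mul_one,
        List.isEmpty_cons, Bool.false_eq_true, if_false, one_mul]
      exact this
    | cons u' L =>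
      rw [sweedlerLines_cons_cons, List.map_cons, List.prod_cons, (ℛ k c₀).convMul_apply,
        Finset.sum_mul, map_sum, Finset.mul_sum]
      refine Finset.sum_congr rfl fun i _ => ?_
      have := ih hnd.2 ((ℛ k c₀).right i) _ _ (step (Q.powEquiv u.2 ((ℛ k c₀).left i)))
      simp only [List.isEmpty_cons, Bool.false_eq_true, if_false, one_mul] at this ⊢
      rw [← this, LinearMap.comp_apply, LinearMap.mulLeft_apply, mul_assoc]
      rfl

/-! ### Models of the crossing product -/

/-- The product of the values at the two lines of the crossing in a slice. -/
def lineProduct (χ : ℕ × Bool → WithConv (C →ₗ[k] R)) (w : List Slice) (c : ℕ × Bool → C)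
    (h : ℕ) : R :=
  match (w[h]?).map Slice.piece with
  | some (.cross _ _ _) => χ (h, true) (c (h, true)) * χ (h, false) (c (h, false))
  | _ => 1

/-- A commutative algebra with a linear functional which represents the product of the factors of
all crossings of `w` as a product of linear maps, one for each crossing line. -/
structure Model (Q : StrictOrientedQuantumCoalgebra k C) (w : List Slice) where
  R : Type v
  [commRing : CommRing R]
  [algebra : Algebra k R]
  χ : ℕ × Bool → WithConv (C →ₗ[k] R)
  Φ : R →ₗ[k] k
  pure : ∀ c : ℕ × Bool → C,
    Φ (∏ h ∈ Finset.range w.length, lineProduct χ w c h) = crossingProduct Q w c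

attribute [instance] Model.commRing Model.algebra

/-- Whether the slice with index `h` contains a crossing. -/
def isCrossing (w : List Slice) (h : ℕ) : Bool :=
  match (w[h]?).map Slice.piece with
  | some (.cross _ _ _) => true
  | _ => false

/-- The crossing lines of `w`. -/
def crossingSet (w : List Slice) : Finset (ℕ × Bool) :=
  (Finset.range w.length ×ˢ Finset.univ).filter fun u => isCrossing w u.1

theorem prod_crossingSet (χ : ℕ × Bool → WithConv (C →ₗ[k] R)) (w : List Slice)
    (c : ℕ × Bool → C) :
    ∏ u ∈ crossingSet w, χ u (c u) = ∏ h ∈ Finset.range w.length, lineProduct χ w c h := by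
  rw [crossingSet, Finset.prod_filter, Finset.prod_product]
  refine Finset.prod_congr rfl fun h _ => ?_
  simp only [Fintype.univ_bool]
  rw [Finset.prod_pair (by decide)]
  rcases hp : (w[h]?).map Slice.piece with _ | (_ | _ | _) <;>
    simp [isCrossing, lineProduct, hp, -Option.map_eq_some_iff, -Option.map_eq_none_iff]

theorem crossingProduct_congr (Q : StrictOrientedQuantumCoalgebra k C) (w : List Slice)
    {x y : ℕ × Bool → C} (h : ∀ u ∈ crossingSet w, x u = y u) :
    crossingProduct Q w x = crossingProduct Q w y := by
  refine Finset.prod_congr rfl fun i hi => ?_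
  rcases hp : (w[i]?).map Slice.piece with _ | (_ | _ | ⟨o, a, b⟩) <;> try rfl
  dsimp only
  rw [h, h]
  · exact Finset.mem_filter.2 ⟨by simpa using hi, by simp only [isCrossing, hp]⟩
  · exact Finset.mem_filter.2 ⟨by simpa using hi, by simp only [isCrossing, hp]⟩

/-! ### The crossing lines met by the traversal -/

/-- The point at which the traversal meets a crossing line. -/
def linePoint (w : List Slice) (u : ℕ × Bool) : ℕ × ℕ :=
  match w[u.1]? with
  | some ⟨l, .cross _ a b, _⟩ =>
    if u.2 then (if a then (u.1, l.length) else (u.1 + 1, l.length + 1))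
    else (if b then (u.1, l.length + 1) else (u.1 + 1, l.length))
  | _ => (0, 0)

theorem mem_crossingSet {w : List Slice} {u : ℕ × Bool} :
    u ∈ crossingSet w ↔ ∃ l o a b r, w[u.1]? = some ⟨l, .cross o a b, r⟩ := by
  simp only [crossingSet, Finset.mem_filter, Finset.mem_product, Finset.mem_range,
    Finset.mem_univ, and_true]
  constructor
  · rintro ⟨-, h⟩
    rcases hs : w[u.1]? with _ | ⟨l, _ | _ | ⟨o, a, b⟩, r⟩ <;> simp [isCrossing, hs] at h ⊢
  · rintro ⟨l, o, a, b, r, h⟩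
    exact ⟨(List.getElem?_eq_some_iff.1 h).1, by simp [isCrossing, h]⟩

/-- A crossing line is entered from below or from above according to its direction, so exactly one
point of the diagram precedes it. This identifies crossing lines with the points where they are met.
-/
theorem crossingLine_step_iff {w : List Slice} (hw : Fits [] w []) {p : ℕ × ℕ} (hp : IsPoint w p)
    (u : ℕ × Bool) :
    (step w p).2.crossingLine = some u ↔ u ∈ crossingSet w ∧ linePoint w u = p := by
  obtain ⟨h, j⟩ := p
  obtain ⟨i, t⟩ := u
  constructor
  · intro hu
    rw [step_eq] at hu
    cases hd : direction w (h, j) with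
    | true =>
      rw [hd] at hu
      cases hs : w[h]? with
      | none => simp [dirStep, hs, Event.crossingLine] at hu
      | some s =>
        rw [dirStep_up hs] at hu
        have hd' : s.bot.getD j false = true := by
          simpa [direction, level_of_getElem? hs] using hd
        obtain ⟨l, p, r⟩ := s
        rcases p with _ | _ | ⟨o, a, b⟩
        · simp only [Slice.enterBelow] at hu
          split_ifs at hu <;> simp [Event.crossingLine] at hu
        · simp only [Slice.enterBelow] at hu
          split_ifs at hu <;> simp [Event.crossingLine] at hu
        · simp only [Slice.enterBelow] at hu
          split_ifs at hu with h1 h2 h3 <;> simp [Event.crossingLine] at hu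
          · obtain ⟨rfl, rfl⟩ := hu
            subst h2
            simp [Slice.bot, Piece.bot] at hd'
            exact ⟨mem_crossingSet.2 ⟨_, _, _, _, _, hs⟩, by simp [linePoint, hs, hd']⟩
          · obtain ⟨rfl, rfl⟩ := hu
            subst h3
            simp [Slice.bot, Piece.bot] at hd'
            exact ⟨mem_crossingSet.2 ⟨_, _, _, _, _, hs⟩, by simp [linePoint, hs, hd']⟩
    | false =>
      rw [hd] at hu
      cases h with
      | zero => simp [dirStep, Event.crossingLine] at hu
      | succ h =>
      cases hs : w[h]? with
      | none => simp [dirStep, hs, Event.crossingLine] at hu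
      | some s =>
        rw [dirStep_down hs] at hu
        have hd' : s.top.getD j false = false := by
          simpa [direction, hw.level_succ hs] using hd
        obtain ⟨l, p, r⟩ := s
        rcases p with _ | _ | ⟨o, a, b⟩
        · simp only [Slice.enterAbove] at hu
          split_ifs at hu <;> simp [Event.crossingLine] at hu
        · simp only [Slice.enterAbove] at hu
          split_ifs at hu <;> simp [Event.crossingLine] at hu
        · simp only [Slice.enterAbove] at hu
          split_ifs at hu with h1 h2 h3 <;> simp [Event.crossingLine] at hu
          · obtain ⟨rfl, rfl⟩ := hu
            subst h2
            simp [Slice.top, Piece.top] at hd'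
            exact ⟨mem_crossingSet.2 ⟨_, _, _, _, _, hs⟩, by simp [linePoint, hs, hd']⟩
          · obtain ⟨rfl, rfl⟩ := hu
            subst h3
            simp [Slice.top, Piece.top] at hd'
            exact ⟨mem_crossingSet.2 ⟨_, _, _, _, _, hs⟩, by simp [linePoint, hs, hd']⟩
  · rintro ⟨hu, he⟩
    obtain ⟨l, o, a, b, r, hs⟩ := mem_crossingSet.1 hu
    dsimp only at hs
    rw [← he]
    cases t <;> cases a <;> cases b <;>
      simp [linePoint, hs, step, direction, level_of_getElem? hs, hw.level_succ hs, Slice.bot,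
        Slice.top, Piece.bot, Piece.top, Slice.enterBelow, Slice.enterAbove, Event.crossingLine]

theorem linePoint_isPoint {w : List Slice} (hw : Fits [] w []) {u : ℕ × Bool}
    (hu : u ∈ crossingSet w) : IsPoint w (linePoint w u) := by
  obtain ⟨l, o, a, b, r, hs⟩ := mem_crossingSet.1 hu
  obtain ⟨h, t⟩ := u
  dsimp only at hs
  cases t <;> cases a <;> cases b <;>
    simp [linePoint, hs, IsPoint, level_of_getElem? hs, hw.level_succ hs, Slice.bot,
      Slice.top, Piece.bot, Piece.top]

/-- Each point lies on the cycle of exactly one starting point, and different crossing lines are met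
at different points. So the state sum assigns a tensor factor to each line exactly once. -/
theorem crossingLines_of_transversal {w : List Slice} (hw : Fits [] w []) {S : List (ℕ × ℕ)}
    (hS : IsTransversal {p | IsPoint w p} (next w) S) :
    (S.flatMap fun p => (crossingLines (events w p)).map Prod.fst).Nodup ∧
      ∀ u, u ∈ (S.flatMap fun p => (crossingLines (events w p)).map Prod.fst) ↔
        u ∈ crossingSet w := by
  have e : (S.flatMap fun p => (crossingLines (events w p)).map Prod.fst) =
      (S.flatMap (cycleList (next w))).filterMap fun p => (step w p).2.crossingLine := by
    rw [List.filterMap_flatMap]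
    congr 1
    funext p
    rw [crossingLines_fst, events, cycleList, List.filterMap_map, List.filterMap_map]
    rfl
  obtain ⟨h1, h2⟩ := (permOn_next hw).flatMap_cycleList hS
  rw [e]
  refine ⟨?_, fun u => ?_⟩
  · rw [List.Nodup, List.pairwise_filterMap]
    refine List.Pairwise.imp_of_mem ?_ h1
    rintro p q hp hq hne u hu _ hu' rfl
    exact hne (((crossingLine_step_iff hw ((h2 p).1 hp) u).1 hu).2.symm.trans
      ((crossingLine_step_iff hw ((h2 q).1 hq) u).1 hu').2)
  · rw [List.mem_filterMap]
    constructor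
    · rintro ⟨p, hp, hu⟩
      exact ((crossingLine_step_iff hw ((h2 p).1 hp) u).1 hu).1
    · intro hu
      have := linePoint_isPoint hw hu
      exact ⟨_, (h2 _).2 this, (crossingLine_step_iff hw this u).2 ⟨hu, rfl⟩⟩

/-! ### The scalar as a value of a functional -/

theorem pathProd_deg {Q : StrictOrientedQuantumCoalgebra k C}
    {P : Type*} {X : Set P} {σ : P → P} (h : PermOn X σ) {lab : P → Bead Q R} {dir : P → Bool}
    (hdeg : ∀ p ∈ X, (lab p).deg.1 - (lab p).deg.2 = dirExp (dir (σ p)) - dirExp (dir p))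
    {p : P} (hp : p ∈ X) (n : ℕ) :
    (pathProd σ lab p n).deg.1 - (pathProd σ lab p n).deg.2 =
      dirExp (dir (σ^[n] p)) - dirExp (dir p) := by
  induction n with
  | zero => simp
  | succ n ih =>
    have := hdeg _ (h.iterate_mem hp n)
    rw [pathProd_add, pathProd_one, Function.iterate_succ_apply', Bead.mul_deg, Prod.fst_add,
      Prod.snd_add]
    omega

/-- The product of the contributions of the cycles does not depend on the transversal. -/
theorem prod_close_transversal_eq (Q : TwistOrientedQuantumCoalgebra k C) {c : C}
    (hc : IsCocommutative k c)
    {P : Type*} {X : Set P} {σ : P → P} (h : PermOn X σ)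
    {lab : P → Bead Q.toStrictOrientedQuantumCoalgebra R} {dir : P → Bool}
    (hdeg : ∀ p ∈ X, (lab p).deg.1 - (lab p).deg.2 = dirExp (dir (σ p)) - dirExp (dir p))
    {S S' : List P} (hS : IsTransversal X σ S) (hS' : IsTransversal X σ S') :
    (S.map fun p => Q.close c (dir p) (cycleProd σ lab p)).prod =
      (S'.map fun p => Q.close c (dir p) (cycleProd σ lab p)).prod := by
  refine h.prod_transversal_eq (fun p hp => ?_) hS hS'
  obtain ⟨L, h1, h2⟩ := h.exists_cycleList hp
  have h3 := pathProd_deg h hdeg hp (Function.minimalPeriod σ p)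
  rw [Function.iterate_minimalPeriod, sub_self] at h3
  have h4 : cycleProd σ lab p = lab p * (L.map lab).prod := by
    rw [cycleProd_eq, h1, List.map_cons, List.prod_cons]
  have h5 : cycleProd σ lab (σ p) = (L.map lab).prod * lab p := by
    rw [cycleProd_eq, h2]; simp
  rw [h5, h4]
  refine (Q.close_mul_comm hc (hdeg p hp) ?_).symm
  rw [← h4]
  exact sub_eq_zero.1 h3

theorem clockwise_eq (e : Event) : e.clockwise = -(e.d + e.u) := by
  rcases e with _ | _ | (_ | _) | (_ | _) <;> rfl

theorem cycleProd_step (Q : StrictOrientedQuantumCoalgebra k C)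
    (χ : ℕ × Bool → WithConv (C →ₗ[k] R)) (w : List Slice) (p : ℕ × ℕ) :
    cycleProd (next w) (fun q => (step w q).2.bead Q χ) p =
      ((events w p).map (Event.bead Q χ)).prod := by
  rw [cycleProd, pathProd, events, List.map_map]; rfl

theorem step_bead_deg (Q : StrictOrientedQuantumCoalgebra k C)
    (χ : ℕ × Bool → WithConv (C →ₗ[k] R)) {w : List Slice} (hw : Fits [] w []) (p : ℕ × ℕ)
    (hp : p ∈ {p | IsPoint w p}) :
    ((step w p).2.bead Q χ).deg.1 - ((step w p).2.bead Q χ).deg.2 =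
      dirExp (direction w (next w p)) - dirExp (direction w p) := step_degree hw hp

/-- A clockwise extremum is counted by `-(d + u)`, and on a closed component the totals of `d` and
`u` agree. So the division by `2` is exact, and the power of `G` can be read off from the degree of
the bead product. -/
theorem whitneyDegree_eq {w : List Slice} (hw : Fits [] w []) {p : ℕ × ℕ} (hp : IsPoint w p) :
    whitneyDegree w p = -((events w p).map Event.d).sum := by
  have h1 : ((events w p).map Event.clockwise).sum =
      -(((events w p).map Event.d).sum + ((events w p).map Event.u).sum) := by
    generalize events w p = E
    induction E with
    | nil => rfl
    | cons e E ih => simp [ih, clockwise_eq]; ring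
  have h2 : ((events w p).map Event.d).sum - ((events w p).map Event.u).sum = 0 := by
    have hper : (next w)^[Function.minimalPeriod (next w) p] p = p :=
      Function.iterate_minimalPeriod
    have key : ∀ n, (((List.range n).map fun t => (step w ((next w)^[t] p)).2).map Event.d).sum -
        (((List.range n).map fun t => (step w ((next w)^[t] p)).2).map Event.u).sum =
        dirExp (direction w ((next w)^[n] p)) - dirExp (direction w p) := by
      intro n
      induction n with
      | zero => simp
      | succ n ih =>
        have := step_degree hw ((permOn_next hw).iterate_mem hp n)
        rw [Function.iterate_succ_apply']
        simp only [List.range_succ, List.map_append, List.sum_append, List.map_cons, List.map_nil,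
          List.sum_cons, List.sum_nil] at ih ⊢
        omega
    have := key (Function.minimalPeriod (next w) p)
    rw [hper, sub_self] at this
    exact this
  rw [whitneyDegree, h1]
  omega

theorem close_true_events (Q : TwistOrientedQuantumCoalgebra k C) (c : C)
    (χ : ℕ × Bool → WithConv (C →ₗ[k] R)) {w : List Slice} (hw : Fits [] w []) {p : ℕ × ℕ}
    (hp : IsPoint w p) :
    Q.close c true ((events w p).map (Event.bead Q.toStrictOrientedQuantumCoalgebra χ)).prod =
      ((crossingLines (events w p)).map fun u => Q.shift u.2 (χ u.1)).prod
        (actR c (twistPower Q w p)) := by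
  have h0 : ((0 : ℤ), dirExp true) = 0 := rfl
  rw [TwistOrientedQuantumCoalgebra.close, h0, Q.shift_zero, Q.unitG_zpow, scalarExt_mul_apply,
    prod_bead_val, prod_bead_deg, twistPower, whitneyDegree_eq hw hp]

/-- This is why a component without crossing lines contributes `G^d(c)`. -/
theorem counit_actR (c : C) (g : WithConv (C →ₗ[k] k)) : counit (R := k) (actR c g) = g c := by
  have := scalarExt_mul_apply (R := k) g 1 c
  rw [mul_one, LinearMap.convOne_apply] at this
  simpa [scalarExt, Algebra.ofId_apply] using this.symm

/-- Components are peeled off one at a time; the one-component statement passes a new functional and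
a new assignment to the induction hypothesis, so both stay general. -/
theorem functional_eq_sumOfProducts (Q : TwistOrientedQuantumCoalgebra k C) (c : C)
    (χ : ℕ × Bool → WithConv (C →ₗ[k] R)) {w : List Slice} (hw : Fits [] w []) (S : List (ℕ × ℕ))
    (hS : ∀ p ∈ S, IsPoint w p)
    (hnd : (S.flatMap fun p => (crossingLines (events w p)).map Prod.fst).Nodup)
    (x : ℕ × Bool → C) (Φ : R →ₗ[k] k)
    (hΦ : ∀ y : ℕ × Bool → C,
      Φ (((S.flatMap fun p => (crossingLines (events w p)).map Prod.fst).map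
        fun u => χ u (y u)).prod) =
      crossingProduct Q.toStrictOrientedQuantumCoalgebra w
        (overwrite x y (S.flatMap fun p => (crossingLines (events w p)).map Prod.fst))) :
    Φ ((S.map fun p => Q.close c true
      ((events w p).map (Event.bead Q.toStrictOrientedQuantumCoalgebra χ)).prod).prod) =
      omega Q c w S * sumOfProducts Q c w S x := by
  induction S generalizing x Φ with
  | nil =>
    have := hΦ x
    simp only [List.flatMap_nil, List.map_nil, List.prod_nil] at this ⊢
    rw [this]
    have h0 : overwrite x x ([] : List (ℕ × Bool)) = x := by funext i; simp [overwrite]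
    simp [omega, sumOfProducts, h0]
  | cons p S ih =>
    rw [List.flatMap_cons] at hnd hΦ
    rw [List.map_cons, List.prod_cons, close_true_events Q c χ hw (hS p (by simp))]
    have := functional_eq_sweedlerLines Q.toStrictOrientedQuantumCoalgebra χ
      (crossingProduct Q.toStrictOrientedQuantumCoalgebra w) (sumOfProducts Q c w S) _
      (omega Q c w S) _
      (fun y Ψ hΨ => ih (fun q hq => hS q (List.mem_cons_of_mem _ hq)) hnd.of_append_right y Ψ hΨ)
      (crossingLines (events w p)) hnd (actR c (twistPower Q w p)) x Φ hΦ
    rw [this, counit_actR]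
    rfl

/-- The scalar computed from any starting points, with directions disregarded. -/
theorem linkScalar_eq (Q : TwistOrientedQuantumCoalgebra k C) (c : C) {D : OrientedLinkDiagram}
    (m : Model.{v} Q.toStrictOrientedQuantumCoalgebra D.word)
    {S : List (ℕ × ℕ)} (hS : IsStartingList D S) :
    linkScalar Q c D S = m.Φ ((S.map fun p => Q.close c true (cycleProd (next D.word)
      (fun q => (step D.word q).2.bead Q.toStrictOrientedQuantumCoalgebra m.χ) p)).prod) := by
  obtain ⟨h1, h2⟩ := crossingLines_of_transversal D.fits (isStartingList_iff.1 hS)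
  simp only [cycleProd_step]
  rw [functional_eq_sumOfProducts Q c m.χ D.fits S hS.isPoint h1 0 m.Φ, linkScalar]
  intro y
  rw [← List.prod_toFinset _ h1]
  have h3 : (S.flatMap fun p => (crossingLines (events D.word p)).map Prod.fst).toFinset =
      crossingSet D.word := by
    ext u; rw [List.mem_toFinset, h2]
  rw [h3, prod_crossingSet, m.pure]
  refine crossingProduct_congr _ _ fun u hu => ?_
  rw [overwrite, if_pos ((h2 u).2 hu)]

end Values

/-! ### Downward strands as co-opposite coalgebras, and convolution algebras of forms. -/

section Forms

open WithConv

variable {k C : Type*} [Field k] [AddCommGroup C] [Module k C] [Coalgebra k C]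

/-! ### Strands of either direction -/

/-- The coalgebra `C` for `a = true`, its co-opposite for `a = false`. -/
def Strand (_a : Bool) (C : Type*) : Type _ := C

instance (a : Bool) : AddCommGroup (Strand a C) := inferInstanceAs (AddCommGroup C)
instance (a : Bool) : Module k (Strand a C) := inferInstanceAs (Module k C)

/-- Reversing all three tensor factors exchanges the two sides of coassociativity when `Δ` is
replaced by its opposite. -/
theorem coassoc_comm (x : C) :
    TensorProduct.assoc k C C C (LinearMap.rTensor C ((TensorProduct.comm k C C).toLinearMap ∘ₗ comul)
      (TensorProduct.comm k C C (comul (R := k) x))) =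
    LinearMap.lTensor C ((TensorProduct.comm k C C).toLinearMap ∘ₗ comul)
      (TensorProduct.comm k C C (comul (R := k) x)) := by
  let rev : C ⊗[k] (C ⊗[k] C) →ₗ[k] C ⊗[k] (C ⊗[k] C) :=
    (TensorProduct.assoc k C C C).toLinearMap ∘ₗ
      (TensorProduct.comm k C (C ⊗[k] C)).toLinearMap ∘ₗ
        LinearMap.lTensor C (TensorProduct.comm k C C).toLinearMap
  have h := congrArg rev (coassoc_apply (R := k) x)
  have h1 : ∀ t : C ⊗[k] C, rev (LinearMap.lTensor C comul t) =
      TensorProduct.assoc k C C C (LinearMap.rTensor C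
        ((TensorProduct.comm k C C).toLinearMap ∘ₗ comul) (TensorProduct.comm k C C t)) := by
    intro t
    induction t with
    | zero => simp
    | add s t hs ht => simp only [map_add, hs, ht]
    | tmul u v => simp [rev]
  have h2 : ∀ t : C ⊗[k] C, rev (TensorProduct.assoc k C C C (LinearMap.rTensor C comul t)) =
      LinearMap.lTensor C ((TensorProduct.comm k C C).toLinearMap ∘ₗ comul)
        (TensorProduct.comm k C C t) := by
    intro t
    induction t with
    | zero => simp
    | add s t hs ht => simp only [map_add, hs, ht]
    | tmul u v =>
      simp only [LinearMap.rTensor_tmul, TensorProduct.comm_tmul, LinearMap.lTensor_tmul,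
        LinearMap.comp_apply, LinearEquiv.coe_coe]
      induction comul (R := k) u with
      | zero => simp
      | add s t hs ht => simp only [map_add, TensorProduct.add_tmul, TensorProduct.tmul_add, hs, ht]
      | tmul y z => simp [rev]
  rw [h1, h2] at h
  exact h.symm

instance strandCoalgebra (a : Bool) : Coalgebra k (Strand a C) where
  comul := match a with
    | true => (comul : C →ₗ[k] C ⊗[k] C)
    | false => (TensorProduct.comm k C C).toLinearMap ∘ₗ (comul : C →ₗ[k] C ⊗[k] C)
  counit := (counit : C →ₗ[k] k)
  coassoc := match a with
    | true => (coassoc (R := k) (A := C))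
    | false => LinearMap.ext fun x => coassoc_comm (k := k) (C := C) x
  rTensor_counit_comp_comul := match a with
    | true => (rTensor_counit_comp_comul (R := k) (A := C))
    | false => LinearMap.ext fun (x : C) => by
      change LinearMap.rTensor C (counit (R := k)) (TensorProduct.comm k C C (comul (R := k) x)) =
        (1 : k) ⊗ₜ[k] x
      rw [← LinearMap.comm_comp_lTensor_comp_comm_eq]
      simp
  lTensor_counit_comp_comul := match a with
    | true => (lTensor_counit_comp_comul (R := k) (A := C))
    | false => LinearMap.ext fun (x : C) => by
      change LinearMap.lTensor C (counit (R := k)) (TensorProduct.comm k C C (comul (R := k) x)) =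
        x ⊗ₜ[k] (1 : k)
      rw [← LinearMap.comm_comp_rTensor_comp_comm_eq]
      simp

/-- The lower one of two consecutive tensor factors on a strand of direction `a`. -/
def lo (k : Type*) {C : Type*} [Field k] [AddCommGroup C] [Module k C] [Coalgebra k C] (a : Bool)
    (x : C) (i : C × C) : C := match a with
  | true => (ℛ k x).left i
  | false => (ℛ k x).right i

/-- The upper one of two consecutive tensor factors on a strand of direction `a`. -/
def up (k : Type*) {C : Type*} [Field k] [AddCommGroup C] [Module k C] [Coalgebra k C] (a : Bool)
    (x : C) (i : C × C) : C := match a with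
  | true => (ℛ k x).right i
  | false => (ℛ k x).left i

/-- The coproduct of an element of a strand, lower factor first. -/
def strandRepr (a : Bool) (x : C) : Coalgebra.Repr k (A := Strand a C) x (C × C) where
  index := (ℛ k x).index
  left := lo k a x
  right := up k a x
  eq := match a with
    | true => (ℛ k x).eq
    | false => by
      change ∑ i ∈ (ℛ k x).index, (ℛ k x).right i ⊗ₜ[k] (ℛ k x).left i =
        TensorProduct.comm k C C (comul (R := k) x)
      rw [← (ℛ k x).eq, map_sum]
      rfl

/-! ### Convolution algebras of forms -/

section Embeddings

/-- The convolution algebra of linear maps from a coalgebra to an algebra. -/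
def Conv (k X A : Type*) [Field k] [AddCommGroup X] [Module k X] [Coalgebra k X] [Ring A]
    [Algebra k A] : Type _ := WithConv (X →ₗ[k] A)

section

variable {X A : Type*} [AddCommGroup X] [Module k X] [Coalgebra k X] [Ring A] [Algebra k A]

instance : Ring (Conv k X A) := inferInstanceAs (Ring (WithConv (X →ₗ[k] A)))
instance : Algebra k (Conv k X A) := inferInstanceAs (Algebra k (WithConv (X →ₗ[k] A)))

/-- A linear map as an element of the convolution algebra. -/
def Conv.of : (X →ₗ[k] A) ≃ₗ[k] Conv k X A := (WithConv.linearEquiv k (X →ₗ[k] A)).symm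

instance : CoeFun (Conv k X A) fun _ => X → A := ⟨fun f => Conv.of.symm f⟩

@[ext] theorem Conv.ext {f g : Conv k X A} (h : ∀ x, f x = g x) : f = g :=
  Conv.of.symm.injective (LinearMap.ext h)

theorem Conv.mul_apply {ι : Type*} {x : X} (r : Coalgebra.Repr k x ι) (f g : Conv k X A) :
    (f * g) x = ∑ i ∈ r.index, f (r.left i) * g (r.right i) :=
  r.convMul_apply (f : WithConv (X →ₗ[k] A)) g

theorem Conv.one_apply (x : X) : (1 : Conv k X A) x = counit (R := k) x • (1 : A) :=
  Algebra.algebraMap_eq_smul_one _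

end

variable {X Y Z : Type*} [AddCommGroup X] [Module k X] [Coalgebra k X]
  [AddCommGroup Y] [Module k Y] [Coalgebra k Y] [AddCommGroup Z] [Module k Z] [Coalgebra k Z]
  {A B : Type*} [Ring A] [Algebra k A] [Ring B] [Algebra k B]

/-- Composition of linear maps with an algebra homomorphism. -/
def convMap (X : Type*) [AddCommGroup X] [Module k X] [Coalgebra k X] (g : A →ₐ[k] B) :
    Conv k X A →ₐ[k] Conv k X B :=
  AlgHom.ofLinearMap
    (Conv.of.toLinearMap ∘ₗ LinearMap.compRight k g.toLinearMap ∘ₗ Conv.of.symm.toLinearMap)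
    (by
      ext x
      change g ((1 : Conv k X A) x) = _
      rw [Conv.one_apply, Conv.one_apply, map_smul, map_one])
    (fun f h => by
      ext x
      change g ((f * h) x) = _
      rw [Conv.mul_apply (ℛ k x), Conv.mul_apply (ℛ k x), map_sum]
      simp only [map_mul]
      rfl)

theorem convMap_apply (g : A →ₐ[k] B) (f : Conv k X A) (x : X) :
    convMap X g f x = g (f x) := rfl

theorem sum_counit_mul_counit (x : X) :
    ∑ i ∈ (ℛ k x).index, counit (R := k) ((ℛ k x).left i) * counit (R := k) ((ℛ k x).right i) =
      counit (R := k) x := by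
  have := congrArg (counit (R := k)) (sum_counit_smul (ℛ k x))
  simpa using this

/-- The maps `x ↦ ε(x) a`. -/
def convConst (X : Type*) [AddCommGroup X] [Module k X] [Coalgebra k X] :
    A →ₐ[k] Conv k X A :=
  AlgHom.ofLinearMap
    (Conv.of.toLinearMap ∘ₗ (LinearMap.smulRightₗ (counit : X →ₗ[k] k)))
    (by
      ext x
      rw [Conv.one_apply]
      rfl)
    (fun a b => by
      ext x
      rw [Conv.mul_apply (ℛ k x)]
      change counit (R := k) x • (a * b) = ∑ i ∈ (ℛ k x).index,
        counit (R := k) ((ℛ k x).left i) • a * counit (R := k) ((ℛ k x).right i) • b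
      simp only [smul_mul_smul_comm, ← Finset.sum_smul, sum_counit_mul_counit])

theorem convConst_apply (a : A) (x : X) :
    (convConst X a : Conv k X A) x = counit (R := k) x • a := rfl

theorem mul_convConst_apply (f : Conv k X A) (a : A) (x : X) :
    (f * convConst X a : Conv k X A) x = f x * a := by
  conv_rhs => rw [← mul_one f, Conv.mul_apply (ℛ k x)]
  rw [Conv.mul_apply (ℛ k x), Finset.sum_mul]
  refine Finset.sum_congr rfl fun i _ => ?_
  rw [mul_assoc, Conv.one_apply, convConst_apply, smul_one_mul]

theorem convConst_mul_apply (f : Conv k X A) (a : A) (x : X) :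
    (convConst X a * f : Conv k X A) x = a * f x := by
  conv_rhs => rw [← one_mul f, Conv.mul_apply (ℛ k x)]
  rw [Conv.mul_apply (ℛ k x), Finset.mul_sum]
  refine Finset.sum_congr rfl fun i _ => ?_
  rw [← mul_assoc, Conv.one_apply, convConst_apply, mul_smul_one]

/-- A bilinear form as an element of the convolution algebra of two strands. -/
def form (β : X →ₗ[k] Y →ₗ[k] k) : Conv k X (Conv k Y k) := Conv.of (Conv.of.toLinearMap ∘ₗ β)

/-- A form on the first two of three strands. -/
def emb₁₂ (Z : Type*) [AddCommGroup Z] [Module k Z] [Coalgebra k Z] :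
    Conv k X (Conv k Y k) →ₐ[k] Conv k X (Conv k Y (Conv k Z k)) :=
  convMap X (convMap Y (convConst Z))

/-- A form on the outer two of three strands. -/
def emb₁₃ (Y : Type*) [AddCommGroup Y] [Module k Y] [Coalgebra k Y] :
    Conv k X (Conv k Z k) →ₐ[k] Conv k X (Conv k Y (Conv k Z k)) :=
  convMap X (convConst Y)

/-- A form on the last two of three strands. -/
def emb₂₃ (X : Type*) [AddCommGroup X] [Module k X] [Coalgebra k X] :
    Conv k Y (Conv k Z k) →ₐ[k] Conv k X (Conv k Y (Conv k Z k)) :=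
  convConst X

section Evaluation

variable (f : Conv k X (Conv k Y k)) (g : Conv k X (Conv k Z k)) (h : Conv k Y (Conv k Z k))
  {ι : Type*} {x : X} {y : Y} {z : Z} (p : Coalgebra.Repr k x ι) (q : Coalgebra.Repr k y ι)
  (r : Coalgebra.Repr k z ι)

theorem Conv.sum_apply {κ : Type*} (s : Finset κ) (F : κ → Conv k X A) (x : X) :
    (∑ i ∈ s, F i) x = ∑ i ∈ s, F i x := by
  rw [map_sum, LinearMap.sum_apply]

/-- In any order of the three embedded forms each strand splits into two legs, and the form which
comes first receives the first one. The variants that follow differ only in this distribution of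
legs. -/
theorem eval_12_13_23 : (emb₁₂ Z f * emb₁₃ Y g * emb₂₃ X h) x y z =
    ∑ i ∈ p.index, ∑ j ∈ q.index, ∑ l ∈ r.index, f (p.left i) (q.left j) *
      g (p.right i) (r.left l) * h (q.right j) (r.right l) := by
  rw [emb₂₃, mul_convConst_apply, Conv.mul_apply p, Finset.sum_mul, Conv.sum_apply,
    Conv.sum_apply]
  refine Finset.sum_congr rfl fun i _ => ?_
  rw [emb₁₃, convMap_apply, Conv.mul_apply q, Conv.sum_apply]
  refine Finset.sum_congr rfl fun j _ => ?_
  rw [mul_convConst_apply, emb₁₂, convMap_apply, convMap_apply, mul_assoc, convConst_mul_apply,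
    Conv.mul_apply r, Finset.mul_sum]
  simp only [mul_assoc]

theorem eval_23_13_12 : (emb₂₃ X h * emb₁₃ Y g * emb₁₂ Z f) x y z =
    ∑ i ∈ p.index, ∑ j ∈ q.index, ∑ l ∈ r.index, h (q.left j) (r.left l) *
      g (p.left i) (r.right l) * f (p.right i) (q.right j) := by
  rw [mul_assoc, emb₂₃, convConst_mul_apply, Conv.mul_apply p, Finset.mul_sum, Conv.sum_apply,
    Conv.sum_apply]
  refine Finset.sum_congr rfl fun i _ => ?_
  rw [emb₁₃, convMap_apply, Conv.mul_apply q, Conv.sum_apply]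
  refine Finset.sum_congr rfl fun j _ => ?_
  rw [convConst_mul_apply, emb₁₂, convMap_apply, convMap_apply, ← mul_assoc, mul_convConst_apply,
    Conv.mul_apply r, Finset.sum_mul]

theorem eval_12_23_13 : (emb₁₂ Z f * emb₂₃ X h * emb₁₃ Y g) x y z =
    ∑ i ∈ p.index, ∑ j ∈ q.index, ∑ l ∈ r.index, f (p.left i) (q.left j) *
      h (q.right j) (r.left l) * g (p.right i) (r.right l) := by
  rw [Conv.mul_apply p, Conv.sum_apply, Conv.sum_apply]
  refine Finset.sum_congr rfl fun i _ => ?_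
  rw [emb₂₃, mul_convConst_apply, emb₁₃, convMap_apply, mul_convConst_apply, Conv.mul_apply q,
    Finset.sum_mul, Conv.sum_apply]
  refine Finset.sum_congr rfl fun j _ => ?_
  rw [emb₁₂, convMap_apply, convMap_apply, mul_assoc, convConst_mul_apply,
    Conv.mul_apply r, Finset.mul_sum]
  simp only [mul_assoc]

theorem eval_13_23_12 : (emb₁₃ Y g * emb₂₃ X h * emb₁₂ Z f) x y z =
    ∑ i ∈ p.index, ∑ j ∈ q.index, ∑ l ∈ r.index, g (p.left i) (r.left l) *
      h (q.left j) (r.right l) * f (p.right i) (q.right j) := by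
  rw [Conv.mul_apply p, Conv.sum_apply, Conv.sum_apply]
  refine Finset.sum_congr rfl fun i _ => ?_
  rw [emb₂₃, mul_convConst_apply, emb₁₃, convMap_apply, mul_assoc, convConst_mul_apply,
    Conv.mul_apply q, Finset.mul_sum, Conv.sum_apply]
  refine Finset.sum_congr rfl fun j _ => ?_
  rw [emb₁₂, convMap_apply, convMap_apply, ← mul_assoc, mul_convConst_apply,
    Conv.mul_apply r, Finset.sum_mul]

theorem eval_23_12_13 : (emb₂₃ X h * emb₁₂ Z f * emb₁₃ Y g) x y z =
    ∑ i ∈ p.index, ∑ j ∈ q.index, ∑ l ∈ r.index, h (q.left j) (r.left l) *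
      f (p.left i) (q.right j) * g (p.right i) (r.right l) := by
  rw [mul_assoc, emb₂₃, convConst_mul_apply, Conv.mul_apply p, Finset.mul_sum, Conv.sum_apply,
    Conv.sum_apply]
  refine Finset.sum_congr rfl fun i _ => ?_
  rw [← mul_assoc, emb₁₃, convMap_apply, mul_convConst_apply, Conv.mul_apply q, Finset.sum_mul,
    Conv.sum_apply]
  refine Finset.sum_congr rfl fun j _ => ?_
  rw [emb₁₂, convMap_apply, convMap_apply, mul_assoc, Conv.mul_apply r]
  refine Finset.sum_congr rfl fun l _ => ?_
  rw [convConst_mul_apply, mul_assoc]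

theorem eval_13_12_23 : (emb₁₃ Y g * emb₁₂ Z f * emb₂₃ X h) x y z =
    ∑ i ∈ p.index, ∑ j ∈ q.index, ∑ l ∈ r.index, g (p.left i) (r.left l) *
      f (p.right i) (q.left j) * h (q.right j) (r.right l) := by
  rw [emb₂₃, mul_convConst_apply, Conv.mul_apply p, Finset.sum_mul, Conv.sum_apply,
    Conv.sum_apply]
  refine Finset.sum_congr rfl fun i _ => ?_
  rw [mul_assoc, emb₁₃, convMap_apply, convConst_mul_apply, Conv.mul_apply q, Finset.mul_sum,
    Conv.sum_apply]
  refine Finset.sum_congr rfl fun j _ => ?_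
  rw [emb₁₂, convMap_apply, convMap_apply, ← mul_assoc, Conv.mul_apply r]
  refine Finset.sum_congr rfl fun l _ => ?_
  rw [mul_convConst_apply]

theorem eval_mul (f g : Conv k X (Conv k Y k)) : (f * g) x y =
    ∑ i ∈ p.index, ∑ j ∈ q.index, f (p.left i) (q.left j) * g (p.right i) (q.right j) := by
  rw [Conv.mul_apply p, Conv.sum_apply]
  refine Finset.sum_congr rfl fun i _ => ?_
  rw [Conv.mul_apply q]

theorem eval_one : (1 : Conv k X (Conv k Y k)) x y =
    counit (R := k) x * counit (R := k) y := by
  rw [Conv.one_apply, map_smul, LinearMap.smul_apply, Conv.one_apply]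
  simp

end Evaluation

end Embeddings

end Forms

/-! ### Invariance and convolution inverses of the crossing forms. -/

section LocalIdentities

variable {k C : Type*} [Field k] [AddCommGroup C] [Module k C] [Coalgebra k C]

/-- Sweedler sums are compatible with coalgebra automorphisms. -/
theorem sweedler_aut {e : C ≃ₗ[k] C} (he : e ∈ coalgAut k C) (x : C) (B : C →ₗ[k] C →ₗ[k] k) :
    sweedler k (e x) (fun u v => B u v) = sweedler k x fun u v => B (e u) (e v) := by
  rw [sweedler_eq_lift]
  have h := LinearMap.congr_fun he.2 x
  simp only [LinearMap.comp_apply, LinearEquiv.coe_coe] at h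
  rw [← h, ← (ℛ k x).eq]
  simp [sweedler]

theorem counit_aut {e : C ≃ₗ[k] C} (he : e ∈ coalgAut k C) (x : C) :
    counit (R := k) (e x) = counit (R := k) x := LinearMap.congr_fun he.1 x

theorem sum_aut₂ {e₁ e₂ : C ≃ₗ[k] C} (h₁ : e₁ ∈ coalgAut k C) (h₂ : e₂ ∈ coalgAut k C)
    (α β : C →ₗ[k] C →ₗ[k] k) (x y : C) :
    (sweedler k (e₁ x) fun x₁ x₂ => sweedler k (e₂ y) fun y₁ y₂ => α x₁ y₁ * β x₂ y₂) =
      sweedler k x fun x₁ x₂ => sweedler k y fun y₁ y₂ =>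
        α (e₁ x₁) (e₂ y₁) * β (e₁ x₂) (e₂ y₂) := by
  have h : ∀ x₁ x₂, (sweedler k (e₂ y) fun y₁ y₂ => α x₁ y₁ * β x₂ y₂) =
      sweedler k y fun y₁ y₂ => α x₁ (e₂ y₁) * β x₂ (e₂ y₂) := fun x₁ x₂ =>
    sweedler_aut h₂ y (LinearMap.mk₂ k (fun u v => α x₁ u * β x₂ v)
      (by intros; simp; ring) (by intros; simp; ring) (by intros; simp; ring)
      (by intros; simp; ring))
  simp only [h]
  exact sweedler_aut h₁ x (LinearMap.mk₂ k
    (fun u v => sweedler k y fun y₁ y₂ => α u (e₂ y₁) * β v (e₂ y₂))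
    (by intros; simp [sweedler, add_mul, Finset.sum_add_distrib])
    (by intros; simp [sweedler, mul_assoc, Finset.mul_sum])
    (by intros; simp [sweedler, mul_add, Finset.sum_add_distrib])
    (by intros; simp [sweedler, mul_left_comm, Finset.mul_sum]))

namespace StrictOrientedQuantumCoalgebra

variable (Q : StrictOrientedQuantumCoalgebra k C)

theorem Td_mem : Q.Td.toLinearEquiv ∈ coalgAut k C := coalgEquiv_mem_coalgAut _
theorem Tu_mem : Q.Tu.toLinearEquiv ∈ coalgAut k C := coalgEquiv_mem_coalgAut _

/-- The third axiom at `(x, e y, f z)`, with the automorphisms carried through the coproducts. It is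
the source of the Yang-Baxter equation for mixed directions. -/
theorem qc3_aut {e f : C ≃ₗ[k] C} (he : e ∈ coalgAut k C) (hf : f ∈ coalgAut k C) (x y z : C) :
    (sweedler k x fun x₁ x₂ => sweedler k y fun y₁ y₂ => sweedler k z fun z₁ z₂ =>
        Q.b x₁ (e y₁) * Q.b x₂ (f z₁) * Q.b (e y₂) (f z₂)) =
      sweedler k x fun x₁ x₂ => sweedler k y fun y₁ y₂ => sweedler k z fun z₁ z₂ =>
        Q.b x₂ (e y₂) * Q.b x₁ (f z₂) * Q.b (e y₁) (f z₁) := by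
  have h := Q.qc3 x (e y) (f z)
  have h1 : ∀ x₁ x₂ y₁ y₂,
      (sweedler k (f z) fun z₁ z₂ => Q.b x₁ y₁ * Q.b x₂ z₁ * Q.b y₂ z₂) =
      sweedler k z fun z₁ z₂ => Q.b x₁ y₁ * Q.b x₂ (f z₁) * Q.b y₂ (f z₂) :=
    fun x₁ x₂ y₁ y₂ => sweedler_aut hf z (LinearMap.mk₂ k
      (fun u v => Q.b x₁ y₁ * Q.b x₂ u * Q.b y₂ v)
      (by intros; simp; ring) (by intros; simp; ring) (by intros; simp; ring)
      (by intros; simp; ring))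
  have h2 : ∀ x₁ x₂ y₁ y₂,
      (sweedler k (f z) fun z₁ z₂ => Q.b x₂ y₂ * Q.b x₁ z₂ * Q.b y₁ z₁) =
      sweedler k z fun z₁ z₂ => Q.b x₂ y₂ * Q.b x₁ (f z₂) * Q.b y₁ (f z₁) :=
    fun x₁ x₂ y₁ y₂ => sweedler_aut hf z (LinearMap.mk₂ k
      (fun u v => Q.b x₂ y₂ * Q.b x₁ v * Q.b y₁ u)
      (by intros; simp; ring) (by intros; simp; ring) (by intros; simp; ring)
      (by intros; simp; ring))
  have h3 : ∀ x₁ x₂, (sweedler k (e y) fun y₁ y₂ => sweedler k z fun z₁ z₂ =>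
        Q.b x₁ y₁ * Q.b x₂ (f z₁) * Q.b y₂ (f z₂)) =
      sweedler k y fun y₁ y₂ => sweedler k z fun z₁ z₂ =>
        Q.b x₁ (e y₁) * Q.b x₂ (f z₁) * Q.b (e y₂) (f z₂) :=
    fun x₁ x₂ => sweedler_aut he y (LinearMap.mk₂ k
      (fun u v => sweedler k z fun z₁ z₂ => Q.b x₁ u * Q.b x₂ (f z₁) * Q.b v (f z₂))
      (by intros; simp [sweedler, add_mul, Finset.sum_add_distrib])
      (by intros; simp [sweedler, mul_assoc, Finset.mul_sum])
      (by intros; simp [sweedler, mul_add, Finset.sum_add_distrib])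
      (by intros; simp [sweedler, mul_left_comm, Finset.mul_sum]))
  have h4 : ∀ x₁ x₂, (sweedler k (e y) fun y₁ y₂ => sweedler k z fun z₁ z₂ =>
        Q.b x₂ y₂ * Q.b x₁ (f z₂) * Q.b y₁ (f z₁)) =
      sweedler k y fun y₁ y₂ => sweedler k z fun z₁ z₂ =>
        Q.b x₂ (e y₂) * Q.b x₁ (f z₂) * Q.b (e y₁) (f z₁) :=
    fun x₁ x₂ => sweedler_aut he y (LinearMap.mk₂ k
      (fun u v => sweedler k z fun z₁ z₂ => Q.b x₂ v * Q.b x₁ (f z₂) * Q.b u (f z₁))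
      (by intros; simp [sweedler, mul_add, Finset.sum_add_distrib])
      (by intros; simp [sweedler, mul_left_comm, Finset.mul_sum])
      (by intros; simp [sweedler, add_mul, Finset.sum_add_distrib])
      (by intros; simp [sweedler, mul_assoc, Finset.mul_sum]))
  simp only [h1, h2, h3, h4] at h
  exact h

/-- A bilinear form between strands of directions `a` and `b`. -/
def strandForm (a b : Bool) (β : C →ₗ[k] C →ₗ[k] k) :
    Conv k (Strand a C) (Conv k (Strand b C) k) := form (X := Strand a C) (Y := Strand b C) β

theorem strandForm_mul (a b : Bool) (β γ : C →ₗ[k] C →ₗ[k] k) (x y : C) :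
    (strandForm a b β * strandForm a b γ) x y = ∑ i ∈ (ℛ k x).index, ∑ j ∈ (ℛ k y).index,
      β (lo k a x i) (lo k b y j) * γ (up k a x i) (up k b y j) :=
  eval_mul (strandRepr a x) (strandRepr b y) _ _

theorem strandForm_mul_eq_one {a b : Bool} {β γ : C →ₗ[k] C →ₗ[k] k}
    (h : ∀ x y, ∑ i ∈ (ℛ k x).index, ∑ j ∈ (ℛ k y).index,
      β (lo k a x i) (lo k b y j) * γ (up k a x i) (up k b y j) =
        counit (R := k) x * counit (R := k) y) :
    strandForm a b β * strandForm a b γ = 1 := by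
  ext x y
  refine (strandForm_mul a b β γ x y).trans ((h x y).trans ?_)
  exact Eq.symm (@eval_one k _ (Strand a C) (Strand b C) _ _ (strandCoalgebra a) _ _ (strandCoalgebra b) x y)

/-- Both `b⁻¹` and its transport by `e` are inverse to the `e`-invariant form `b`, and inverses are
unique. -/
theorem bInv_aut {e : C ≃ₗ[k] C} (he : e ∈ coalgAut k C) (hb : ∀ x y, Q.b x y = Q.b (e x) (e y))
    (x y : C) : Q.bInv (e x) (e y) = Q.bInv x y := by
  have h1 : strandForm true true Q.b * strandForm true true Q.bInv = 1 :=
    strandForm_mul_eq_one fun x y => Q.b_bInv x y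
  have h2 : strandForm true true Q.bInv * strandForm true true Q.b = 1 :=
    strandForm_mul_eq_one fun x y => Q.bInv_b x y
  have h3 : strandForm true true Q.b *
      strandForm true true (Q.bInv.compl₁₂ e.toLinearMap e.toLinearMap) = 1 :=
    strandForm_mul_eq_one fun x y => by
      have := (sum_aut₂ he he Q.b Q.bInv x y).symm.trans (Q.b_bInv (e x) (e y))
      rw [counit_aut he, counit_aut he] at this
      simp only [← hb] at this
      exact this
  have h4 := left_inv_eq_right_inv h2 h3
  have h5 := congrArg (fun F : Conv k (Strand true C) (Conv k (Strand true C) k) => F x y) h4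
  exact h5.symm

theorem bInv_Td (x y : C) : Q.bInv (Q.Td x) (Q.Td y) = Q.bInv x y := Q.bInv_aut Q.Td_mem Q.qc2_d x y
theorem bInv_Tu (x y : C) : Q.bInv (Q.Tu x) (Q.Tu y) = Q.bInv x y := Q.bInv_aut Q.Tu_mem Q.qc2_u x y

/-- The form of a crossing with over line `/`, for the directions of the lines `/` and `\`. -/
def crossForm : Bool → Bool → C →ₗ[k] C →ₗ[k] k
  | true, true => Q.b
  | false, false => Q.b
  | true, false => Q.bInv ∘ₗ Q.Tu.toLinearEquiv.toLinearMap
  | false, true => Q.bInv ∘ₗ Q.Td.toLinearEquiv.toLinearMap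

/-- The inverse of `crossForm`. -/
def crossFormInv : Bool → Bool → C →ₗ[k] C →ₗ[k] k
  | true, true => Q.bInv
  | false, false => Q.bInv
  | true, false => Q.b.compl₂ Q.Td.toLinearEquiv.toLinearMap
  | false, true => Q.b.compl₂ Q.Tu.toLinearEquiv.toLinearMap

theorem crossingFactor_true (a b : Bool) (x y : C) :
    crossingFactor Q true a b x y = Q.crossForm a b x y := by
  cases a <;> cases b <;> rfl

theorem crossingFactor_false (a b : Bool) (x y : C) :
    crossingFactor Q false b a y x = Q.crossFormInv a b x y := by
  cases a <;> cases b <;> rfl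

theorem crossingFactor_Tu (o a b : Bool) (x y : C) :
    crossingFactor Q o a b (Q.Tu x) (Q.Tu y) = crossingFactor Q o a b x y := by
  cases o <;> cases a <;> cases b <;> simp only [crossingFactor, Q.bInv_Tu, Q.commute, ← Q.qc2_u]

theorem b_Td_symm_Tu (x y : C) : Q.b (Q.Td.symm (Q.Tu x)) (Q.Tu y) = Q.b x (Q.Td y) := by
  have h : Q.Td (Q.Td.symm (Q.Tu x)) = Q.Tu x := Q.Td.toLinearEquiv.apply_symm_apply _
  rw [Q.qc2_d, h, Q.commute, ← Q.qc2_u]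

theorem Td_symm_Tu_mem : Q.Td.toLinearEquiv⁻¹ * Q.Tu.toLinearEquiv ∈ coalgAut k C :=
  mul_mem (inv_mem Q.Td_mem) Q.Tu_mem

/-- The first axiom has `T_d` inside `b⁻¹` and `T_u` inside `b`. Evaluating it at `T_d⁻¹ T_u x`
interchanges the two automorphisms, because `b` is invariant under both. -/
theorem sum_bInv_Tu_b_Td (x y : C) :
    (sweedler k x fun x₁ x₂ => sweedler k y fun y₁ y₂ => Q.bInv (Q.Tu x₁) y₂ * Q.b x₂ (Q.Td y₁)) =
      counit (R := k) x * counit (R := k) y := by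
  have h1 := Q.qc1' ((Q.Td.toLinearEquiv⁻¹ * Q.Tu.toLinearEquiv) x) y
  rw [counit_aut Q.Td_symm_Tu_mem] at h1
  rw [← h1]
  refine Eq.symm ?_
  refine (sweedler_aut Q.Td_symm_Tu_mem x (LinearMap.mk₂ k
    (fun u v => sweedler k y fun y₁ y₂ => Q.bInv (Q.Td u) y₂ * Q.b v (Q.Tu y₁))
    (by intros; simp [sweedler, add_mul, Finset.sum_add_distrib])
    (by intros; simp [sweedler, mul_assoc, Finset.mul_sum])
    (by intros; simp [sweedler, mul_add, Finset.sum_add_distrib])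
    (by intros; simp [sweedler, mul_left_comm, Finset.mul_sum]))).trans ?_
  have h : ∀ u, Q.Td ((Q.Td.toLinearEquiv⁻¹ * Q.Tu.toLinearEquiv) u) = Q.Tu u :=
    fun u => Q.Td.toLinearEquiv.apply_symm_apply _
  have h' : ∀ u v, Q.b ((Q.Td.toLinearEquiv⁻¹ * Q.Tu.toLinearEquiv) u) (Q.Tu v) = Q.b u (Q.Td v) :=
    fun u v => Q.b_Td_symm_Tu u v
  simp only [LinearMap.mk₂_apply, h, h']

theorem sum_b_Td_bInv_Tu (x y : C) :
    (sweedler k x fun x₁ x₂ => sweedler k y fun y₁ y₂ => Q.b x₁ (Q.Td y₂) * Q.bInv (Q.Tu x₂) y₁) =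
      counit (R := k) x * counit (R := k) y := by
  have h1 := Q.qc1 ((Q.Td.toLinearEquiv⁻¹ * Q.Tu.toLinearEquiv) x) y
  rw [counit_aut Q.Td_symm_Tu_mem] at h1
  rw [← h1]
  refine Eq.symm ?_
  refine (sweedler_aut Q.Td_symm_Tu_mem x (LinearMap.mk₂ k
    (fun u v => sweedler k y fun y₁ y₂ => Q.b u (Q.Tu y₂) * Q.bInv (Q.Td v) y₁)
    (by intros; simp [sweedler, add_mul, Finset.sum_add_distrib])
    (by intros; simp [sweedler, mul_assoc, Finset.mul_sum])
    (by intros; simp [sweedler, mul_add, Finset.sum_add_distrib])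
    (by intros; simp [sweedler, mul_left_comm, Finset.mul_sum]))).trans ?_
  have h : ∀ u, Q.Td ((Q.Td.toLinearEquiv⁻¹ * Q.Tu.toLinearEquiv) u) = Q.Tu u :=
    fun u => Q.Td.toLinearEquiv.apply_symm_apply _
  have h' : ∀ u v, Q.b ((Q.Td.toLinearEquiv⁻¹ * Q.Tu.toLinearEquiv) u) (Q.Tu v) = Q.b u (Q.Td v) :=
    fun u v => Q.b_Td_symm_Tu u v
  simp only [LinearMap.mk₂_apply, h, h']

/-- With reversed coproducts on downward strands, parallel strands give the invertibility of `b`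
(with the factors commuted when both go down). The pair (down, up) gives the first axiom, and (up,
down) its form with `T_d` and `T_u` interchanged. -/
theorem crossForm_mul_inv (a b : Bool) :
    strandForm a b (Q.crossForm a b) * strandForm a b (Q.crossFormInv a b) = 1 := by
  apply strandForm_mul_eq_one
  intro x y
  cases a <;> cases b
  · rw [← Q.bInv_b x y]
    simp only [sweedler, lo, up, crossForm, crossFormInv, mul_comm]
  · rw [← Q.qc1 x y]
    exact Finset.sum_congr rfl fun i _ => Finset.sum_congr rfl fun j _ => mul_comm _ _
  · rw [← Q.sum_bInv_Tu_b_Td x y]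
    rfl
  · exact Q.b_bInv x y

theorem crossFormInv_mul (a b : Bool) :
    strandForm a b (Q.crossFormInv a b) * strandForm a b (Q.crossForm a b) = 1 := by
  apply strandForm_mul_eq_one
  intro x y
  cases a <;> cases b
  · rw [← Q.b_bInv x y]
    simp only [sweedler, lo, up, crossForm, crossFormInv, mul_comm]
  · rw [← Q.qc1' x y]
    exact Finset.sum_congr rfl fun i _ => Finset.sum_congr rfl fun j _ => mul_comm _ _
  · rw [← Q.sum_b_Td_bInv_Tu x y]
    rfl
  · exact Q.bInv_b x y

end StrictOrientedQuantumCoalgebra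

end LocalIdentities

/-! ### The Yang-Baxter equation for all choices of directions. -/

section YangBaxter

variable {k C : Type*} [Field k] [AddCommGroup C] [Module k C] [Coalgebra k C]

theorem sum₃_congr {M ι : Type*} [AddCommMonoid M] {s t u : Finset ι} {F G : ι → ι → ι → M}
    (h : ∀ i j l, F i j l = G i j l) :
    ∑ i ∈ s, ∑ j ∈ t, ∑ l ∈ u, F i j l = ∑ i ∈ s, ∑ j ∈ t, ∑ l ∈ u, G i j l := by
  simp only [h]

section Permute

variable {M : Type*} [CommMonoid M] (a b c : M)

theorem mul_acb : a * b * c = a * c * b := mul_right_comm _ _ _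
theorem mul_bac : a * b * c = b * a * c := by rw [mul_comm a]
theorem mul_bca : a * b * c = b * c * a := by rw [mul_comm a, mul_right_comm]
theorem mul_cab : a * b * c = c * a * b := by rw [mul_comm (a * b), mul_assoc]
theorem mul_cba : a * b * c = c * b * a := by rw [mul_comm (a * b), mul_comm a, mul_assoc]

end Permute

namespace StrictOrientedQuantumCoalgebra

variable (Q : StrictOrientedQuantumCoalgebra k C)

/-- A form on the first two of three strands of given directions. -/
def E₁₂ (a b c : Bool) (β : C →ₗ[k] C →ₗ[k] k) :
    Conv k (Strand a C) (Conv k (Strand b C) (Conv k (Strand c C) k)) :=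
  emb₁₂ (Strand c C) (strandForm a b β)

/-- A form on the outer two of three strands of given directions. -/
def E₁₃ (a b c : Bool) (β : C →ₗ[k] C →ₗ[k] k) :
    Conv k (Strand a C) (Conv k (Strand b C) (Conv k (Strand c C) k)) :=
  emb₁₃ (Strand b C) (strandForm a c β)

/-- A form on the last two of three strands of given directions. -/
def E₂₃ (a b c : Bool) (β : C →ₗ[k] C →ₗ[k] k) :
    Conv k (Strand a C) (Conv k (Strand b C) (Conv k (Strand c C) k)) :=
  emb₂₃ (Strand a C) (strandForm b c β)

theorem E₁₂_mul {β γ : C →ₗ[k] C →ₗ[k] k} {a b : Bool} (c : Bool)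
    (h : strandForm a b β * strandForm a b γ = 1) : E₁₂ a b c β * E₁₂ a b c γ = 1 := by
  rw [E₁₂, E₁₂, ← map_mul, h, map_one]

theorem E₁₃_mul {β γ : C →ₗ[k] C →ₗ[k] k} {a c : Bool} (b : Bool)
    (h : strandForm a c β * strandForm a c γ = 1) : E₁₃ a b c β * E₁₃ a b c γ = 1 := by
  rw [E₁₃, E₁₃, ← map_mul, h, map_one]

theorem E₂₃_mul {β γ : C →ₗ[k] C →ₗ[k] k} {b c : Bool} (a : Bool)
    (h : strandForm b c β * strandForm b c γ = 1) : E₂₃ a b c β * E₂₃ a b c γ = 1 := by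
  rw [E₂₃, E₂₃, ← map_mul, h, map_one]

section Eval

variable (a b c : Bool) (f g h : C →ₗ[k] C →ₗ[k] k) (x y z : C)

theorem E_12_13_23 : (E₁₂ a b c f * E₁₃ a b c g * E₂₃ a b c h) x y z =
    ∑ i ∈ (ℛ k x).index, ∑ j ∈ (ℛ k y).index, ∑ l ∈ (ℛ k z).index,
      f (lo k a x i) (lo k b y j) * g (up k a x i) (lo k c z l) *
        h (up k b y j) (up k c z l) :=
  eval_12_13_23 _ _ _ (strandRepr a x) (strandRepr b y) (strandRepr c z)

theorem E_23_13_12 : (E₂₃ a b c h * E₁₃ a b c g * E₁₂ a b c f) x y z =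
    ∑ i ∈ (ℛ k x).index, ∑ j ∈ (ℛ k y).index, ∑ l ∈ (ℛ k z).index,
      h (lo k b y j) (lo k c z l) * g (lo k a x i) (up k c z l) *
        f (up k a x i) (up k b y j) :=
  eval_23_13_12 _ _ _ (strandRepr a x) (strandRepr b y) (strandRepr c z)

theorem E_12_23_13 : (E₁₂ a b c f * E₂₃ a b c h * E₁₃ a b c g) x y z =
    ∑ i ∈ (ℛ k x).index, ∑ j ∈ (ℛ k y).index, ∑ l ∈ (ℛ k z).index,
      f (lo k a x i) (lo k b y j) * h (up k b y j) (lo k c z l) *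
        g (up k a x i) (up k c z l) :=
  eval_12_23_13 _ _ _ (strandRepr a x) (strandRepr b y) (strandRepr c z)

theorem E_13_23_12 : (E₁₃ a b c g * E₂₃ a b c h * E₁₂ a b c f) x y z =
    ∑ i ∈ (ℛ k x).index, ∑ j ∈ (ℛ k y).index, ∑ l ∈ (ℛ k z).index,
      g (lo k a x i) (lo k c z l) * h (lo k b y j) (up k c z l) *
        f (up k a x i) (up k b y j) :=
  eval_13_23_12 _ _ _ (strandRepr a x) (strandRepr b y) (strandRepr c z)

theorem E_23_12_13 : (E₂₃ a b c h * E₁₂ a b c f * E₁₃ a b c g) x y z =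
    ∑ i ∈ (ℛ k x).index, ∑ j ∈ (ℛ k y).index, ∑ l ∈ (ℛ k z).index,
      h (lo k b y j) (lo k c z l) * f (lo k a x i) (up k b y j) *
        g (up k a x i) (up k c z l) :=
  eval_23_12_13 _ _ _ (strandRepr a x) (strandRepr b y) (strandRepr c z)

theorem E_13_12_23 : (E₁₃ a b c g * E₁₂ a b c f * E₂₃ a b c h) x y z =
    ∑ i ∈ (ℛ k x).index, ∑ j ∈ (ℛ k y).index, ∑ l ∈ (ℛ k z).index,
      g (lo k a x i) (lo k c z l) * f (up k a x i) (lo k b y j) *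
        h (up k b y j) (up k c z l) :=
  eval_13_12_23 _ _ _ (strandRepr a x) (strandRepr b y) (strandRepr c z)

end Eval

/-- The form twisted by an automorphism in the second argument. -/
def twist (e : C ≃ₗ[k] C) : C →ₗ[k] C →ₗ[k] k := Q.b.compl₂ e.toLinearMap

/-- With all strands up this is the third axiom as it stands. With all strands down every coproduct
is reversed, and the same axiom is read from right to left. -/
theorem ybe_ttt : E₁₂ true true true Q.b * E₁₃ true true true Q.b * E₂₃ true true true Q.b =
    E₂₃ true true true Q.b * E₁₃ true true true Q.b * E₁₂ true true true Q.b := by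
  ext x y z
  refine (E_12_13_23 ..).trans (Eq.trans ?_ (E_23_13_12 ..).symm)
  exact (Q.qc3 x y z).trans (sum₃_congr fun i j l => mul_cba _ _ _)

theorem ybe_fff : E₁₂ false false false Q.b * E₁₃ false false false Q.b *
      E₂₃ false false false Q.b =
    E₂₃ false false false Q.b * E₁₃ false false false Q.b * E₁₂ false false false Q.b := by
  ext x y z
  refine (E_12_13_23 ..).trans (Eq.trans ?_ (E_23_13_12 ..).symm)
  exact (Q.qc3 x y z).symm.trans (sum₃_congr fun i j l => mul_cba _ _ _)

variable {e : C ≃ₗ[k] C} (he : e ∈ coalgAut k C)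
include he

/-- When an outer strand is the odd one, the forms which involve it are replaced by their inverses,
again `b` with an automorphism `e` in the second argument. The identity becomes the third axiom with
one argument moved by `e`, or two of them if the first strand is odd; then the invariance of `b` is
needed as well. -/
theorem ybe_ttf : E₁₂ true true false Q.b * E₂₃ true true false (Q.twist e) *
      E₁₃ true true false (Q.twist e) =
    E₁₃ true true false (Q.twist e) * E₂₃ true true false (Q.twist e) *
      E₁₂ true true false Q.b := by
  ext x y z
  refine (E_12_23_13 ..).trans (Eq.trans ?_ (E_13_23_12 ..).symm)
  exact (sum₃_congr fun i j l => mul_acb _ _ _).trans ((Q.qc3_aut (one_mem _) he x y z).trans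
    (sum₃_congr fun i j l => mul_bca _ _ _))

theorem ybe_fft : E₁₂ false false true Q.b * E₂₃ false false true (Q.twist e) *
      E₁₃ false false true (Q.twist e) =
    E₁₃ false false true (Q.twist e) * E₂₃ false false true (Q.twist e) *
      E₁₂ false false true Q.b := by
  ext x y z
  refine (E_12_23_13 ..).trans (Eq.trans ?_ (E_13_23_12 ..).symm)
  exact (sum₃_congr fun i j l => mul_acb _ _ _).trans ((Q.qc3_aut (one_mem _) he x y z).symm.trans
    (sum₃_congr fun i j l => mul_bca _ _ _))

variable (hb : ∀ x y, Q.b x y = Q.b (e x) (e y))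
include hb

theorem ybe_tff : E₂₃ true false false Q.b * E₁₂ true false false (Q.twist e) *
      E₁₃ true false false (Q.twist e) =
    E₁₃ true false false (Q.twist e) * E₁₂ true false false (Q.twist e) *
      E₂₃ true false false Q.b := by
  ext x y z
  refine (E_23_12_13 ..).trans (Eq.trans ?_ (E_13_12_23 ..).symm)
  have h := Q.qc3_aut he he x y z
  simp only [← hb] at h
  exact (sum₃_congr fun i j l => mul_bca _ _ _).trans (h.trans
    (sum₃_congr fun i j l => mul_bac _ _ _))

theorem ybe_ftt : E₂₃ false true true Q.b * E₁₂ false true true (Q.twist e) *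
      E₁₃ false true true (Q.twist e) =
    E₁₃ false true true (Q.twist e) * E₁₂ false true true (Q.twist e) *
      E₂₃ false true true Q.b := by
  ext x y z
  refine (E_23_12_13 ..).trans (Eq.trans ?_ (E_13_12_23 ..).symm)
  have h := Q.qc3_aut he he x y z
  simp only [← hb] at h
  exact (sum₃_congr fun i j l => mul_bca _ _ _).trans (h.symm.trans
    (sum₃_congr fun i j l => mul_bac _ _ _))

omit hb

/-- When the middle strand is the odd one, the form on the last two strands remains a `b⁻¹`. The
equation on upward strands at `(x, e y, z)` is multiplied from both sides by the inverse of its `b`.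
-/
theorem ybe_inv (x y z : C) :
    (E₂₃ true true true (Q.bInv ∘ₗ e.toLinearMap) * E₁₂ true true true (Q.twist e) *
      E₁₃ true true true Q.b) x y z =
    (E₁₃ true true true Q.b * E₁₂ true true true (Q.twist e) *
      E₂₃ true true true (Q.bInv ∘ₗ e.toLinearMap)) x y z := by
  have h1 : E₁₂ true true true (Q.twist e) * E₁₃ true true true Q.b *
      E₂₃ true true true (Q.b ∘ₗ e.toLinearMap) =
      E₂₃ true true true (Q.b ∘ₗ e.toLinearMap) * E₁₃ true true true Q.b *
        E₁₂ true true true (Q.twist e) := by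
    ext x y z
    refine (E_12_13_23 ..).trans (Eq.trans ?_ (E_23_13_12 ..).symm)
    exact (Q.qc3_aut he (one_mem _) x y z).trans (sum₃_congr fun i j l => mul_cba _ _ _)
  have h2 : E₂₃ true true true (Q.bInv ∘ₗ e.toLinearMap) *
      E₂₃ true true true (Q.b ∘ₗ e.toLinearMap) = 1 := by
    refine E₂₃_mul _ (strandForm_mul_eq_one fun x y => ?_)
    rw [← counit_aut he x, ← Q.bInv_b (e x) y]
    exact (sum_aut₂ he (one_mem _) Q.bInv Q.b x y).symm
  have h3 : E₂₃ true true true (Q.b ∘ₗ e.toLinearMap) *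
      E₂₃ true true true (Q.bInv ∘ₗ e.toLinearMap) = 1 := by
    refine E₂₃_mul _ (strandForm_mul_eq_one fun x y => ?_)
    rw [← counit_aut he x, ← Q.b_bInv (e x) y]
    exact (sum_aut₂ he (one_mem _) Q.b Q.bInv x y).symm
  suffices E₂₃ true true true (Q.bInv ∘ₗ e.toLinearMap) * E₁₂ true true true (Q.twist e) *
      E₁₃ true true true Q.b = E₁₃ true true true Q.b * E₁₂ true true true (Q.twist e) *
      E₂₃ true true true (Q.bInv ∘ₗ e.toLinearMap) by rw [this]
  generalize E₂₃ true true true (Q.bInv ∘ₗ e.toLinearMap) = i at *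
  generalize E₂₃ true true true (Q.b ∘ₗ e.toLinearMap) = f at *
  generalize E₁₂ true true true (Q.twist e) = p at *
  generalize E₁₃ true true true Q.b = q at *
  calc i * p * q = i * (p * q * f) * i := by
        rw [mul_assoc i (p * q * f), mul_assoc (p * q), h3, mul_one, mul_assoc]
    _ = q * p * i := by rw [h1, mul_assoc f, ← mul_assoc i f, h2, one_mul]

theorem ybe_tft : E₁₂ true false true (Q.twist e) * E₂₃ true false true (Q.bInv ∘ₗ e.toLinearMap) *
      E₁₃ true false true Q.b =
    E₁₃ true false true Q.b * E₂₃ true false true (Q.bInv ∘ₗ e.toLinearMap) *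
      E₁₂ true false true (Q.twist e) := by
  ext x y z
  refine (E_12_23_13 ..).trans (Eq.trans ?_ (E_13_23_12 ..).symm)
  -- Reversing the middle strand exchanges its two legs, which turns the order `23, 12, 13` of the
  -- factors into `12, 23, 13`.
  have h := (E_23_12_13 ..).symm.trans ((Q.ybe_inv he x y z).trans (E_13_12_23 ..))
  exact (sum₃_congr fun i j l => mul_bac _ _ _).trans (h.trans
    (sum₃_congr fun i j l => mul_acb _ _ _))

theorem ybe_ftf : E₁₂ false true false (Q.twist e) *
      E₂₃ false true false (Q.bInv ∘ₗ e.toLinearMap) * E₁₃ false true false Q.b =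
    E₁₃ false true false Q.b * E₂₃ false true false (Q.bInv ∘ₗ e.toLinearMap) *
      E₁₂ false true false (Q.twist e) := by
  ext x y z
  refine (E_12_23_13 ..).trans (Eq.trans ?_ (E_13_23_12 ..).symm)
  have h := (E_23_12_13 ..).symm.trans ((Q.ybe_inv he x y z).trans (E_13_12_23 ..))
  exact (sum₃_congr fun i j l => mul_cab _ _ _).trans (h.symm.trans
    (sum₃_congr fun i j l => mul_cab _ _ _))

omit he

end StrictOrientedQuantumCoalgebra

section Monoids

variable {M : Type*} [Monoid M] {r₁₂ r₁₃ r₂₃ s₁₂ s₁₃ s₂₃ : M}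

/-- This and the next two lemmas restore the Yang-Baxter equation from its rearranged forms by
cancelling inverse pairs. The three shapes belong to the strand that runs against the other two: the
last, the first and the middle one. -/
theorem ybe_of_inv_13_23 (h13 : r₁₃ * s₁₃ = 1) (h13' : s₁₃ * r₁₃ = 1) (h23 : r₂₃ * s₂₃ = 1)
    (h23' : s₂₃ * r₂₃ = 1) (h : r₁₂ * s₂₃ * s₁₃ = s₁₃ * s₂₃ * r₁₂) :
    r₁₂ * r₁₃ * r₂₃ = r₂₃ * r₁₃ * r₁₂ := by
  calc r₁₂ * r₁₃ * r₂₃ = r₂₃ * (r₁₃ * s₁₃) * s₂₃ * r₁₂ * r₁₃ * r₂₃ := by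
        rw [h13, mul_one, h23, one_mul]
    _ = r₂₃ * r₁₃ * (s₁₃ * s₂₃ * r₁₂) * r₁₃ * r₂₃ := by simp only [mul_assoc]
    _ = r₂₃ * r₁₃ * r₁₂ * (s₂₃ * (s₁₃ * r₁₃) * r₂₃) := by rw [← h]; simp only [mul_assoc]
    _ = _ := by rw [h13', mul_one, h23', mul_one]

theorem ybe_of_inv_12_13 (h12 : r₁₂ * s₁₂ = 1) (h12' : s₁₂ * r₁₂ = 1) (h13 : r₁₃ * s₁₃ = 1)
    (h13' : s₁₃ * r₁₃ = 1) (h : r₂₃ * s₁₂ * s₁₃ = s₁₃ * s₁₂ * r₂₃) :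
    r₁₂ * r₁₃ * r₂₃ = r₂₃ * r₁₃ * r₁₂ := by
  calc r₁₂ * r₁₃ * r₂₃ = r₁₂ * r₁₃ * r₂₃ * (s₁₂ * (s₁₃ * r₁₃) * r₁₂) := by
        rw [h13', mul_one, h12', mul_one]
    _ = r₁₂ * r₁₃ * (r₂₃ * s₁₂ * s₁₃) * r₁₃ * r₁₂ := by simp only [mul_assoc]
    _ = (r₁₂ * (r₁₃ * s₁₃) * s₁₂) * r₂₃ * r₁₃ * r₁₂ := by rw [h]; simp only [mul_assoc]
    _ = _ := by rw [h13, mul_one, h12, one_mul]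

theorem ybe_of_inv_12 (h12 : r₁₂ * s₁₂ = 1) (h12' : s₁₂ * r₁₂ = 1)
    (h : s₁₂ * r₂₃ * r₁₃ = r₁₃ * r₂₃ * s₁₂) :
    r₁₂ * r₁₃ * r₂₃ = r₂₃ * r₁₃ * r₁₂ := by
  calc r₁₂ * r₁₃ * r₂₃ = r₁₂ * (r₁₃ * r₂₃ * s₁₂) * r₁₂ := by
        simp only [mul_assoc, h12', mul_one]
    _ = (r₁₂ * s₁₂) * r₂₃ * r₁₃ * r₁₂ := by rw [← h]; simp only [mul_assoc]
    _ = _ := by rw [h12, one_mul]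

theorem ybe_inverse (h12 : r₁₂ * s₁₂ = 1) (h12' : s₁₂ * r₁₂ = 1) (h13 : r₁₃ * s₁₃ = 1)
    (h13' : s₁₃ * r₁₃ = 1) (h23 : r₂₃ * s₂₃ = 1) (h23' : s₂₃ * r₂₃ = 1)
    (h : r₁₂ * r₁₃ * r₂₃ = r₂₃ * r₁₃ * r₁₂) : s₁₂ * s₁₃ * s₂₃ = s₂₃ * s₁₃ * s₁₂ := by
  have e1 : (s₁₂ * s₁₃ * s₂₃) * (r₂₃ * r₁₃ * r₁₂) = 1 := by
    calc _ = s₁₂ * (s₁₃ * (s₂₃ * r₂₃) * r₁₃) * r₁₂ := by simp only [mul_assoc]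
      _ = 1 := by rw [h23', mul_one, h13', mul_one, h12']
  have e2 : (r₁₂ * r₁₃ * r₂₃) * (s₂₃ * s₁₃ * s₁₂) = 1 := by
    calc _ = r₁₂ * (r₁₃ * (r₂₃ * s₂₃) * s₁₃) * s₁₂ := by simp only [mul_assoc]
      _ = 1 := by rw [h23, mul_one, h13, mul_one, h12]
  rw [h] at e2
  exact left_inv_eq_right_inv e1 e2

end Monoids

namespace StrictOrientedQuantumCoalgebra

variable (Q : StrictOrientedQuantumCoalgebra k C)

/-- In the six mixed patterns the inserted automorphism is the one of the inverse mixed form: `T_u`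
if the first strand goes down, `T_d` if it goes up. -/
theorem ybe (a b c : Bool) :
    E₁₂ a b c (Q.crossForm a b) * E₁₃ a b c (Q.crossForm a c) * E₂₃ a b c (Q.crossForm b c) =
    E₂₃ a b c (Q.crossForm b c) * E₁₃ a b c (Q.crossForm a c) * E₁₂ a b c (Q.crossForm a b) := by
  have i12 := E₁₂_mul c (Q.crossForm_mul_inv a b)
  have i12' := E₁₂_mul c (Q.crossFormInv_mul a b)
  have i13 := E₁₃_mul b (Q.crossForm_mul_inv a c)
  have i13' := E₁₃_mul b (Q.crossFormInv_mul a c)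
  have i23 := E₂₃_mul a (Q.crossForm_mul_inv b c)
  have i23' := E₂₃_mul a (Q.crossFormInv_mul b c)
  cases a <;> cases b <;> cases c
  · exact Q.ybe_fff
  · exact ybe_of_inv_13_23 i13 i13' i23 i23' (Q.ybe_fft Q.Tu_mem)
  · exact ybe_of_inv_12 i12 i12' (Q.ybe_ftf Q.Tu_mem)
  · exact ybe_of_inv_12_13 i12 i12' i13 i13' (Q.ybe_ftt Q.Tu_mem Q.qc2_u)
  · exact ybe_of_inv_12_13 i12 i12' i13 i13' (Q.ybe_tff Q.Td_mem Q.qc2_d)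
  · exact ybe_of_inv_12 i12 i12' (Q.ybe_tft Q.Td_mem)
  · exact ybe_of_inv_13_23 i13 i13' i23 i23' (Q.ybe_ttf Q.Td_mem)
  · exact Q.ybe_ttt

theorem ybe_crossFormInv (a b c : Bool) :
    E₁₂ a b c (Q.crossFormInv a b) * E₁₃ a b c (Q.crossFormInv a c) *
      E₂₃ a b c (Q.crossFormInv b c) =
    E₂₃ a b c (Q.crossFormInv b c) * E₁₃ a b c (Q.crossFormInv a c) *
      E₁₂ a b c (Q.crossFormInv a b) :=
  ybe_inverse (E₁₂_mul c (Q.crossForm_mul_inv a b)) (E₁₂_mul c (Q.crossFormInv_mul a b))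
    (E₁₃_mul b (Q.crossForm_mul_inv a c)) (E₁₃_mul b (Q.crossFormInv_mul a c))
    (E₂₃_mul a (Q.crossForm_mul_inv b c)) (E₂₃_mul a (Q.crossFormInv_mul b c)) (Q.ybe a b c)

/-- The identity behind the cancellation of two opposite crossings. -/
theorem crossingFactor_two (o a b : Bool) (x y : C) :
    ∑ i ∈ (ℛ k x).index, ∑ j ∈ (ℛ k y).index,
      crossingFactor Q o a b (lo k a x i) (lo k b y j) *
        crossingFactor Q (!o) b a (up k b y j) (up k a x i) =
      counit (R := k) x * counit (R := k) y := by
  cases o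
  · rw [Finset.sum_comm, mul_comm]
    simp only [Bool.not_false, crossingFactor_true, crossingFactor_false]
    refine (strandForm_mul b a (Q.crossFormInv b a) (Q.crossForm b a) y x).symm.trans ?_
    rw [crossFormInv_mul]
    exact @eval_one k _ (Strand b C) (Strand a C) _ _ (strandCoalgebra b) _ _ (strandCoalgebra a)
      y x
  · simp only [Bool.not_true, crossingFactor_true, crossingFactor_false]
    refine (strandForm_mul a b (Q.crossForm a b) (Q.crossFormInv a b) x y).symm.trans ?_
    rw [crossForm_mul_inv]
    exact @eval_one k _ (Strand a C) (Strand b C) _ _ (strandCoalgebra a) _ _ (strandCoalgebra b)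
      x y

/-- The identity behind the braid relation. -/
theorem crossingFactor_three (o a b c : Bool) (x y z : C) :
    ∑ i ∈ (ℛ k x).index, ∑ j ∈ (ℛ k y).index, ∑ l ∈ (ℛ k z).index,
      crossingFactor Q o a b (lo k a x i) (lo k b y j) *
        crossingFactor Q o a c (up k a x i) (lo k c z l) *
          crossingFactor Q o b c (up k b y j) (up k c z l) =
    ∑ i ∈ (ℛ k x).index, ∑ j ∈ (ℛ k y).index, ∑ l ∈ (ℛ k z).index,
      crossingFactor Q o b c (lo k b y j) (lo k c z l) *
        crossingFactor Q o a c (lo k a x i) (up k c z l) *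
          crossingFactor Q o a b (up k a x i) (up k b y j) := by
  cases o
  -- If the lines `\` are over, the topmost strand is the last one from left to right. So the
  -- equation for the inverse forms is used with the strands in the order `c, b, a`.
  · have h := congrArg (fun F : Conv k (Strand c C) (Conv k (Strand b C) (Conv k (Strand a C) k))
      => F z y x) (Q.ybe_crossFormInv c b a)
    have h' := (E_23_13_12 ..).symm.trans (h.symm.trans (E_12_13_23 ..))
    have sw : ∀ F : C × C → C × C → C × C → k,
        ∑ i ∈ (ℛ k x).index, ∑ j ∈ (ℛ k y).index, ∑ l ∈ (ℛ k z).index, F i j l =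
        ∑ l ∈ (ℛ k z).index, ∑ j ∈ (ℛ k y).index, ∑ i ∈ (ℛ k x).index, F i j l := by
      intro F
      rw [Finset.sum_comm]
      simp only [Finset.sum_comm (s := (ℛ k x).index)]
      rw [Finset.sum_comm]
    simp only [crossingFactor_false]
    rw [sw, sw]
    exact h'
  · have h := congrArg (fun F : Conv k (Strand a C) (Conv k (Strand b C) (Conv k (Strand c C) k))
      => F x y z) (Q.ybe a b c)
    simp only [crossingFactor_true]
    exact (E_12_13_23 ..).symm.trans (h.trans (E_23_13_12 ..))

end StrictOrientedQuantumCoalgebra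

end YangBaxter

/-! ### Construction of models from square-zero extensions. -/

section Models

open WithConv

variable {k : Type u} {C : Type w} [Field k] [AddCommGroup C] [Module k C] [Coalgebra k C]

/-- The right module structure making the trivial square-zero extension of `k` by `C` available. -/
abbrev oppositeModule (k C : Type*) [Field k] [AddCommGroup C] [Module k C] : Module kᵐᵒᵖ C :=
  Module.compHom C ((RingHom.id k).fromOpposite mul_comm)

attribute [local instance] oppositeModule

theorem isCentralScalar_opposite (k C : Type*) [Field k] [AddCommGroup C] [Module k C] :
    IsCentralScalar k C := ⟨fun _ _ => rfl⟩

attribute [local instance] isCentralScalar_opposite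

/-- The algebra carrying the two lines of one crossing. -/
abbrev CrossingAlgebra (k C : Type*) [Field k] [AddCommGroup C] [Module k C] : Type _ :=
  TrivSqZeroExt k C ⊗[k] TrivSqZeroExt k C

/-- The linear maps contributed by the two lines of one crossing. -/
def lineMap (k C : Type*) [Field k] [AddCommGroup C] [Module k C] (s : Bool) :
    C →ₗ[k] CrossingAlgebra k C :=
  if s then (TensorProduct.mk k _ _).flip 1 ∘ₗ TrivSqZeroExt.inrHom k C
  else TensorProduct.mk k _ _ 1 ∘ₗ TrivSqZeroExt.inrHom k C

/-- The functional on the algebra of a crossing given by a bilinear form. -/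
def crossingFunctional (B : C →ₗ[k] C →ₗ[k] k) : CrossingAlgebra k C →ₗ[k] k :=
  TensorProduct.lift
    ((LinearMap.mul k k).compl₁₂ (TrivSqZeroExt.fstHom k k C).toLinearMap
        (TrivSqZeroExt.fstHom k k C).toLinearMap +
      B.compl₁₂ (TrivSqZeroExt.sndHom k C) (TrivSqZeroExt.sndHom k C))

/-- The scalar and the square-zero parts keep two requirements apart: a piece without crossing must
contribute `1`, and the product of the two lines of a crossing the value of `B`. -/
theorem crossingFunctional_one (B : C →ₗ[k] C →ₗ[k] k) :
    crossingFunctional B (1 : CrossingAlgebra k C) = 1 := by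
  rw [Algebra.TensorProduct.one_def, crossingFunctional, TensorProduct.lift.tmul]
  simp

theorem crossingFunctional_line (B : C →ₗ[k] C →ₗ[k] k) (x y : C) :
    crossingFunctional B (lineMap k C true x * lineMap k C false y) = B x y := by
  have : lineMap k C true x * lineMap k C false y =
      (TrivSqZeroExt.inr x : TrivSqZeroExt k C) ⊗ₜ[k] (TrivSqZeroExt.inr y : TrivSqZeroExt k C) := by
    simp [lineMap, Algebra.TensorProduct.tmul_mul_tmul]
  rw [this, crossingFunctional, TensorProduct.lift.tmul]
  simp

/-- The factor of a crossing as a bilinear form. -/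
def crossingBilin (Q : StrictOrientedQuantumCoalgebra k C) (o a b : Bool) :
    C →ₗ[k] C →ₗ[k] k :=
  LinearMap.mk₂ k (crossingFactor Q o a b)
    (by intros; cases o <;> cases a <;> cases b <;> simp [crossingFactor])
    (by intros; cases o <;> cases a <;> cases b <;> simp [crossingFactor])
    (by intros; cases o <;> cases a <;> cases b <;> simp [crossingFactor])
    (by intros; cases o <;> cases a <;> cases b <;> simp [crossingFactor])

/-- The bilinear form of a piece, zero if the piece is not a crossing. -/
def Piece.bilin (Q : StrictOrientedQuantumCoalgebra k C) : Piece → C →ₗ[k] C →ₗ[k] k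
  | .cross o a b => crossingBilin Q o a b
  | _ => 0

/-- The product of two linear functionals. -/
def tensorFunctional {R R' : Type*} [CommRing R] [Algebra k R] [CommRing R'] [Algebra k R']
    (Φ : R →ₗ[k] k) (Φ' : R' →ₗ[k] k) : R ⊗[k] R' →ₗ[k] k :=
  TensorProduct.lift ((LinearMap.mul k k).compl₁₂ Φ Φ')

@[simp] theorem tensorFunctional_tmul {R R' : Type*} [CommRing R] [Algebra k R]
    [CommRing R'] [Algebra k R'] (Φ : R →ₗ[k] k) (Φ' : R' →ₗ[k] k) (x : R) (y : R') :
    tensorFunctional Φ Φ' (x ⊗ₜ y) = Φ x * Φ' y := rfl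

/-- Composition of a linear map with an algebra homomorphism. -/
def postcomp {R R' : Type*} [CommRing R] [Algebra k R] [CommRing R'] [Algebra k R']
    (f : R →ₐ[k] R') (χ : WithConv (C →ₗ[k] R)) : WithConv (C →ₗ[k] R') :=
  toConv (f.toLinearMap ∘ₗ χ.ofConv)

@[simp] theorem postcomp_apply {R R' : Type*} [CommRing R] [Algebra k R] [CommRing R']
    [Algebra k R'] (f : R →ₐ[k] R') (χ : WithConv (C →ₗ[k] R)) (c : C) :
    postcomp f χ c = f (χ c) := rfl

namespace Model

variable {Q : StrictOrientedQuantumCoalgebra k C}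

/-- The base field would serve as well; the crossing algebra is chosen because it lies in the
universe of the models of longer words. -/
def nil (Q : StrictOrientedQuantumCoalgebra k C) : Model.{max u w} Q [] where
  R := CrossingAlgebra k C
  χ _ := 0
  Φ := crossingFunctional 0
  pure c := by simp [crossingProduct, crossingFunctional_one]

def single (Q : StrictOrientedQuantumCoalgebra k C) (s : Slice) : Model.{max u w} Q [s] where
  R := CrossingAlgebra k C
  χ u := toConv (lineMap k C u.2)
  Φ := crossingFunctional (s.piece.bilin Q)
  pure c := by
    rcases h : s.piece with _ | _ | ⟨o, a, b⟩
    · simp [crossingProduct, lineProduct, h, crossingFunctional_one]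
    · simp [crossingProduct, lineProduct, h, crossingFunctional_one]
    · simpa [crossingProduct, lineProduct, h, Piece.bilin, crossingBilin] using
        crossingFunctional_line (crossingBilin Q o a b) (c (0, true)) (c (0, false))

def append {w₁ w₂ : List Slice} (m : Model.{v} Q w₁) (m' : Model.{v} Q w₂) :
    Model.{v} Q (w₁ ++ w₂) where
  R := m.R ⊗[k] m'.R
  χ u := if u.1 < w₁.length then postcomp Algebra.TensorProduct.includeLeft (m.χ u)
    else postcomp Algebra.TensorProduct.includeRight (m'.χ (u.1 - w₁.length, u.2))
  Φ := tensorFunctional m.Φ m'.Φ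
  pure c := by
    have h1 : ∀ h ∈ Finset.range w₁.length, lineProduct (fun u : ℕ × Bool =>
        if u.1 < w₁.length then
          postcomp (Algebra.TensorProduct.includeLeft : m.R →ₐ[k] m.R ⊗[k] m'.R) (m.χ u)
        else postcomp Algebra.TensorProduct.includeRight (m'.χ (u.1 - w₁.length, u.2)))
        (w₁ ++ w₂) c h = (Algebra.TensorProduct.includeLeft : m.R →ₐ[k] m.R ⊗[k] m'.R)
          (lineProduct m.χ w₁ c h) := by
      intro h hh
      rw [Finset.mem_range] at hh
      simp only [lineProduct, List.getElem?_append_left hh]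
      split
      · simp only [if_pos hh, postcomp_apply, map_mul]
      · rw [map_one]
    have h2 : ∀ h ∈ Finset.range w₂.length, lineProduct (fun u : ℕ × Bool =>
        if u.1 < w₁.length then
          postcomp (Algebra.TensorProduct.includeLeft : m.R →ₐ[k] m.R ⊗[k] m'.R) (m.χ u)
        else postcomp Algebra.TensorProduct.includeRight (m'.χ (u.1 - w₁.length, u.2)))
        (w₁ ++ w₂) c (w₁.length + h) =
          (Algebra.TensorProduct.includeRight : m'.R →ₐ[k] m.R ⊗[k] m'.R)
          (lineProduct m'.χ w₂ (fun u => c (w₁.length + u.1, u.2)) h) := by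
      intro h hh
      simp only [lineProduct, List.getElem?_append_right (Nat.le_add_right _ _),
        Nat.add_sub_cancel_left]
      split
      · simp only [if_neg (Nat.not_lt.2 (Nat.le_add_right _ _)), postcomp_apply, map_mul]
      · rw [map_one]
    have h3 : crossingProduct Q (w₁ ++ w₂) c = crossingProduct Q w₁ c *
        crossingProduct Q w₂ (fun u => c (w₁.length + u.1, u.2)) := by
      rw [crossingProduct, List.length_append, Finset.prod_range_add]
      congr 1
      · refine Finset.prod_congr rfl fun h hh => ?_
        rw [List.getElem?_append_left (Finset.mem_range.1 hh)]
      · refine Finset.prod_congr rfl fun h hh => ?_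
        rw [List.getElem?_append_right (Nat.le_add_right _ _), Nat.add_sub_cancel_left]
    rw [List.length_append, Finset.prod_range_add, Finset.prod_congr rfl h1,
      Finset.prod_congr rfl h2, ← map_prod, ← map_prod, h3, ← m.pure, ← m'.pure]
    rw [Algebra.TensorProduct.includeLeft_apply, Algebra.TensorProduct.includeRight_apply,
      Algebra.TensorProduct.tmul_mul_tmul, one_mul, mul_one, tensorFunctional_tmul]

/-- A model of every word. -/
def ofWord (Q : StrictOrientedQuantumCoalgebra k C) : (w : List Slice) → Model.{max u w} Q w
  | [] => nil Q
  | s :: w => (single Q s).append (ofWord Q w)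

/-- Only the pieces matter for a model. -/
def pad {w : List Slice} (m : Model.{v} Q w) (l r : List Bool) :
    Model.{v} Q (w.map (Slice.pad l r)) where
  R := m.R
  χ := m.χ
  Φ := m.Φ
  pure c := by
    have h : ∀ h : ℕ,
        ((w.map (Slice.pad l r))[h]?).map Slice.piece = (w[h]?).map Slice.piece := by
      intro h
      rw [List.getElem?_map, Option.map_map]
      rfl
    simp only [crossingProduct, lineProduct, h, List.length_map]
    exact m.pure c

end Model

end Models

/-! ### Independence of starting points, and admissible choices. -/

section AdmissibleValues

open WithConv

variable {k C : Type*} [Field k] [AddCommGroup C] [Module k C] [Coalgebra k C]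
variable {R : Type v} [CommRing R] [Algebra k R]

theorem PermOn.comps_nodup {P : Type*} {X : Set P} {σ : P → P} (h : PermOn X σ) {S : List P}
    (hS : IsTransversal X σ S) (dir : P → Bool) :
    ((S.map fun p => (dir p, cycleList σ p)).flatMap Prod.snd).Nodup ∧
      ∀ q, q ∈ (S.map fun p => (dir p, cycleList σ p)).flatMap Prod.snd ↔ q ∈ X := by
  rw [List.flatMap_map]
  exact h.flatMap_cycleList hS

/-- Two labellings of a system by beads which agree on pure tensors have the same value. -/
theorem prod_close_cycleProd_eq (Q : TwistOrientedQuantumCoalgebra k C) {R' : Type v} [CommRing R']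
    [Algebra k R'] {P : Type*} {X : Set P} {σ : P → P} (hX : PermOn X σ)
    {S : List P} (hS : IsTransversal X σ S) (dir : P → Bool)
    {lab : P → Bead Q.toStrictOrientedQuantumCoalgebra R}
    {lab' : P → Bead Q.toStrictOrientedQuantumCoalgebra R'}
    (hdeg : ∀ p, (lab p).deg = (lab' p).deg) (c : C) (Φ : R →ₗ[k] k) (Φ' : R' →ₗ[k] k)
    (h : ∀ (F : Finset P) (y : P → C), (∀ p, p ∈ F ↔ p ∈ X) →
      Φ (∏ p ∈ F, (lab p).val (y p)) = Φ' (∏ p ∈ F, (lab' p).val (y p))) :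
    Φ ((S.map fun p => Q.close c (dir p) (cycleProd σ lab p)).prod) =
      Φ' ((S.map fun p => Q.close c (dir p) (cycleProd σ lab' p)).prod) := by
  classical
  obtain ⟨h1, h2⟩ := hX.comps_nodup hS dir
  have := prod_close_eq_of_pure Q hdeg c _ h1 Φ Φ' fun y => by
    rw [← List.prod_toFinset _ h1, ← List.prod_toFinset _ h1]
    exact h _ y fun p => by rw [List.mem_toFinset, h2]
  simpa only [List.map_map, Function.comp_def, ← cycleProd_eq] using this

/-- The value of a functional on a diagram with starting points. -/
def linkValue (Q : TwistOrientedQuantumCoalgebra k C) (c : C) (w : List Slice)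
    (m : Model.{v} Q.toStrictOrientedQuantumCoalgebra w) (S : List (ℕ × ℕ)) : k :=
  m.Φ ((S.map fun p => Q.close c (direction w p) (cycleProd (next w)
      (fun q => (step w q).2.bead Q.toStrictOrientedQuantumCoalgebra m.χ) p)).prod)

theorem linkValue_eq (Q : TwistOrientedQuantumCoalgebra k C) {c : C} (hc : IsCocommutative k c)
    (D : OrientedLinkDiagram) (m : Model.{v} Q.toStrictOrientedQuantumCoalgebra D.word)
    {S S' : List (ℕ × ℕ)} (hS : IsStartingList D S) (hS' : IsStartingList D S') :
    linkValue Q c D.word m S = linkValue Q c D.word m S' := by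
  rw [linkValue, linkValue, prod_close_transversal_eq Q hc (permOn_next D.fits)
    (step_bead_deg _ _ D.fits) (isStartingList_iff.1 hS) (isStartingList_iff.1 hS')]

theorem Event.map_apply (χ : ℕ × Bool → WithConv (C →ₗ[k] R)) (e : Event) (x : C) :
    e.map χ x = (match e.crossingLine with
      | some _ => (1 : R)
      | none => algebraMap k R (counit (R := k) x)) * (match e.crossingLine with
      | some u => χ u x
      | none => 1) := by
  cases e <;> simp [Event.map, Event.crossingLine, LinearMap.convOne_apply]

theorem linePoint_injOn {w : List Slice} (hw : Fits [] w []) :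
    Set.InjOn (linePoint w) (crossingSet w : Set (ℕ × Bool)) := by
  intro u hu v hv e
  have h1 := (crossingLine_step_iff hw (linePoint_isPoint hw hu) u).2 ⟨hu, rfl⟩
  have h2 := (crossingLine_step_iff hw (linePoint_isPoint hw hu) v).2 ⟨hv, e.symm⟩
  exact Option.some_injective _ (h1.symm.trans h2)

/-- The product over all points, split into counits and crossing lines. -/
theorem prod_points_eq (χ : ℕ × Bool → WithConv (C →ₗ[k] R)) {w : List Slice}
    (hw : Fits [] w []) (F : Finset (ℕ × ℕ)) (hF : ∀ p, p ∈ F ↔ IsPoint w p)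
    (y : ℕ × ℕ → C) :
    ∏ p ∈ F, (step w p).2.map χ (y p) =
      (∏ p ∈ F, match (step w p).2.crossingLine with
        | some _ => (1 : R)
        | none => algebraMap k R (counit (R := k) (y p))) *
      ∏ h ∈ Finset.range w.length, lineProduct χ w (fun u => y (linePoint w u)) h := by
  simp only [Event.map_apply]
  rw [Finset.prod_mul_distrib, ← prod_crossingSet]
  congr 1
  have hsub : (crossingSet w).image (linePoint w) ⊆ F := by
    intro p hp
    obtain ⟨u, hu, rfl⟩ := Finset.mem_image.1 hp
    exact (hF _).2 (linePoint_isPoint hw hu)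
  rw [← Finset.prod_subset hsub, Finset.prod_image (linePoint_injOn hw)]
  · refine Finset.prod_congr rfl fun u hu => ?_
    rw [(crossingLine_step_iff hw (linePoint_isPoint hw hu) u).2 ⟨hu, rfl⟩]
  · intro p hp hn
    cases h : (step w p).2.crossingLine with
    | none => rfl
    | some u =>
      obtain ⟨h1, h2⟩ := (crossingLine_step_iff hw ((hF p).1 hp) u).1 h
      exact absurd (Finset.mem_image.2 ⟨u, h1, h2⟩) hn

theorem crossingProduct_Tu (Q : StrictOrientedQuantumCoalgebra k C) (w : List Slice)
    (x : ℕ × Bool → C) : crossingProduct Q w (fun u => Q.Tu (x u)) = crossingProduct Q w x := by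
  refine Finset.prod_congr rfl fun h _ => ?_
  rcases (w[h]?).map Slice.piece with _ | _ | _ | _ <;> try rfl
  exact StrictOrientedQuantumCoalgebra.crossingFactor_Tu Q _ _ _ _ _

theorem powEquiv_zero_one (Q : StrictOrientedQuantumCoalgebra k C) (c : C) :
    Q.powEquiv (0, 1) c = Q.Tu c := by
  simp [StrictOrientedQuantumCoalgebra.powEquiv]

/-- Precompose a bead with `T_u`. -/
def Bead.precompTu {Q : StrictOrientedQuantumCoalgebra k C} (x : Bead Q R) : Bead Q R :=
  ⟨Q.shift (0, 1) x.val, x.deg⟩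

theorem Bead.precompTu_mul {Q : StrictOrientedQuantumCoalgebra k C} (x y : Bead Q R) :
    (x * y).precompTu = x.precompTu * y.precompTu := by
  refine Bead.ext ?_ rfl
  simp only [precompTu, mul_val, Q.shift_mul, Q.shift_shift, add_comm]

theorem Bead.precompTu_prod {Q : StrictOrientedQuantumCoalgebra k C} (L : List (Bead Q R)) :
    L.prod.precompTu = (L.map precompTu).prod := by
  induction L with
  | nil => exact Bead.ext (Q.shift_one _) rfl
  | cons x L ih => rw [List.prod_cons, precompTu_mul, ih, List.map_cons, List.prod_cons]

/-- The extra `T_u` of a downward starting point fixes the power of `G`, so it lands on the bead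
product alone. -/
theorem TwistOrientedQuantumCoalgebra.close_false (Q : TwistOrientedQuantumCoalgebra k C) (c : C)
    (x : Bead Q.toStrictOrientedQuantumCoalgebra R) :
    Q.close c false x = Q.close c true x.precompTu := by
  rw [close, close, Q.shift_mul, Q.shift_unitG_zpow,
    show ((0 : ℤ), dirExp true) = 0 from rfl, Q.shift_zero]
  rfl

/-- If all starting points go down, the extra `T_u` distributes over the bead products and reaches
every label of the diagram at once. Counits and crossing factors do not change when `T_u` is applied
to all their arguments. -/
theorem linkValue_down (Q : TwistOrientedQuantumCoalgebra k C) (c : C)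
    (D : OrientedLinkDiagram) (m : Model.{v} Q.toStrictOrientedQuantumCoalgebra D.word)
    {S : List (ℕ × ℕ)} (hS : IsStartingList D S) (hd : ∀ p ∈ S, direction D.word p = false) :
    linkScalar Q c D S = linkValue Q c D.word m S := by
  rw [linkScalar_eq Q c m hS, linkValue]
  have h1 : (S.map fun p => Q.close c (direction D.word p) (cycleProd (next D.word)
      (fun q => (step D.word q).2.bead Q.toStrictOrientedQuantumCoalgebra m.χ) p)) =
      S.map fun p => Q.close c true (cycleProd (next D.word)
      (fun q => ((step D.word q).2.bead Q.toStrictOrientedQuantumCoalgebra m.χ).precompTu) p) := by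
    refine List.map_congr_left fun p hp => ?_
    rw [hd p hp, Q.close_false, cycleProd_eq, cycleProd_eq, Bead.precompTu_prod, List.map_map]
    rfl
  rw [h1]
  refine Eq.symm (prod_close_cycleProd_eq Q (permOn_next D.fits) (isStartingList_iff.1 hS)
    (fun _ => true)
    (lab := fun q => ((step D.word q).2.bead Q.toStrictOrientedQuantumCoalgebra m.χ).precompTu)
    (lab' := fun q => (step D.word q).2.bead Q.toStrictOrientedQuantumCoalgebra m.χ)
    (fun _ => rfl) c m.Φ m.Φ fun F y hF => ?_)
  have h2 : ∀ p, ((step D.word p).2.bead Q.toStrictOrientedQuantumCoalgebra m.χ).precompTu.val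
      (y p) = (step D.word p).2.map m.χ (Q.Tu (y p)) := fun p => by
    rw [← powEquiv_zero_one]; rfl
  have h3 : ∀ p, ((step D.word p).2.bead Q.toStrictOrientedQuantumCoalgebra m.χ).val
      (y p) = (step D.word p).2.map m.χ (y p) := fun p => rfl
  simp only [h2, h3]
  -- Points which precede no crossing line only contribute counits, so on pure tensors the
  -- functional is a scalar multiple of the crossing product.
  have h4 : ∀ z : ℕ × ℕ → C, m.Φ (∏ p ∈ F, (step D.word p).2.map m.χ (z p)) =
      (∏ p ∈ F, match (step D.word p).2.crossingLine with
        | some _ => (1 : k)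
        | none => counit (R := k) (z p)) *
      crossingProduct Q.toStrictOrientedQuantumCoalgebra D.word
        (fun u => z (linePoint D.word u)) := by
    intro z
    rw [prod_points_eq m.χ D.fits F hF, ← m.pure]
    have : (∏ p ∈ F, match (step D.word p).2.crossingLine with
        | some _ => (1 : m.R)
        | none => algebraMap k m.R (counit (R := k) (z p))) = algebraMap k m.R
      (∏ p ∈ F, match (step D.word p).2.crossingLine with
        | some _ => (1 : k)
        | none => counit (R := k) (z p)) := by
      rw [map_prod]
      refine Finset.prod_congr rfl fun p _ => ?_
      cases (step D.word p).2.crossingLine <;> simp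
    rw [this, ← Algebra.smul_def, map_smul, smul_eq_mul]
  rw [h4, h4, crossingProduct_Tu]
  congr 1
  refine Finset.prod_congr rfl fun p _ => ?_
  cases (step D.word p).2.crossingLine with
  | none => exact counit_aut (coalgEquiv_mem_coalgAut Q.Tu) (y p)
  | some => rfl

/-- The scalar of a diagram, computed from admissible starting points. -/
theorem linkScalar_eq_linkValue (Q : TwistOrientedQuantumCoalgebra k C) (c : C)
    (D : OrientedLinkDiagram) (m : Model.{v} Q.toStrictOrientedQuantumCoalgebra D.word)
    {S : List (ℕ × ℕ)} (hS : IsStartingList D S)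
    (hadm : (∃ up : Bool, ∀ p ∈ S, direction D.word p = up) ∨ Q.Tu c = c) :
    linkScalar Q c D S = linkValue Q c D.word m S := by
  rcases hadm with ⟨up, h⟩ | hT
  · cases up with
    | false => exact linkValue_down Q c D m hS h
    | true =>
      rw [linkScalar_eq Q c m hS, linkValue]
      congr 2
      exact List.map_congr_left fun p hp => by rw [h p hp]
  -- If `T_u` fixes `c`, the correction for the direction of a starting point has no effect.
  · rw [linkScalar_eq Q c m hS, linkValue]
    congr 2
    refine List.map_congr_left fun p _ => ?_
    cases direction D.word p with
    | true => rfl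
    | false =>
      have : Q.powEquiv (0, dirExp false) c = Q.powEquiv (0, dirExp true) c := by
        rw [show ((0 : ℤ), dirExp false) = (0, 1) from rfl, powEquiv_zero_one, hT,
          show ((0 : ℤ), dirExp true) = 0 from rfl, Q.powEquiv_zero]
        rfl
      rw [TwistOrientedQuantumCoalgebra.close, TwistOrientedQuantumCoalgebra.close,
        Q.shift_apply, Q.shift_apply, this]

end AdmissibleValues

/-! ### Strands through a word of slices. -/

section Passages

open Function

/-- Renumber the slice in which a crossing line is met. -/
def Event.raise (H : ℕ) : Event → Event
  | .line h s => .line (H + h) s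
  | e => e

theorem Event.raise_zero (e : Event) : e.raise 0 = e := by
  cases e <;> simp [Event.raise]

theorem Slice.enterBelow_raise (s : Slice) (H h j : ℕ) :
    s.enterBelow (H + h) j =
      ((H + (s.enterBelow h j).1.1, (s.enterBelow h j).1.2), (s.enterBelow h j).2.raise H) := by
  obtain ⟨l, p, r⟩ := s
  rcases p with _ | _ | _ <;> simp only [enterBelow] <;> split_ifs <;>
    simp [Event.raise, add_assoc]

theorem Slice.enterAbove_raise (s : Slice) (H h j : ℕ) :
    s.enterAbove (H + h) j =
      ((H + (s.enterAbove h j).1.1, (s.enterAbove h j).1.2), (s.enterAbove h j).2.raise H) := by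
  obtain ⟨l, p, r⟩ := s
  rcases p with _ | _ | _ <;> simp only [enterAbove] <;> split_ifs <;>
    simp [Event.raise, add_assoc]

/-- From height `h` one can step in direction `d` inside a word of length `n`. -/
def CanStep (n : ℕ) (d : Bool) (h : ℕ) : Prop := if d then h < n else 0 < h ∧ h ≤ n

theorem dirStep_append {a w b : List Slice} {d : Bool} {h : ℕ} (hv : CanStep w.length d h)
    (j : ℕ) :
    dirStep (a ++ w ++ b) d (a.length + h, j) =
      ((a.length + (dirStep w d (h, j)).1.1, (dirStep w d (h, j)).1.2),
        (dirStep w d (h, j)).2.raise a.length) := by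
  have key : ∀ i < w.length, (a ++ w ++ b)[a.length + i]? = w[i]? := by
    intro i hi
    rw [List.append_assoc, List.getElem?_append_right (Nat.le_add_right _ _),
      Nat.add_sub_cancel_left, List.getElem?_append_left hi]
  cases d with
  | true =>
    have hv' : h < w.length := hv
    have e : w[h]? = some w[h] := List.getElem?_eq_getElem hv'
    rw [dirStep_up ((key h hv').trans e), dirStep_up e, Slice.enterBelow_raise]
  | false =>
    obtain ⟨h0, hle⟩ : 0 < h ∧ h ≤ w.length := hv
    obtain ⟨h, rfl⟩ := Nat.exists_eq_succ_of_ne_zero h0.ne'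
    have e : w[h]? = some w[h] := List.getElem?_eq_getElem hle
    rw [Nat.succ_eq_add_one, ← add_assoc, dirStep_down ((key h hle).trans e), dirStep_down e,
      Slice.enterAbove_raise]

theorem newDir_add (d : Bool) (a h h' : ℕ) : newDir d (a + h) (a + h') = newDir d h h' := by
  cases d <;> simp [newDir]

theorem Slice.enterBelow_height (s : Slice) (h j : ℕ) :
    (s.enterBelow h j).1.1 = h ∨ (s.enterBelow h j).1.1 = h + 1 := by
  obtain ⟨l, p, r⟩ := s
  rcases p with _ | _ | _ <;> simp only [enterBelow] <;> split_ifs <;> simp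

theorem Slice.enterAbove_height (s : Slice) (h j : ℕ) :
    (s.enterAbove h j).1.1 = h ∨ (s.enterAbove h j).1.1 = h + 1 := by
  obtain ⟨l, p, r⟩ := s
  rcases p with _ | _ | _ <;> simp only [enterAbove] <;> split_ifs <;> simp

/-- After a step inside a word of length `n`, one has reached its upper boundary going up, its lower
boundary going down, or some height strictly in between. -/
theorem dirStep_height {w : List Slice} {d : Bool} {h : ℕ} (hv : CanStep w.length d h) (j : ℕ) :
    (dirStep w d (h, j)).1.1 ≤ w.length ∧
    (newDir d h (dirStep w d (h, j)).1.1 = true → 0 < (dirStep w d (h, j)).1.1) ∧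
    (newDir d h (dirStep w d (h, j)).1.1 = false → (dirStep w d (h, j)).1.1 < w.length) := by
  cases d with
  | true =>
    have hv' : h < w.length := hv
    rw [dirStep_up (List.getElem?_eq_getElem hv')]
    have := Slice.enterBelow_height w[h] h j
    refine ⟨by omega, ?_, ?_⟩
    · simp only [newDir, if_true, decide_eq_true_eq]; omega
    · simp only [newDir, if_true, decide_eq_false_iff_not]; omega
  | false =>
    obtain ⟨h0, hle⟩ : 0 < h ∧ h ≤ w.length := hv
    obtain ⟨h, rfl⟩ := Nat.exists_eq_succ_of_ne_zero h0.ne'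
    have hle' : h < w.length := hle
    rw [Nat.succ_eq_add_one, dirStep_down (List.getElem?_eq_getElem hle')]
    have := Slice.enterAbove_height w[h] h j
    refine ⟨by omega, ?_, ?_⟩
    · simp [newDir]; omega
    · simp [newDir]; omega

/-- `Passage w d p d' j E`: the traversal of `w` from `p` in direction `d` leaves `w` in direction
`d'` at position `j`, after meeting `E`. -/
inductive Passage (w : List Slice) : Bool → ℕ × ℕ → Bool → ℕ → List Event → Prop
  | exit {d : Bool} {p : ℕ × ℕ} (h : p.1 = if d then w.length else 0) : Passage w d p d p.2 []
  | step {d : Bool} {p : ℕ × ℕ} {d' : Bool} {j : ℕ} {E : List Event}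
      (hv : CanStep w.length d p.1)
      (hs : Passage w (newDir d p.1 (dirStep w d p).1.1) (dirStep w d p).1 d' j E) :
      Passage w d p d' j ((dirStep w d p).2 :: E)

/-- The traversal of a diagram follows the strands of its parts. -/
theorem Passage.sound {a w b : List Slice} (hW : Fits [] (a ++ w ++ b) []) {d d' : Bool} {p : ℕ × ℕ}
    {j : ℕ} {E : List Event} (hs : Passage w d p d' j E)
    (hp : IsPoint (a ++ w ++ b) (a.length + p.1, p.2))
    (hd : direction (a ++ w ++ b) (a.length + p.1, p.2) = d) :
    (next (a ++ w ++ b))^[E.length] (a.length + p.1, p.2) =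
        (a.length + (if d' then w.length else 0), j) ∧
      ((List.range E.length).map fun t =>
        (OQC.step (a ++ w ++ b) ((next (a ++ w ++ b))^[t] (a.length + p.1, p.2))).2) =
          E.map (Event.raise a.length) ∧
      ∀ t, 0 < t → t < E.length →
        a.length < ((next (a ++ w ++ b))^[t] (a.length + p.1, p.2)).1 ∧
          ((next (a ++ w ++ b))^[t] (a.length + p.1, p.2)).1 < a.length + w.length := by
  induction hs with
  | exit h => exact ⟨by rw [← h]; rfl, rfl, fun t h1 h2 => absurd h2 (by simp)⟩
  | @step d p d' j E hv hs ih =>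
    have hstep := dirStep_append (a := a) (b := b) hv p.2
    rw [← hd, ← step_eq, hd] at hstep
    have hnext : next (a ++ w ++ b) (a.length + p.1, p.2) =
        (a.length + (dirStep w d p).1.1, (dirStep w d p).1.2) := by rw [next, hstep]
    have hp' := isPoint_next hW hp
    have hd' := direction_next hW hp
    rw [hnext] at hp' hd'
    rw [hd, newDir_add] at hd'
    obtain ⟨h1, h2, h3⟩ := ih hp' hd'
    refine ⟨?_, ?_, ?_⟩
    · rw [List.length_cons, iterate_succ_apply, hnext, h1]
    · rw [List.length_cons, List.range_succ_eq_map, List.map_cons, List.map_map, List.map_cons]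
      congr 1
      · rw [iterate_zero_apply, hstep]
      · rw [← h2]
        refine List.map_congr_left fun t _ => ?_
        rw [Function.comp_apply, iterate_succ_apply, hnext]
    · intro t ht0 ht
      obtain ⟨t, rfl⟩ := Nat.exists_eq_succ_of_ne_zero ht0.ne'
      rw [iterate_succ_apply, hnext]
      rcases Nat.eq_zero_or_pos t with rfl | h0
      · rw [iterate_zero_apply]
        obtain ⟨e1, e2, e3⟩ := dirStep_height hv p.2
        -- The strand has a further step to make, so this point is not on the boundary it is heading
        -- for; it is not on the other boundary by `dirStep_height`.
        cases hs with
        | exit => simp at ht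
        | step hv' _ =>
          change CanStep _ (newDir d p.1 (dirStep w d (p.1, p.2)).1.1) (dirStep w d (p.1, p.2)).1.1
            at hv'
          change a.length < a.length + (dirStep w d (p.1, p.2)).1.1 ∧
            a.length + (dirStep w d (p.1, p.2)).1.1 < a.length + w.length
          cases hn : newDir d p.1 (dirStep w d (p.1, p.2)).1.1 with
          | true =>
            rw [hn] at hv'
            have hv'' : (dirStep w d (p.1, p.2)).1.1 < w.length := hv'
            have := e2 hn
            omega
          | false =>
            rw [hn] at hv'
            have hv'' : 0 < (dirStep w d (p.1, p.2)).1.1 ∧ _ := hv'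
            have := e3 hn
            omega
      · exact h3 t h0 (by simpa using ht)

/-! ### Padding -/

theorem Slice.enterBelow_pad (s : Slice) (l r : List Bool) (h j : ℕ) :
    (s.pad l r).enterBelow h (l.length + j) =
      (((s.enterBelow h j).1.1, l.length + (s.enterBelow h j).1.2), (s.enterBelow h j).2) := by
  obtain ⟨l', p, r'⟩ := s
  rcases p with _ | _ | _ <;>
    simp only [enterBelow, pad, List.length_append, Nat.add_lt_add_iff_left, Nat.add_left_cancel_iff,
      add_assoc] <;> split_ifs <;> simp <;> omega

theorem Slice.enterAbove_pad (s : Slice) (l r : List Bool) (h j : ℕ) :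
    (s.pad l r).enterAbove h (l.length + j) =
      (((s.enterAbove h j).1.1, l.length + (s.enterAbove h j).1.2), (s.enterAbove h j).2) := by
  obtain ⟨l', p, r'⟩ := s
  rcases p with _ | _ | _ <;>
    simp only [enterAbove, pad, List.length_append, Nat.add_lt_add_iff_left, Nat.add_left_cancel_iff,
      add_assoc] <;> split_ifs <;> simp <;> omega

theorem dirStep_pad {w : List Slice} (l r : List Bool) {d : Bool} {p : ℕ × ℕ}
    (hv : CanStep w.length d p.1) :
    dirStep (w.map (Slice.pad l r)) d (p.1, l.length + p.2) =
      (((dirStep w d p).1.1, l.length + (dirStep w d p).1.2), (dirStep w d p).2) := by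
  obtain ⟨h, j⟩ := p
  cases d with
  | true =>
    have hv' : h < w.length := hv
    have e : w[h]? = some w[h] := List.getElem?_eq_getElem hv'
    rw [dirStep_up e, dirStep_up (s := w[h].pad l r) (by simp [e]), Slice.enterBelow_pad]
  | false =>
    obtain ⟨h0, hle⟩ : 0 < h ∧ h ≤ w.length := hv
    obtain ⟨h, rfl⟩ := Nat.exists_eq_succ_of_ne_zero h0.ne'
    have e : w[h]? = some w[h] := List.getElem?_eq_getElem hle
    rw [Nat.succ_eq_add_one, dirStep_down e, dirStep_down (s := w[h].pad l r) (by simp [e]),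
      Slice.enterAbove_pad]

theorem Passage.pad {w : List Slice} (l r : List Bool) {d d' : Bool} {p : ℕ × ℕ} {j : ℕ}
    {E : List Event} (hs : Passage w d p d' j E) :
    Passage (w.map (Slice.pad l r)) d (p.1, l.length + p.2) d' (l.length + j) E := by
  induction hs with
  | @exit d p h => exact Passage.exit (p := (p.1, l.length + p.2)) (by simpa using h)
  | @step d p d' j E hv hs ih =>
    have e := dirStep_pad l r hv
    have := Passage.step (w := w.map (Slice.pad l r)) (d := d) (p := (p.1, l.length + p.2))
      (by simpa using hv) (by rw [e]; exact ih)
    rwa [e] at this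

/-- A vertical line through all slices of a word. -/
theorem Passage.vertical {w : List Slice} (f : ℕ → ℕ)
    (hup : ∀ (h : ℕ) (hh : h < w.length), w[h].enterBelow h (f h) = ((h + 1, f (h + 1)), .plain))
    (hdown : ∀ (h : ℕ) (hh : h < w.length), w[h].enterAbove h (f (h + 1)) = ((h, f h), .plain))
    (d : Bool) {h : ℕ} (hle : h ≤ w.length) :
    ∃ m, Passage w d (h, f h) d (f (if d then w.length else 0)) (List.replicate m .plain) := by
  cases d with
  | true =>
    induction hn : w.length - h generalizing h with
    | zero =>
      obtain rfl : h = w.length := by omega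
      exact ⟨0, Passage.exit rfl⟩
    | succ m ih =>
      have hlt : h < w.length := by omega
      obtain ⟨m, hm⟩ := ih (h := h + 1) hlt (by omega)
      have e : dirStep w true (h, f h) = ((h + 1, f (h + 1)), .plain) := by
        rw [dirStep_up (List.getElem?_eq_getElem hlt), hup]
      have := Passage.step (w := w) (d := true) (p := (h, f h)) hlt
        (by rw [e]; simpa [newDir] using hm)
      rw [e] at this
      exact ⟨m + 1, this⟩
  | false =>
    induction h with
    | zero => exact ⟨0, Passage.exit rfl⟩
    | succ h ih =>
      obtain ⟨m, hm⟩ := ih (by omega)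
      have e : dirStep w false (h + 1, f (h + 1)) = ((h, f h), .plain) := by
        rw [dirStep_down (List.getElem?_eq_getElem hle), hdown]
      have := Passage.step (w := w) (d := false) (p := (h + 1, f (h + 1))) ⟨by simp, hle⟩
        (by rw [e]; simpa [newDir] using hm)
      rw [e] at this
      exact ⟨m + 1, this⟩

/-- Directions at height `h` of a word with upper boundary `t`. -/
def cutLevel (w : List Slice) (t : List Bool) (h : ℕ) : List Bool :=
  ((w[h]?).map Slice.bot).getD t

theorem cutLevel_of_getElem? {w : List Slice} {t : List Bool} {h : ℕ} {s : Slice}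
    (hs : w[h]? = some s) : cutLevel w t h = s.bot := by simp [cutLevel, hs]

theorem cutLevel_length (w : List Slice) (t : List Bool) : cutLevel w t w.length = t := by
  simp [cutLevel]

theorem Fits.cutLevel_zero {u t : List Bool} {w : List Slice} (hw : Fits u w t) :
    cutLevel w t 0 = u := by
  cases h : w[0]? with
  | none =>
    obtain rfl : w = [] := by simpa using h
    exact hw.symm
  | some s => rw [cutLevel_of_getElem? h, hw.bot_eq h]

theorem Fits.cutLevel_succ {u t : List Bool} {w : List Slice} (hw : Fits u w t) {h : ℕ}
    (hh : h < w.length) : cutLevel w t (h + 1) = w[h].top :=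
  hw.succ (List.getElem?_eq_getElem hh)

theorem Passage.left {w : List Slice} (l r : List Bool) {j : ℕ} (hj : j < l.length)
    (d : Bool) {h : ℕ} (hle : h ≤ w.length) :
    ∃ m, Passage (w.map (Slice.pad l r)) d (h, j) d j (List.replicate m .plain) := by
  refine Passage.vertical (w := w.map (Slice.pad l r)) (fun _ => j) ?_ ?_ d (by simpa using hle)
  · intro h hh
    exact Slice.enterBelow_left (by simp [Slice.pad]; omega)
  · intro h hh
    exact Slice.enterAbove_left (by simp [Slice.pad]; omega)

/-- Such a line keeps its distance from the right end of every level, while its position from the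
left varies with the length of the level. -/
theorem Passage.right {u t : List Bool} {w : List Slice} (hw : Fits u w t) (l r : List Bool) (i : ℕ)
    (d : Bool) {h : ℕ} (hle : h ≤ w.length) :
    ∃ m, Passage (w.map (Slice.pad l r)) d (h, l.length + (cutLevel w t h).length + i) d
      (l.length + (if d then t else u).length + i) (List.replicate m .plain) := by
  have hup : ∀ (h : ℕ) (hh : h < (w.map (Slice.pad l r)).length),
      (w.map (Slice.pad l r))[h].enterBelow h (l.length + (cutLevel w t h).length + i) =
        ((h + 1, l.length + (cutLevel w t (h + 1)).length + i), .plain) := by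
    intro h hh
    have hh' : h < w.length := by simpa using hh
    have := Slice.enterBelow_right (w[h].pad l r) h (w[h].right.length + i)
    rw [List.getElem_map, hw.cutLevel_succ hh',
      cutLevel_of_getElem? (List.getElem?_eq_getElem hh'), Slice.bot_length, Slice.top_length]
    simpa [Slice.pad, add_assoc] using this
  have hdown : ∀ (h : ℕ) (hh : h < (w.map (Slice.pad l r)).length),
      (w.map (Slice.pad l r))[h].enterAbove h (l.length + (cutLevel w t (h + 1)).length + i) =
        ((h, l.length + (cutLevel w t h).length + i), .plain) := by
    intro h hh
    have hh' : h < w.length := by simpa using hh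
    have := Slice.enterAbove_right (w[h].pad l r) h (w[h].right.length + i)
    rw [List.getElem_map, hw.cutLevel_succ hh',
      cutLevel_of_getElem? (List.getElem?_eq_getElem hh'), Slice.bot_length, Slice.top_length]
    simpa [Slice.pad, add_assoc] using this
  obtain ⟨m, hm⟩ := Passage.vertical (w := w.map (Slice.pad l r))
    (fun h => l.length + (cutLevel w t h).length + i) hup hdown d (by simpa using hle)
  refine ⟨m, ?_⟩
  cases d with
  | true => simpa [cutLevel_length] using hm
  | false => simpa [hw.cutLevel_zero] using hm

end Passages

/-! ### Diagrams with an open window. -/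

section Frames

open Function WithConv

variable {k C : Type*} [Field k] [AddCommGroup C] [Module k C] [Coalgebra k C]
variable {R R' : Type v} [CommRing R] [Algebra k R] [CommRing R'] [Algebra k R']
variable {Q : StrictOrientedQuantumCoalgebra k C}

/-! ### Extension of scalars for beads -/

/-- Extension of scalars for beads. -/
def Bead.map (f : R →ₐ[k] R') (x : Bead Q R) : Bead Q R' := ⟨postcomp f x.val, x.deg⟩

theorem postcomp_one (f : R →ₐ[k] R') : postcomp f (1 : WithConv (C →ₗ[k] R)) = 1 := by
  ext c
  simp [LinearMap.convOne_apply]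

theorem postcomp_mul (f : R →ₐ[k] R') (x y : WithConv (C →ₗ[k] R)) :
    postcomp f (x * y) = postcomp f x * postcomp f y := by
  ext c
  rw [postcomp_apply, (ℛ k c).convMul_apply, (ℛ k c).convMul_apply, map_sum]
  simp

theorem Bead.map_prod (f : R →ₐ[k] R') (L : List (Bead Q R)) :
    L.prod.map f = (L.map (Bead.map f)).prod := by
  induction L with
  | nil => exact Bead.ext (postcomp_one f) rfl
  | cons x L ih =>
    rw [List.prod_cons, List.map_cons, List.prod_cons, ← ih]
    exact Bead.ext (postcomp_mul f _ _) rfl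

theorem Event.bead_raise {χ : ℕ × Bool → WithConv (C →ₗ[k] R)}
    {χ' : ℕ × Bool → WithConv (C →ₗ[k] R')} (f : R →ₐ[k] R') {H n : ℕ}
    (hχ : ∀ h < n, ∀ s, χ' (H + h, s) = postcomp f (χ (h, s))) {e : Event}
    (he : ∀ h s, e = .line h s → h < n) :
    (e.raise H).bead Q χ' = (e.bead Q χ).map f := by
  cases e with
  | line h s => exact Bead.ext (hχ h (he h s rfl) s) rfl
  | _ => exact Bead.ext (postcomp_one f).symm rfl

theorem Slice.enterBelow_line {s : Slice} {h j h' : ℕ} {b : Bool}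
    (e : (s.enterBelow h j).2 = .line h' b) : h' = h := by
  obtain ⟨l, p, r⟩ := s
  rcases p with _ | _ | _ <;> simp only [enterBelow] at e <;> split_ifs at e <;> simp_all

theorem Slice.enterAbove_line {s : Slice} {h j h' : ℕ} {b : Bool}
    (e : (s.enterAbove h j).2 = .line h' b) : h' = h := by
  obtain ⟨l, p, r⟩ := s
  rcases p with _ | _ | _ <;> simp only [enterAbove] at e <;> split_ifs at e <;> simp_all

theorem dirStep_line {w : List Slice} {d : Bool} {p : ℕ × ℕ} (hv : CanStep w.length d p.1) (h : ℕ)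
    (s : Bool) (e : (dirStep w d p).2 = .line h s) : h < w.length := by
  obtain ⟨i, j⟩ := p
  cases d with
  | true =>
    have hv' : i < w.length := hv
    rw [dirStep_up (List.getElem?_eq_getElem hv')] at e
    rw [Slice.enterBelow_line e]
    exact hv'
  | false =>
    obtain ⟨h0, hle⟩ : 0 < i ∧ i ≤ w.length := hv
    obtain ⟨i, rfl⟩ := Nat.exists_eq_succ_of_ne_zero h0.ne'
    rw [Nat.succ_eq_add_one, dirStep_down (List.getElem?_eq_getElem hle)] at e
    rw [Slice.enterAbove_line e]
    exact hle

theorem Passage.line {w : List Slice} {d d' : Bool} {p : ℕ × ℕ} {j : ℕ} {E : List Event}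
    (hs : Passage w d p d' j E) : ∀ e ∈ E, ∀ h s, e = .line h s → h < w.length := by
  induction hs with
  | exit => simp
  | step hv _ ih =>
    intro e he
    rcases List.mem_cons.1 he with rfl | he
    · exact dirStep_line hv
    · exact ih e he

/-! ### Entries -/

/-- A strand entering at position `e.2`, from below if `e.1 = true` and else from above. -/
def IsEntry (u t : List Bool) (e : Bool × ℕ) : Prop :=
  if e.1 then e.2 < u.length ∧ u.getD e.2 false = true
  else e.2 < t.length ∧ t.getD e.2 false = false

/-- The product over all entries. -/
def entryProd (u t : List Bool) {M : Type*} [CommMonoid M] (f : Bool × ℕ → M) : M :=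
  (∏ j ∈ Finset.range u.length, if u.getD j false then f (true, j) else 1) *
    ∏ j ∈ Finset.range t.length, if t.getD j false then 1 else f (false, j)

/-- The strands of a word, their exits and their beads. -/
structure PassageSystem (u : List Bool) (V : List Slice) (t : List Bool)
    (χ : ℕ × Bool → WithConv (C →ₗ[k] R)) (ex : Bool × ℕ → Bool × ℕ) (z : Bool × ℕ → Bead Q R) :
    Prop where
  fits : Fits u V t
  entry : ∀ e, IsEntry u t e → ∃ E, Passage V e.1 (if e.1 then 0 else V.length, e.2)
    (ex e).1 (ex e).2 E ∧ (E.map (Event.bead Q χ)).prod = z e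
  inner : ∀ h j, 0 < h → h < V.length → j < (cutLevel V t h).length →
    ∃ d' i E, Passage V ((cutLevel V t h).getD j false) (h, j) d' i E

/-! ### Frames -/

/-- A diagram with a part between two horizontal lines left open. -/
structure Frame where
  below : List Slice
  above : List Slice
  u : List Bool
  t : List Bool
  fits_below : Fits [] below u
  fits_above : Fits t above []

namespace Frame

variable (F : Frame)

/-- Fill the open part. -/
def fill (V : List Slice) : List Slice := F.below ++ V ++ F.above

theorem fits_fill {V : List Slice} (hV : Fits F.u V F.t) : Fits [] (F.fill V) [] :=
  fits_append.2 ⟨F.t, fits_append.2 ⟨F.u, F.fits_below, hV⟩, F.fits_above⟩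

/-- Points below or above the open part. -/
abbrev Pt := (ℕ × ℕ) ⊕ (ℕ × ℕ)

def dir : Pt → Bool
  | .inl p => (cutLevel F.below F.u p.1).getD p.2 false
  | .inr p => (cutLevel F.above [] p.1).getD p.2 false

/-- The lower boundary line of the window belongs to the first kind of points and the upper one to
the second. For an empty window the common line occurs twice. -/
def pts : Set Pt
  | .inl p => p.1 ≤ F.below.length ∧ p.2 < (cutLevel F.below F.u p.1).length
  | .inr p => p.2 < (cutLevel F.above [] p.1).length

/-- The position of an outer point, where the open part consists of `n` slices. -/
def place (n : ℕ) : Pt → ℕ × ℕ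
  | .inl p => p
  | .inr p => (F.below.length + n + p.1, p.2)

/-- The entry of the open part at an outer point. -/
def entryOf : Pt → Option (Bool × ℕ)
  | .inl p => if p.1 = F.below.length ∧ (cutLevel F.below F.u p.1).getD p.2 false = true
      then some (true, p.2) else none
  | .inr p => if p.1 = 0 ∧ p.2 < F.t.length ∧ F.t.getD p.2 false = false
      then some (false, p.2) else none

/-- The outer point at an entry. -/
def entryPt (e : Bool × ℕ) : Pt := if e.1 then .inl (F.below.length, e.2) else .inr (0, e.2)

/-- The outer point at an exit. -/
def exitPt (e : Bool × ℕ) : Pt := if e.1 then .inr (0, e.2) else .inl (F.below.length, e.2)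

def outerNext : Pt → Pt
  | .inl p => .inl (dirStep F.below (F.dir (.inl p)) p).1
  | .inr p => .inr (dirStep F.above (F.dir (.inr p)) p).1

/-- The next outer point, where strands in the open part leave as given by `ex`. -/
def nextPt (ex : Bool × ℕ → Bool × ℕ) (X : Pt) : Pt :=
  match F.entryOf X with
  | some e => F.exitPt (ex e)
  | none => F.outerNext X

variable {F}

theorem cutLevel_above_zero : cutLevel F.above [] 0 = F.t := F.fits_above.cutLevel_zero

theorem cutLevel_below_zero : cutLevel F.below F.u 0 = [] := F.fits_below.cutLevel_zero

theorem level_lower {V : List Slice} (hV : Fits F.u V F.t) {h : ℕ} (hh : h ≤ F.below.length) :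
    level (F.fill V) h = cutLevel F.below F.u h := by
  rcases hh.lt_or_eq with hlt | rfl
  · rw [level, fill, List.append_assoc, List.getElem?_append_left hlt, cutLevel,
      List.getElem?_eq_getElem hlt]
    rfl
  · have : Fits F.u (V ++ F.above) [] := fits_append.2 ⟨F.t, hV, F.fits_above⟩
    rw [cutLevel_length, ← this.cutLevel_zero, level, fill, List.append_assoc,
      List.getElem?_append_right le_rfl, Nat.sub_self]
    rfl

theorem level_upper (V : List Slice) (h : ℕ) :
    level (F.fill V) (F.below.length + V.length + h) = cutLevel F.above [] h := by
  rw [level, fill, List.getElem?_append_right (by simp [add_assoc]), cutLevel, List.length_append,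
    Nat.add_sub_cancel_left]

theorem level_inner {V : List Slice} {h : ℕ} (hh : h < V.length) (t : List Bool) :
    level (F.fill V) (F.below.length + h) = cutLevel V t h := by
  rw [level, fill, List.append_assoc, List.getElem?_append_right (Nat.le_add_right _ _),
    Nat.add_sub_cancel_left, List.getElem?_append_left hh, cutLevel, List.getElem?_eq_getElem hh]
  rfl

theorem mem_pts_iff {V : List Slice} (hV : Fits F.u V F.t) {X : Pt} :
    X ∈ F.pts ↔ IsPoint (F.fill V) (F.place V.length X) ∧
      ∀ p, X = .inl p → p.1 ≤ F.below.length := by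
  rcases X with p | p
  · constructor
    · rintro ⟨h1, h2⟩
      refine ⟨?_, fun q hq => by cases hq; exact h1⟩
      change p.2 < (level (F.fill V) p.1).length
      rwa [level_lower hV h1]
    · rintro ⟨h1, h2⟩
      refine ⟨h2 p rfl, ?_⟩
      rw [← level_lower hV (h2 p rfl)]
      exact h1
  · change p.2 < (cutLevel F.above [] p.1).length ↔
      p.2 < (level (F.fill V) (F.below.length + V.length + p.1)).length ∧ _
    rw [level_upper]
    simp

theorem direction_place {V : List Slice} (hV : Fits F.u V F.t) {X : Pt} (hX : X ∈ F.pts) :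
    direction (F.fill V) (F.place V.length X) = F.dir X := by
  rcases X with p | p
  · change (level (F.fill V) p.1).getD p.2 false = _
    rw [level_lower hV hX.1]
    rfl
  · change (level (F.fill V) (F.below.length + V.length + p.1)).getD p.2 false = _
    rw [level_upper]
    rfl

theorem entryOf_spec {X : Pt} (hX : X ∈ F.pts) {e : Bool × ℕ} (he : F.entryOf X = some e) :
    IsEntry F.u F.t e ∧ X = F.entryPt e ∧ F.dir X = e.1 := by
  rcases X with ⟨h, j⟩ | ⟨h, j⟩
  · simp only [entryOf, Option.ite_none_right_eq_some, Option.some.injEq] at he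
    obtain ⟨⟨rfl, h2⟩, rfl⟩ := he
    have h3 : j < (cutLevel F.below F.u F.below.length).length := hX.2
    refine ⟨?_, rfl, h2⟩
    rw [cutLevel_length] at h2 h3
    exact ⟨h3, h2⟩
  · simp only [entryOf, Option.ite_none_right_eq_some, Option.some.injEq] at he
    obtain ⟨⟨rfl, h2, h3⟩, rfl⟩ := he
    refine ⟨⟨h2, h3⟩, rfl, ?_⟩
    rw [dir, cutLevel_above_zero, h3]

theorem canStep_lower {p : ℕ × ℕ} (hX : Sum.inl p ∈ F.pts) (he : F.entryOf (.inl p) = none) :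
    CanStep F.below.length (F.dir (.inl p)) p.1 := by
  obtain ⟨h1, h2⟩ := hX
  simp only [entryOf, ite_eq_right_iff, reduceCtorEq, imp_false, not_and] at he
  cases hd : F.dir (.inl p) with
  | true => exact lt_of_le_of_ne h1 fun h => he h hd
  | false =>
    refine ⟨Nat.pos_of_ne_zero fun h0 => ?_, h1⟩
    rw [h0, cutLevel_below_zero] at h2
    simp at h2

theorem canStep_upper {p : ℕ × ℕ} (hX : Sum.inr p ∈ F.pts) (he : F.entryOf (.inr p) = none) :
    CanStep F.above.length (F.dir (.inr p)) p.1 := by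
  have hlt : p.1 < F.above.length := by
    by_contra hc
    have h2 : p.2 < (cutLevel F.above [] p.1).length := hX
    rw [cutLevel, List.getElem?_eq_none (by omega)] at h2
    simp at h2
  cases hd : F.dir (.inr p) with
  | true => exact hlt
  | false =>
    refine ⟨Nat.pos_of_ne_zero fun h0 => ?_, hlt.le⟩
    have h2 : p.2 < (cutLevel F.above [] p.1).length := hX
    rw [h0, cutLevel_above_zero] at h2
    rw [dir, h0, cutLevel_above_zero] at hd
    simp only [entryOf, ite_eq_right_iff, reduceCtorEq, imp_false, not_and] at he
    exact he h0 h2 hd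

/-- Steps outside the open part. -/
theorem step_place {V : List Slice} (hV : Fits F.u V F.t) {X : Pt} (hX : X ∈ F.pts)
    (he : F.entryOf X = none) :
    step (F.fill V) (F.place V.length X) = (F.place V.length (F.outerNext X),
      match X with
      | .inl p => (dirStep F.below (F.dir X) p).2
      | .inr p => (dirStep F.above (F.dir X) p).2.raise (F.below.length + V.length)) := by
  rw [step_eq, direction_place hV hX]
  rcases X with p | p
  · have := dirStep_append (a := []) (b := V ++ F.above) (canStep_lower hX he) p.2
    simpa [place, outerNext, fill, Event.raise_zero] using this
  · have := dirStep_append (a := F.below ++ V) (b := []) (canStep_upper hX he) p.2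
    simpa [place, outerNext, fill] using this

theorem next_place {V : List Slice} (hV : Fits F.u V F.t) {X : Pt} (hX : X ∈ F.pts)
    (he : F.entryOf X = none) :
    next (F.fill V) (F.place V.length X) = F.place V.length (F.outerNext X) := by
  rw [next, step_place hV hX he]

theorem outerNext_mem {V : List Slice} (hV : Fits F.u V F.t) {X : Pt} (hX : X ∈ F.pts)
    (he : F.entryOf X = none) : F.outerNext X ∈ F.pts := by
  rw [mem_pts_iff hV, ← next_place hV hX he]
  refine ⟨isPoint_next (F.fits_fill hV) ((mem_pts_iff hV).1 hX).1, ?_⟩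
  rcases X with p | p
  · intro q hq
    cases hq
    exact (dirStep_height (canStep_lower hX he) p.2).1
  · intro q hq
    cases hq

/-- A step outside the open part does not lead away from it at its boundary. -/
theorem outerNext_not_exit {V : List Slice} (hV : Fits F.u V F.t) {X : Pt} (hX : X ∈ F.pts)
    (he : F.entryOf X = none) :
    (∀ j, F.outerNext X = .inl (F.below.length, j) → F.dir (F.outerNext X) = true) ∧
      ∀ j, F.outerNext X = .inr (0, j) → F.dir (F.outerNext X) = false := by
  have hd := direction_next (F.fits_fill hV) ((mem_pts_iff hV).1 hX).1
  rw [next_place hV hX he, direction_place hV (outerNext_mem hV hX he), direction_place hV hX] at hd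
  rcases X with p | p
  · obtain ⟨-, -, h3⟩ := dirStep_height (canStep_lower hX he) p.2
    refine ⟨fun j hj => ?_, fun j hj => by cases hj⟩
    by_contra hc
    rw [Bool.not_eq_true] at hc
    have h4 := h3 (hd.symm.trans hc)
    have h5 : (dirStep F.below (F.dir (.inl p)) p).1 = (F.below.length, j) := Sum.inl_injective hj
    change (dirStep F.below (F.dir (.inl p)) p).1.1 < _ at h4
    rw [h5] at h4
    exact lt_irrefl _ h4
  · obtain ⟨-, h2, -⟩ := dirStep_height (canStep_upper hX he) p.2
    refine ⟨(fun j hj => by cases hj), fun j hj => ?_⟩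
    by_contra hc
    rw [Bool.not_eq_false] at hc
    have h5 : (dirStep F.above (F.dir (.inr p)) p).1 = (0, j) := Sum.inr_injective hj
    have hd' : F.dir (F.outerNext (.inr p)) = newDir (F.dir (.inr p))
        (F.below.length + V.length + p.1)
        (F.below.length + V.length + (dirStep F.above (F.dir (.inr p)) p).1.1) := hd
    rw [newDir_add] at hd'
    have h4 := h2 (hd'.symm.trans hc)
    change 0 < (dirStep F.above (F.dir (.inr p)) p).1.1 at h4
    rw [h5] at h4
    exact lt_irrefl _ h4

end Frame

end Frames

/-! ### The traversal reduced to the points outside the window. -/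

section FrameSystems

open Function WithConv

variable {k C : Type*} [Field k] [AddCommGroup C] [Module k C] [Coalgebra k C]
variable {Q : StrictOrientedQuantumCoalgebra k C}
variable {R Rb Rv Ra : Type v} [CommRing R] [Algebra k R] [CommRing Rb] [Algebra k Rb]
  [CommRing Rv] [Algebra k Rv] [CommRing Ra] [Algebra k Ra]

theorem Passage.height_of_nil {w : List Slice} {d d' : Bool} {p : ℕ × ℕ} {j : ℕ} {E : List Event}
    (hs : Passage w d p d' j E) (hE : E = []) : p.1 = if d then w.length else 0 := by
  cases hs with
  | exit h => exact h
  | step => cases hE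

namespace Frame

variable (F : Frame)

/-- The line maps of a filled frame restrict to given ones below, inside and above the open part. -/
structure Splits (n : ℕ) (χ : ℕ × Bool → WithConv (C →ₗ[k] R))
    (χb : ℕ × Bool → WithConv (C →ₗ[k] Rb)) (χv : ℕ × Bool → WithConv (C →ₗ[k] Rv))
    (χa : ℕ × Bool → WithConv (C →ₗ[k] Ra)) (ιb : Rb →ₐ[k] R) (ιv : Rv →ₐ[k] R)
    (ιa : Ra →ₐ[k] R) : Prop where
  lower : ∀ h < F.below.length, ∀ s, χ (h, s) = postcomp ιb (χb (h, s))
  middle : ∀ h < n, ∀ s, χ (F.below.length + h, s) = postcomp ιv (χv (h, s))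
  upper : ∀ h < F.above.length, ∀ s,
    χ (F.below.length + n + h, s) = postcomp ιa (χa (h, s))

/-- The bead at an outer point. -/
def ptBead (χb : ℕ × Bool → WithConv (C →ₗ[k] Rb)) (z : Bool × ℕ → Bead Q Rv)
    (χa : ℕ × Bool → WithConv (C →ₗ[k] Ra)) (ιb : Rb →ₐ[k] R) (ιv : Rv →ₐ[k] R)
    (ιa : Ra →ₐ[k] R) (X : Pt) : Bead Q R :=
  match F.entryOf X with
  | some e => (z e).map ιv
  | none =>
    match X with
    | .inl p => ((dirStep F.below (F.dir (.inl p)) p).2.bead Q χb).map ιb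
    | .inr p => ((dirStep F.above (F.dir (.inr p)) p).2.bead Q χa).map ιa

variable {F} {V : List Slice} {χ : ℕ × Bool → WithConv (C →ₗ[k] R)}
  {χb : ℕ × Bool → WithConv (C →ₗ[k] Rb)} {χv : ℕ × Bool → WithConv (C →ₗ[k] Rv)}
  {χa : ℕ × Bool → WithConv (C →ₗ[k] Ra)} {ιb : Rb →ₐ[k] R} {ιv : Rv →ₐ[k] R}
  {ιa : Ra →ₐ[k] R} {ex : Bool × ℕ → Bool × ℕ} {z : Bool × ℕ → Bead Q Rv}

theorem step_bead_place (hV : Fits F.u V F.t)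
    (hsp : F.Splits V.length χ χb χv χa ιb ιv ιa) {X : Pt} (hX : X ∈ F.pts)
    (he : F.entryOf X = none) :
    (step (F.fill V) (F.place V.length X)).2.bead Q χ = F.ptBead χb z χa ιb ιv ιa X := by
  simp only [step_place hV hX he, ptBead, he]
  rcases X with p | p
  · have := Event.bead_raise (Q := Q) (χ := χb) (χ' := χ) ιb (H := 0)
      (fun h hh s => by rw [zero_add, hsp.lower h hh])
      (dirStep_line (canStep_lower hX he))
    rwa [Event.raise_zero] at this
  · exact Event.bead_raise (Q := Q) (χ := χa) (χ' := χ) ιa (hsp.upper)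
      (dirStep_line (canStep_upper hX he))

theorem place_entryPt (n : ℕ) (e : Bool × ℕ) :
    F.place n (F.entryPt e) = (F.below.length + (if e.1 then 0 else n), e.2) := by
  obtain ⟨d, j⟩ := e
  cases d <;> rfl

theorem place_exitPt (n : ℕ) (e : Bool × ℕ) :
    F.place n (F.exitPt e) = (F.below.length + (if e.1 then n else 0), e.2) := by
  obtain ⟨d, j⟩ := e
  cases d <;> rfl

theorem exitPt_mem (hV : Fits F.u V F.t) {e : Bool × ℕ}
    (h : IsPoint (F.fill V) (F.place V.length (F.exitPt e))) : F.exitPt e ∈ F.pts := by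
  rw [mem_pts_iff hV]
  refine ⟨h, fun p hp => ?_⟩
  obtain ⟨d, j⟩ := e
  cases d
  · cases hp; exact le_rfl
  · cases hp

/-- The outer points, as part of the system of all points of the filled frame. -/
theorem coarsens_of_ne_nil (hne : V ≠ []) (hS : PassageSystem F.u V F.t χv ex z)
    (hsp : F.Splits V.length χ χb χv χa ιb ιv ιa) :
    ∃ cnt, Coarsens F.pts (F.nextPt ex) (F.ptBead χb z χa ιb ιv ιa)
      {p | IsPoint (F.fill V) p} (next (F.fill V)) (fun q => (step (F.fill V) q).2.bead Q χ)
      (F.place V.length) cnt := by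
  have hV := hS.fits
  have hW := F.fits_fill hV
  have hn : 0 < V.length := List.length_pos_iff.2 hne
  choose! E hE hz using hS.entry
  have hmem : ∀ X ∈ F.pts, IsPoint (F.fill V) (F.place V.length X) := fun X hX =>
    ((mem_pts_iff hV).1 hX).1
  -- A strand of the window is one jump of the coarse system. Its length is positive because `V ≠
  -- []`, and its intermediate points lie strictly inside the window, so they are not outer points.
  have key : ∀ X ∈ F.pts, ∀ e, F.entryOf X = some e →
      0 < (E e).length ∧
      (next (F.fill V))^[(E e).length] (F.place V.length X) = F.place V.length (F.exitPt (ex e)) ∧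
      pathProd (next (F.fill V)) (fun q => (step (F.fill V) q).2.bead Q χ) (F.place V.length X)
        (E e).length = (z e).map ιv ∧
      ∀ t, 0 < t → t < (E e).length →
        F.below.length < ((next (F.fill V))^[t] (F.place V.length X)).1 ∧
          ((next (F.fill V))^[t] (F.place V.length X)).1 < F.below.length + V.length := by
    intro X hX e he
    obtain ⟨h1, h2, h3⟩ := entryOf_spec hX he
    have h4 := direction_place hV hX
    have h5 := hmem X hX
    rw [h3, h2, place_entryPt] at h4
    rw [h2, place_entryPt] at h5 ⊢
    obtain ⟨s1, s2, s3⟩ := (hE e h1).sound hW h5 h4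
    refine ⟨?_, ?_, ?_, s3⟩
    · rw [List.length_pos_iff]
      intro hnil
      have := (hE e h1).height_of_nil hnil
      cases hb : e.1 <;> simp [hb] at this <;> simp_all
    · rw [place_exitPt]
      exact s1
    · have : pathProd (next (F.fill V)) (fun q => (step (F.fill V) q).2.bead Q χ)
          (F.below.length + (if e.1 then 0 else V.length), e.2) (E e).length =
          (((E e).map (Event.raise F.below.length)).map (Event.bead Q χ)).prod := by
        rw [← s2, List.map_map]
        rfl
      rw [this, ← hz e h1, Bead.map_prod, List.map_map, List.map_map]
      congr 1
      exact List.map_congr_left fun x hx =>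
        Event.bead_raise ιv hsp.middle ((hE e h1).line x hx)
  let cnt : Pt → ℕ := fun X => match F.entryOf X with
    | some e => (E e).length
    | none => 1
  have hiter : ∀ X ∈ F.pts, (next (F.fill V))^[cnt X] (F.place V.length X) =
      F.place V.length (F.nextPt ex X) := by
    intro X hX
    cases he : F.entryOf X with
    | some e => simp only [cnt, nextPt, he]; exact (key X hX e he).2.1
    | none => simp only [cnt, nextPt, he]; exact next_place hV hX he
  refine ⟨cnt, hmem, ?_, ?_, hiter, ?_, ?_, ?_, ?_⟩
  · intro X hX
    have h1 := (permOn_next hW).iterate_mem (hmem X hX) (cnt X)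
    rw [hiter X hX] at h1
    cases he : F.entryOf X with
    | some e =>
      simp only [nextPt, he] at h1 ⊢
      exact exitPt_mem hV h1
    | none => simp only [nextPt, he]; exact outerNext_mem hV hX he
  · intro X hX
    cases he : F.entryOf X with
    | some e => simp only [cnt, he]; exact (key X hX e he).1
    | none => simp only [cnt, he]; exact one_pos
  · intro X hX t h0 ht Y hY hXY
    cases he : F.entryOf X with
    | none => simp only [cnt, he] at ht; omega
    | some e =>
      simp only [cnt, he] at ht
      have := (key X hX e he).2.2.2 t h0 ht
      rw [hXY] at this
      rcases Y with p | p
      · have h1 : p.1 ≤ F.below.length := hY.1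
        simp only [place] at this
        omega
      · simp only [place] at this
        omega
  · rintro (p | p) hX (q | q) hY hXY
    · exact congrArg _ hXY
    · have h1 : p.1 ≤ F.below.length := hX.1
      have h2 := congrArg Prod.fst hXY
      simp only [place] at h2
      omega
    · have h1 : q.1 ≤ F.below.length := hY.1
      have h2 := congrArg Prod.fst hXY
      simp only [place] at h2
      omega
    · have h2 := congrArg Prod.fst hXY
      have h3 := congrArg Prod.snd hXY
      simp only [place] at h2 h3
      exact congrArg _ (Prod.ext (by omega) h3)
  · intro X hX
    cases he : F.entryOf X with
    | some e =>
      simp only [cnt, he]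
      simp only [(key X hX e he).2.2.1, ptBead, he]
    | none =>
      simp only [cnt, he]
      rw [pathProd_one, step_bead_place (z := z) hV hsp hX he]
  · rintro ⟨h, j⟩ hq
    by_cases h1 : h ≤ F.below.length
    · exact ⟨0, .inl (h, j), (mem_pts_iff hV).2 ⟨hq, fun p hp => by cases hp; exact h1⟩, rfl⟩
    by_cases h2 : F.below.length + V.length ≤ h
    · have e : F.place V.length (.inr (h - (F.below.length + V.length), j)) = (h, j) := by
        simp only [place, Prod.mk.injEq, and_true]; omega
      refine ⟨0, .inr (h - (F.below.length + V.length), j), (mem_pts_iff hV).2 ⟨?_, ?_⟩, e.symm⟩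
      · rw [e]; exact hq
      · intro p hp; cases hp
    -- The remaining points lie strictly inside the window, and the strand through such a point
    -- reaches an exit.
    · obtain ⟨i, rfl⟩ : ∃ i, h = F.below.length + i := ⟨h - F.below.length, by omega⟩
      have hi : i < V.length := by omega
      have hl := level_inner (F := F) hi F.t
      have hq' : j < (level (F.fill V) (F.below.length + i)).length := hq
      rw [hl] at hq'
      obtain ⟨d', j', E', hE'⟩ := hS.inner i j (by omega) hi hq'
      have hd : direction (F.fill V) (F.below.length + i, j) = (cutLevel V F.t i).getD j false := by
        rw [direction, hl]
      obtain ⟨s1, -, -⟩ := hE'.sound hW hq hd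
      have e : F.place V.length (F.exitPt (d', j')) = (next (F.fill V))^[E'.length]
        (F.below.length + i, j) := by rw [place_exitPt]; exact s1.symm
      refine ⟨E'.length, F.exitPt (d', j'), exitPt_mem hV ?_, e.symm⟩
      rw [e]
      exact (permOn_next hW).iterate_mem hq _

/-- An outer point at which the traversal does not leave the open part. -/
def NotExit (F : Frame) (X : Pt) : Prop :=
  (∀ j, X = .inl (F.below.length, j) → F.dir X = true) ∧ ∀ j, X = .inr (0, j) → F.dir X = false

theorem notExit_of_entryOf {X : Pt} (hX : X ∈ F.pts) {e : Bool × ℕ} (he : F.entryOf X = some e) :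
    F.NotExit X := by
  obtain ⟨-, h2, h3⟩ := entryOf_spec hX he
  obtain ⟨d, j⟩ := e
  cases d <;> subst h2 <;> exact ⟨fun i hi => (by first | exact h3 | cases hi),
    fun i hi => (by first | exact h3 | cases hi)⟩

/-- The outer point over a point of a frame filled with nothing: on the common boundary, points of
direction up count as lying below, the others as lying above. -/
def unplace (F : Frame) (d : Bool) (p : ℕ × ℕ) : Pt :=
  if p.1 < F.below.length then .inl p
  else if p.1 = F.below.length ∧ d = true then .inl p
  else .inr (p.1 - F.below.length, p.2)

theorem place_unplace (d : Bool) (p : ℕ × ℕ) : F.place 0 (F.unplace d p) = p := by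
  unfold unplace
  split_ifs with h1 h2
  · rfl
  · rfl
  · simp only [place, add_zero]
    exact Prod.ext (by dsimp only; omega) rfl

theorem unplace_mem (hV : Fits F.u [] F.t) (d : Bool) {p : ℕ × ℕ} (hp : IsPoint (F.fill []) p) :
    F.unplace d p ∈ F.pts := by
  rw [mem_pts_iff hV]
  refine ⟨?_, ?_⟩
  · rw [List.length_nil, place_unplace]; exact hp
  · intro q hq
    unfold unplace at hq
    split_ifs at hq with h1 h2
    · cases hq; omega
    · cases hq; omega

theorem dir_unplace (hV : Fits F.u [] F.t) (d : Bool) {p : ℕ × ℕ} (hp : IsPoint (F.fill []) p) :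
    F.dir (F.unplace d p) = direction (F.fill []) p := by
  rw [← direction_place hV (unplace_mem hV d hp), List.length_nil, place_unplace]

theorem notExit_unplace (hV : Fits F.u [] F.t) {p : ℕ × ℕ} (hp : IsPoint (F.fill []) p) :
    F.NotExit (F.unplace (direction (F.fill []) p) p) := by
  rw [NotExit, dir_unplace hV _ hp]
  constructor
  · intro j hj
    unfold unplace at hj
    split_ifs at hj with h1 h2
    · cases hj; simp at h1
    · exact h2.2
  · intro j hj
    unfold unplace at hj
    split_ifs at hj with h1 h2
    have h3 := congrArg Prod.fst (Sum.inr_injective hj)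
    dsimp only at h3
    by_contra hc
    rw [Bool.not_eq_false] at hc
    exact h2 ⟨by omega, hc⟩

theorem unplace_place (hV : Fits F.u [] F.t) {X : Pt} (hX : X ∈ F.pts) (hn : F.NotExit X) :
    F.unplace (direction (F.fill []) (F.place 0 X)) (F.place 0 X) = X := by
  have hd := direction_place hV hX
  rw [List.length_nil] at hd
  rw [hd]
  rcases X with ⟨h, j⟩ | ⟨h, j⟩
  · have h1 : h ≤ F.below.length := hX.1
    unfold unplace
    split_ifs with h2 h3
    · rfl
    · rfl
    · simp only [place] at h2 h3
      have h4 : h = F.below.length := by omega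
      subst h4
      exact absurd ⟨rfl, hn.1 j rfl⟩ h3
  · unfold unplace
    split_ifs with h2 h3
    · simp only [place] at h2; omega
    · simp only [place] at h3
      have h4 : h = 0 := by omega
      subst h4
      rw [hn.2 j rfl] at h3
      exact absurd h3.2 (by simp)
    · simp [place]

theorem passage_nil {d d' : Bool} {p : ℕ × ℕ} {j : ℕ} {E : List Event} (h0 : p.1 = 0)
    (h : Passage [] d p d' j E) : d' = d ∧ j = p.2 ∧ E = [] := by
  cases h with
  | exit => exact ⟨rfl, rfl, rfl⟩
  | step hv =>
    rw [h0] at hv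
    cases d
    · exact absurd hv.1 (lt_irrefl 0)
    · exact absurd hv (lt_irrefl 0)

/-- The points of a frame filled with nothing, as part of the system of all outer points. -/
theorem coarsens_nil (hS : PassageSystem F.u [] F.t χv ex z)
    (hsp : F.Splits 0 χ χb χv χa ιb ιv ιa) :
    ∃ cnt, Coarsens {p | IsPoint (F.fill []) p} (next (F.fill []))
      (fun q => (step (F.fill []) q).2.bead Q χ) F.pts (F.nextPt ex)
      (F.ptBead χb z χa ιb ιv ιa)
      (fun p => F.unplace (direction (F.fill []) p) p) cnt := by
  have hV := hS.fits
  have hW := F.fits_fill hV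
  have hent : ∀ e, IsEntry F.u F.t e → ex e = e ∧ z e = 1 := by
    intro e he
    obtain ⟨E, h1, h2⟩ := hS.entry e he
    obtain ⟨h3, h4, rfl⟩ := passage_nil (by simp) h1
    exact ⟨Prod.ext h3 h4, h2.symm⟩
  -- Contrary to the nonempty case, the outer points are now the finer system: points on the line
  -- closing the window have two copies, and `φ` picks the one from which the window is entered.
  set φ : ℕ × ℕ → Pt := fun p => F.unplace (direction (F.fill []) p) p with hφ
  have hφmem : ∀ p, IsPoint (F.fill []) p → φ p ∈ F.pts := fun p hp => unplace_mem hV _ hp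
  -- the point at which the traversal leaves the open part after entering it at `φ p`
  have key : ∀ p, IsPoint (F.fill []) p → ∀ e, F.entryOf (φ p) = some e →
      F.nextPt ex (φ p) = F.exitPt e ∧ F.exitPt e ∈ F.pts ∧ F.entryOf (F.exitPt e) = none ∧
        F.place 0 (F.exitPt e) = p ∧ ¬ F.NotExit (F.exitPt e) ∧
        F.ptBead χb z χa ιb ιv ιa (φ p) = 1 := by
    intro p hp e he
    obtain ⟨h1, h2, h3⟩ := entryOf_spec (hφmem p hp) he
    have h4 : F.place 0 (F.exitPt e) = p := by
      rw [← place_unplace (F := F) (direction (F.fill []) p) p]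
      change _ = F.place 0 (φ p)
      rw [h2, place_entryPt, place_exitPt, ite_self]
    have h5 : F.exitPt e ∈ F.pts := exitPt_mem hV (by rw [List.length_nil, h4]; exact hp)
    have h6 : F.dir (F.exitPt e) = e.1 := by
      rw [← h3, ← direction_place hV h5, ← direction_place hV (hφmem p hp), List.length_nil, h4]
      exact congrArg _ (place_unplace _ _).symm
    have h7 : ¬ F.NotExit (F.exitPt e) := by
      intro hc
      obtain ⟨d, j⟩ := e
      cases d
      · have := hc.1 j rfl
        rw [h6] at this
        exact absurd this (by simp)
      · have := hc.2 j rfl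
        rw [h6] at this
        exact absurd this (by simp)
    refine ⟨?_, h5, ?_, h4, h7, ?_⟩
    · simp only [nextPt, he, (hent e h1).1]
    · by_contra hc
      obtain ⟨e', he'⟩ := Option.ne_none_iff_exists'.1 hc
      exact h7 (notExit_of_entryOf h5 he')
    · simp only [ptBead, he, (hent e h1).2]
      exact Bead.ext (postcomp_one ιv) rfl
  have hout : ∀ X ∈ F.pts, F.entryOf X = none →
      F.nextPt ex X = φ (next (F.fill []) (F.place 0 X)) := by
    intro X hX he
    have h1 := next_place hV hX he
    rw [List.length_nil] at h1
    rw [h1]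
    simp only [nextPt, he]
    exact (unplace_place hV (outerNext_mem hV hX he) (outerNext_not_exit hV hX he)).symm
  -- From an entry two steps are needed: through the empty window to the other copy, with trivial
  -- bead, and then the actual step.
  refine ⟨fun p => match F.entryOf (φ p) with
    | some _ => 2
    | none => 1, hφmem, fun p hp => isPoint_next hW hp, ?_, ?_, ?_, ?_, ?_, ?_⟩
  · intro p hp
    cases he : F.entryOf (φ p) <;> simp
  · intro p hp
    cases he : F.entryOf (φ p) with
    | some e =>
      obtain ⟨h1, h2, h3, h4, -⟩ := key p hp e he
      change F.nextPt ex (F.nextPt ex (φ p)) = _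
      rw [h1, hout _ h2 h3, h4]
    | none =>
      change F.nextPt ex (φ p) = _
      rw [hout _ (hφmem p hp) he, place_unplace]
  · intro p hp t h0 ht q hq hpq
    cases he : F.entryOf (φ p) with
    | some e =>
      simp only [he] at ht
      obtain rfl : t = 1 := by omega
      obtain ⟨h1, -, -, -, h5, -⟩ := key p hp e he
      apply h5
      rw [← h1]
      change F.nextPt ex (φ p) = φ q at hpq
      rw [hpq]
      exact notExit_unplace hV hq
    | none =>
      simp only [he] at ht
      omega
  · intro p hp q hq hpq
    have := congrArg (F.place 0) hpq
    simpa only [hφ, place_unplace] using this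
  · intro p hp
    cases he : F.entryOf (φ p) with
    | some e =>
      obtain ⟨h1, h2, h3, h4, -, h6⟩ := key p hp e he
      have := step_bead_place (z := z) hV hsp h2 h3
      rw [List.length_nil, h4] at this
      change _ = pathProd _ _ _ (1 + 1)
      rw [pathProd_add, pathProd_one, h6, one_mul, pathProd_one, iterate_one, h1]
      exact this
    | none =>
      have := step_bead_place (z := z) hV hsp (hφmem p hp) he
      rw [List.length_nil, place_unplace] at this
      change _ = pathProd _ _ _ 1
      rw [pathProd_one]
      exact this
  · intro X hX
    by_cases hn : F.NotExit X
    · refine ⟨0, F.place 0 X, ((mem_pts_iff hV).1 hX).1, (unplace_place hV hX hn).symm⟩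
    · have he : F.entryOf X = none := by
        by_contra hc
        obtain ⟨e', he'⟩ := Option.ne_none_iff_exists'.1 hc
        exact hn (notExit_of_entryOf hX he')
      exact ⟨1, _, isPoint_next hW ((mem_pts_iff hV).1 hX).1, hout X hX he⟩

end Frame

end FrameSystems

/-! ### Replacing the content of the window. -/

section Replacement

open Function WithConv

variable {k C : Type*} [Field k] [AddCommGroup C] [Module k C] [Coalgebra k C]

theorem Model.append_χ_left {Q : StrictOrientedQuantumCoalgebra k C} {w₁ w₂ : List Slice}
    (m : Model.{v} Q w₁) (m' : Model.{v} Q w₂) {u : ℕ × Bool} (hu : u.1 < w₁.length) :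
    (m.append m').χ u = postcomp Algebra.TensorProduct.includeLeft (m.χ u) := if_pos hu

theorem Model.append_χ_right {Q : StrictOrientedQuantumCoalgebra k C} {w₁ w₂ : List Slice}
    (m : Model.{v} Q w₁) (m' : Model.{v} Q w₂) (h : ℕ) (s : Bool) :
    (m.append m').χ (w₁.length + h, s) =
      postcomp Algebra.TensorProduct.includeRight (m'.χ (h, s)) := by
  refine (if_neg (Nat.not_lt.2 (Nat.le_add_right _ _))).trans ?_
  rw [Nat.add_sub_cancel_left]
  rfl

/-- Two words with the same boundaries whose strands connect the same end points and whose values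
agree. -/
structure LocalEquiv (Q : StrictOrientedQuantumCoalgebra k C) (u : List Bool) {V V' : List Slice}
    (t : List Bool) (m : Model.{v} Q V) (m' : Model.{v} Q V') (ex : Bool × ℕ → Bool × ℕ)
    (z : Bool × ℕ → Bead Q m.R) (z' : Bool × ℕ → Bead Q m'.R) : Prop where
  left : PassageSystem u V t m.χ ex z
  right : PassageSystem u V' t m'.χ ex z'
  deg : ∀ e, IsEntry u t e → (z e).deg = (z' e).deg
  pure : ∀ y : Bool × ℕ → C, m.Φ (entryProd u t fun e => (z e).val (y e)) =
    m'.Φ (entryProd u t fun e => (z' e).val (y e))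

namespace Frame

variable {F : Frame} {Q : StrictOrientedQuantumCoalgebra k C} {V : List Slice}

/-- The model of a filled frame. -/
abbrev fillModel (mb : Model.{v} Q F.below) (m : Model.{v} Q V) (ma : Model.{v} Q F.above) :
    Model.{v} Q (F.fill V) := (mb.append m).append ma

variable (mb : Model.{v} Q F.below) (m : Model.{v} Q V) (ma : Model.{v} Q F.above)

def inclBelow : mb.R →ₐ[k] (fillModel mb m ma).R :=
  (Algebra.TensorProduct.includeLeft : _ →ₐ[k] (mb.R ⊗[k] m.R) ⊗[k] ma.R).comp
    (Algebra.TensorProduct.includeLeft : mb.R →ₐ[k] mb.R ⊗[k] m.R)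

def inclMiddle : m.R →ₐ[k] (fillModel mb m ma).R :=
  (Algebra.TensorProduct.includeLeft : _ →ₐ[k] (mb.R ⊗[k] m.R) ⊗[k] ma.R).comp
    (Algebra.TensorProduct.includeRight : m.R →ₐ[k] mb.R ⊗[k] m.R)

def inclAbove : ma.R →ₐ[k] (fillModel mb m ma).R :=
  (Algebra.TensorProduct.includeRight : _ →ₐ[k] (mb.R ⊗[k] m.R) ⊗[k] ma.R)

theorem splits_fillModel : F.Splits V.length (fillModel mb m ma).χ mb.χ m.χ ma.χ
    (inclBelow mb m ma) (inclMiddle mb m ma) (inclAbove mb m ma) := by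
  refine ⟨fun h hh s => ?_, fun h hh s => ?_, fun h hh s => ?_⟩
  · rw [Model.append_χ_left _ _ (by rw [List.length_append]; exact Nat.lt_add_right _ hh),
      Model.append_χ_left _ _ hh]
    rfl
  · rw [Model.append_χ_left _ _ (by rw [List.length_append]; exact Nat.add_lt_add_left hh _),
      Model.append_χ_right]
    rfl
  · rw [← List.length_append, Model.append_χ_right]
    rfl

theorem fillModel_Φ (x : mb.R) (y : m.R) (z : ma.R) :
    (fillModel mb m ma).Φ (inclBelow mb m ma x * inclMiddle mb m ma y * inclAbove mb m ma z) =
      mb.Φ x * m.Φ y * ma.Φ z := by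
  have : inclBelow mb m ma x * inclMiddle mb m ma y * inclAbove mb m ma z =
      (x ⊗ₜ[k] y) ⊗ₜ[k] z := by
    change ((x ⊗ₜ[k] (1 : m.R)) ⊗ₜ[k] (1 : ma.R)) * (((1 : mb.R) ⊗ₜ[k] y) ⊗ₜ[k] (1 : ma.R)) *
      ((1 : mb.R ⊗[k] m.R) ⊗ₜ[k] z) = _
    simp only [Algebra.TensorProduct.tmul_mul_tmul, mul_one, one_mul]
  rw [this]
  rfl

variable {m}

theorem prod_entries {R : Type*} [CommMonoid R] (f : Bool × ℕ → Pt → R) (S : Finset Pt)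
    (hS : ∀ X, X ∈ S ↔ X ∈ F.pts) :
    (∏ X ∈ S, match F.entryOf X with
      | some e => f e X
      | none => 1) = entryProd F.u F.t fun e => f e (F.entryPt e) := by
  classical
  have hu : ∀ j < F.u.length, (Sum.inl (F.below.length, j) : Pt) ∈ F.pts := fun j hj =>
    ⟨le_rfl, by simpa [cutLevel_length] using hj⟩
  have ht : ∀ j < F.t.length, (Sum.inr (0, j) : Pt) ∈ F.pts := fun j hj => by
    change j < (cutLevel F.above [] 0).length
    rwa [cutLevel_above_zero]
  have hsub : (Finset.range F.u.length).image (fun j => (Sum.inl (F.below.length, j) : Pt)) ∪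
      (Finset.range F.t.length).image (fun j => (Sum.inr (0, j) : Pt)) ⊆ S := by
    intro X hX
    rw [hS]
    rcases Finset.mem_union.1 hX with h | h <;> obtain ⟨j, hj, rfl⟩ := Finset.mem_image.1 h
    · exact hu j (Finset.mem_range.1 hj)
    · exact ht j (Finset.mem_range.1 hj)
  rw [← Finset.prod_subset hsub, Finset.prod_union, Finset.prod_image, Finset.prod_image, entryProd]
  · congr 1
    · refine Finset.prod_congr rfl fun j _ => ?_
      simp only [entryOf, cutLevel_length, true_and]
      split_ifs <;> rfl
    · refine Finset.prod_congr rfl fun j hj => ?_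
      simp only [entryOf, Finset.mem_range.1 hj, true_and]
      cases F.t.getD j false <;> rfl
  · intro a _ b _ e; simpa using e
  · intro a _ b _ e; simpa using e
  · rw [Finset.disjoint_left]
    intro X h1 h2
    obtain ⟨j, -, rfl⟩ := Finset.mem_image.1 h1
    obtain ⟨i, -, h⟩ := Finset.mem_image.1 h2
    cases h
  · intro X hX hn
    cases he : F.entryOf X with
    | none => rfl
    | some e =>
      obtain ⟨h1, h2, -⟩ := entryOf_spec ((hS X).1 hX) he
      refine absurd ?_ hn
      obtain ⟨d, j⟩ := e
      rw [Finset.mem_union, Finset.mem_image, Finset.mem_image]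
      cases d
      · exact .inr ⟨j, Finset.mem_range.2 h1.1, h2.symm⟩
      · exact .inl ⟨j, Finset.mem_range.2 h1.1, h2.symm⟩

/-- The value on pure tensors of the beads at the outer points. -/
theorem functional_prod_ptBead (z : Bool × ℕ → Bead Q m.R) (S : Finset Pt)
    (hS : ∀ X, X ∈ S ↔ X ∈ F.pts) (y : Pt → C) :
    (fillModel mb m ma).Φ (∏ X ∈ S, (F.ptBead mb.χ z ma.χ (inclBelow mb m ma)
      (inclMiddle mb m ma) (inclAbove mb m ma) X).val (y X)) =
    mb.Φ (∏ X ∈ S, match F.entryOf X, X with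
      | none, .inl p => ((dirStep F.below (F.dir (.inl p)) p).2.bead Q mb.χ).val (y (.inl p))
      | _, _ => 1) *
    m.Φ (entryProd F.u F.t fun e => (z e).val (y (F.entryPt e))) *
    ma.Φ (∏ X ∈ S, match F.entryOf X, X with
      | none, .inr p => ((dirStep F.above (F.dir (.inr p)) p).2.bead Q ma.χ).val (y (.inr p))
      | _, _ => 1) := by
  rw [← prod_entries (fun e X => (z e).val (y X)) S hS, ← fillModel_Φ mb m ma,
    map_prod (inclBelow mb m ma), map_prod (inclMiddle mb m ma), map_prod (inclAbove mb m ma), ← Finset.prod_mul_distrib, ← Finset.prod_mul_distrib]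
  congr 1
  refine Finset.prod_congr rfl fun X _ => ?_
  cases he : F.entryOf X with
  | some e =>
    simp only [ptBead, he, map_one, one_mul, mul_one]
    rfl
  | none =>
    rcases X with p | p
    · simp only [ptBead, he, map_one, mul_one]
      rfl
    · simp only [ptBead, he, map_one, one_mul]
      rfl

end Frame

/-- The points of the filled frame and the outer points give the same value, for suitable starting
points. -/
theorem exists_startingList_of_ne_nil (Q : TwistOrientedQuantumCoalgebra k C) (c : C) {F : Frame}
    {V : List Slice} (hne : V ≠ []) (mb : Model.{v} Q.toStrictOrientedQuantumCoalgebra F.below)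
    (m : Model.{v} Q.toStrictOrientedQuantumCoalgebra V)
    (ma : Model.{v} Q.toStrictOrientedQuantumCoalgebra F.above)
    {ex : Bool × ℕ → Bool × ℕ} {z : Bool × ℕ → Bead Q.toStrictOrientedQuantumCoalgebra m.R}
    (hS : PassageSystem F.u V F.t m.χ ex z) :
    PermOn F.pts (F.nextPt ex) ∧ ∀ S, IsTransversal F.pts (F.nextPt ex) S →
      ∃ S', IsStartingList ⟨F.fill V, F.fits_fill hS.fits⟩ S' ∧
        linkValue Q c (F.fill V) (Frame.fillModel mb m ma) S' = (Frame.fillModel mb m ma).Φ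
          ((S.map fun X => Q.close c (F.dir X) (cycleProd (F.nextPt ex) (F.ptBead mb.χ z ma.χ
            (Frame.inclBelow mb m ma) (Frame.inclMiddle mb m ma) (Frame.inclAbove mb m ma))
              X)).prod) := by
  obtain ⟨cnt, hco⟩ := Frame.coarsens_of_ne_nil hne hS (Frame.splits_fillModel mb m ma)
  have hY := permOn_next (F.fits_fill hS.fits)
  refine ⟨hco.permOn hY, fun S hT => ⟨S.map (F.place V.length),
    isStartingList_iff.2 (hco.transversal_map hY hT), ?_⟩⟩
  rw [linkValue, List.map_map]
  congr 2
  refine List.map_congr_left fun X hX => ?_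
  rw [Function.comp_apply, Frame.direction_place hS.fits (hT.mem X hX),
    hco.cycleProd_eq hY (hT.mem X hX)]

/-- Here the transversal of outer points comes from starting points of the diagram and cannot be
prescribed. When two fillings are compared, it is therefore chosen for the empty one and then used
for the other. -/
theorem exists_startingList_nil (Q : TwistOrientedQuantumCoalgebra k C) (c : C) {F : Frame}
    (mb : Model.{v} Q.toStrictOrientedQuantumCoalgebra F.below)
    (m : Model.{v} Q.toStrictOrientedQuantumCoalgebra [])
    (ma : Model.{v} Q.toStrictOrientedQuantumCoalgebra F.above)
    {ex : Bool × ℕ → Bool × ℕ} {z : Bool × ℕ → Bead Q.toStrictOrientedQuantumCoalgebra m.R}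
    (hS : PassageSystem F.u [] F.t m.χ ex z) (hY : PermOn F.pts (F.nextPt ex)) :
    ∃ S, IsTransversal F.pts (F.nextPt ex) S ∧
      ∃ S', IsStartingList ⟨F.fill [], F.fits_fill hS.fits⟩ S' ∧
        linkValue Q c (F.fill []) (Frame.fillModel mb m ma) S' = (Frame.fillModel mb m ma).Φ
          ((S.map fun X => Q.close c (F.dir X) (cycleProd (F.nextPt ex) (F.ptBead mb.χ z ma.χ
            (Frame.inclBelow mb m ma) (Frame.inclMiddle mb m ma) (Frame.inclAbove mb m ma))
              X)).prod) := by
  obtain ⟨cnt, hco⟩ := Frame.coarsens_nil hS (Frame.splits_fillModel mb m ma)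
  obtain ⟨S', hS', -⟩ := exists_startingList_up ⟨F.fill [], F.fits_fill hS.fits⟩
  have hT := isStartingList_iff.1 hS'
  refine ⟨_, hco.transversal_map hY hT, S', hS', ?_⟩
  rw [linkValue, List.map_map]
  congr 2
  refine List.map_congr_left fun p hp => ?_
  rw [Function.comp_apply, Frame.dir_unplace hS.fits _ (hT.mem p hp),
    hco.cycleProd_eq hY (hT.mem p hp)]

/-- Replacing a part of a diagram by an equivalent one does not change the value. -/
theorem LocalEquiv.linkValue_eq {Q : TwistOrientedQuantumCoalgebra k C} (c : C) {F : Frame}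
    {V V' : List Slice} (hne : V ≠ []) (mb : Model.{v} Q.toStrictOrientedQuantumCoalgebra F.below)
    {m : Model.{v} Q.toStrictOrientedQuantumCoalgebra V}
    {m' : Model.{v} Q.toStrictOrientedQuantumCoalgebra V'}
    (ma : Model.{v} Q.toStrictOrientedQuantumCoalgebra F.above)
    {ex : Bool × ℕ → Bool × ℕ} {z : Bool × ℕ → Bead Q.toStrictOrientedQuantumCoalgebra m.R}
    {z' : Bool × ℕ → Bead Q.toStrictOrientedQuantumCoalgebra m'.R}
    (h : LocalEquiv Q.toStrictOrientedQuantumCoalgebra F.u F.t m m' ex z z') :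
    ∃ S S', IsStartingList ⟨F.fill V, F.fits_fill h.left.fits⟩ S ∧
      IsStartingList ⟨F.fill V', F.fits_fill h.right.fits⟩ S' ∧
      linkValue Q c (F.fill V) (Frame.fillModel mb m ma) S =
        linkValue Q c (F.fill V') (Frame.fillModel mb m' ma) S' := by
  obtain ⟨hY, hL⟩ := exists_startingList_of_ne_nil Q c hne mb m ma h.left
  have hR : ∃ S, IsTransversal F.pts (F.nextPt ex) S ∧
      ∃ S', IsStartingList ⟨F.fill V', F.fits_fill h.right.fits⟩ S' ∧
        linkValue Q c (F.fill V') (Frame.fillModel mb m' ma) S' = (Frame.fillModel mb m' ma).Φ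
          ((S.map fun X => Q.close c (F.dir X) (cycleProd (F.nextPt ex) (F.ptBead mb.χ z' ma.χ
            (Frame.inclBelow mb m' ma) (Frame.inclMiddle mb m' ma) (Frame.inclAbove mb m' ma))
              X)).prod) := by
    by_cases hne' : V' = []
    · subst hne'
      exact exists_startingList_nil Q c mb m' ma h.right hY
    · obtain ⟨S, hS, -⟩ := hY.exists_transversal (A := fun _ => True) fun _ _ => ⟨0, trivial⟩
      exact ⟨S, hS, (exists_startingList_of_ne_nil Q c hne' mb m' ma h.right).2 S hS⟩
  obtain ⟨S, hS, S₂, hS₂, e₂⟩ := hR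
  obtain ⟨S₁, hS₁, e₁⟩ := hL S hS
  refine ⟨S₁, S₂, hS₁, hS₂, ?_⟩
  rw [e₁, e₂]
  have hdeg : ∀ X, (F.ptBead mb.χ z ma.χ
      (Frame.inclBelow mb m ma) (Frame.inclMiddle mb m ma) (Frame.inclAbove mb m ma) X).deg =
      (F.ptBead mb.χ z' ma.χ
      (Frame.inclBelow mb m' ma) (Frame.inclMiddle mb m' ma) (Frame.inclAbove mb m' ma) X).deg := by
    intro X
    cases he : F.entryOf X with
    | none => rcases X with p | p <;> simp only [Frame.ptBead, he] <;> rfl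
    | some e =>
      simp only [Frame.ptBead, he]
      refine h.deg e ?_
      rcases X with p | p
      · simp only [Frame.entryOf, Option.ite_none_right_eq_some, Option.some.injEq] at he
        obtain ⟨⟨h1, h2⟩, rfl⟩ := he
        rw [h1, cutLevel_length] at h2
        refine ⟨?_, h2⟩
        by_contra hc
        rw [List.getD_eq_default _ _ (not_lt.1 hc)] at h2
        simp at h2
      · simp only [Frame.entryOf, Option.ite_none_right_eq_some, Option.some.injEq] at he
        obtain ⟨⟨-, h2⟩, rfl⟩ := he
        exact h2
  -- Outside the window both fillings give the same factors on pure tensors; inside they agree by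
  -- `h.pure`.
  refine prod_close_cycleProd_eq Q hY hS F.dir hdeg c _ _ fun T y hT => ?_
  rw [Frame.functional_prod_ptBead mb ma z T hT, Frame.functional_prod_ptBead mb ma z' T hT,
    h.pure fun e => y (F.entryPt e)]

end Replacement

/-! ### Vertical lines beside a local move, and computation of strands. -/

section Padding

open Function WithConv

variable {k C : Type*} [Field k] [AddCommGroup C] [Module k C] [Coalgebra k C]
variable {R : Type v} [CommRing R] [Algebra k R] {Q : StrictOrientedQuantumCoalgebra k C}

theorem Slice.bot_pad (s : Slice) (l r : List Bool) : (s.pad l r).bot = l ++ s.bot ++ r := by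
  simp [Slice.bot, Slice.pad]

theorem Slice.top_pad (s : Slice) (l r : List Bool) : (s.pad l r).top = l ++ s.top ++ r := by
  simp [Slice.top, Slice.pad]

theorem Fits.pad {u t : List Bool} {w : List Slice} (h : Fits u w t) (l r : List Bool) :
    Fits (l ++ u ++ r) (w.map (Slice.pad l r)) (l ++ t ++ r) := by
  induction w generalizing u with
  | nil => exact congrArg (fun x => l ++ x ++ r) h
  | cons s w ih =>
    refine ⟨by rw [Slice.bot_pad, h.1], ?_⟩
    rw [Slice.top_pad]
    exact ih h.2

theorem cutLevel_pad {w : List Slice} {h : ℕ} (l t r : List Bool) :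
    cutLevel (w.map (Slice.pad l r)) (l ++ t ++ r) h = l ++ cutLevel w t h ++ r := by
  rw [cutLevel, cutLevel, List.getElem?_map]
  cases w[h]? with
  | none => rfl
  | some s => exact s.bot_pad l r

/-- The beads of a padded word. -/
def padBead (l u t : List Bool) (z : Bool × ℕ → Bead Q R) (e : Bool × ℕ) : Bead Q R :=
  if e.2 < l.length then 1
  else if e.2 < l.length + (if e.1 then u else t).length then z (e.1, e.2 - l.length) else 1

/-- The exits of a padded word. -/
def padExit (l u t : List Bool) (ex : Bool × ℕ → Bool × ℕ) (e : Bool × ℕ) : Bool × ℕ :=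
  if e.2 < l.length then e
  else if e.2 < l.length + (if e.1 then u else t).length then
    ((ex (e.1, e.2 - l.length)).1, l.length + (ex (e.1, e.2 - l.length)).2)
  else (e.1, l.length + (if e.1 then t else u).length +
    (e.2 - (l.length + (if e.1 then u else t).length)))

theorem prod_replicate_plain (χ : ℕ × Bool → WithConv (C →ₗ[k] R)) (n : ℕ) :
    ((List.replicate n Event.plain).map (Event.bead Q χ)).prod = 1 := by
  rw [List.map_replicate, List.prod_replicate]
  exact one_pow n

theorem isEntry_iff {u t : List Bool} {d : Bool} {j : ℕ} :
    IsEntry u t (d, j) ↔ j < (if d then u else t).length ∧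
      (if d then u else t).getD j false = d := by
  cases d <;> rfl

theorem getD_middle (l x r : List Bool) {i : ℕ} (hi : i < x.length) :
    (l ++ x ++ r).getD (l.length + i) false = x.getD i false := by
  rw [List.append_assoc, getD_append_add, List.getD_append _ _ _ _ hi]

theorem PassageSystem.pad {u t : List Bool} {V : List Slice}
    {χ : ℕ × Bool → WithConv (C →ₗ[k] R)} {ex : Bool × ℕ → Bool × ℕ} {z : Bool × ℕ → Bead Q R}
    (h : PassageSystem u V t χ ex z) (l r : List Bool) :
    PassageSystem (l ++ u ++ r) (V.map (Slice.pad l r)) (l ++ t ++ r) χ (padExit l u t ex)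
      (padBead l u t z) := by
  refine ⟨h.fits.pad l r, ?_, ?_⟩
  · rintro ⟨d, j⟩ he
    rw [isEntry_iff] at he
    have e1 : (if d then l ++ u ++ r else l ++ t ++ r) = l ++ (if d then u else t) ++ r := by
      cases d <;> rfl
    rw [e1] at he
    obtain ⟨h1, h2⟩ := he
    have hle : (if d then 0 else V.length) ≤ V.length := by cases d <;> simp
    rw [List.length_append, List.length_append] at h1
    rw [List.length_map]
    rcases Slice.position_cases h1 with hj | ⟨i, hi, rfl⟩ | ⟨i, hi, rfl⟩
    · obtain ⟨m, hm⟩ := Passage.left (w := V) l r hj d hle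
      simp only [padExit, padBead, if_pos hj]
      exact ⟨_, hm, prod_replicate_plain χ m⟩
    · rw [getD_middle _ _ _ hi] at h2
      obtain ⟨E, hE, hz⟩ := h.entry (d, i) (isEntry_iff.2 ⟨hi, h2⟩)
      have n1 : ¬ l.length + i < l.length := by omega
      have n2 : l.length + i < l.length + (if d then u else t).length := by omega
      simp only [padExit, padBead, if_neg n1, if_pos n2, Nat.add_sub_cancel_left]
      exact ⟨E, hE.pad l r, hz⟩
    · obtain ⟨m, hm⟩ := Passage.right h.fits l r i d hle
      have e2 : cutLevel V t (if d then 0 else V.length) = if d then u else t := by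
        cases d
        · exact cutLevel_length V t
        · exact h.fits.cutLevel_zero
      rw [e2] at hm
      have n1 : ¬ l.length + (if d then u else t).length + i < l.length := by omega
      have n2 : ¬ l.length + (if d then u else t).length + i <
        l.length + (if d then u else t).length := by omega
      simp only [padExit, padBead, if_neg n1, if_neg n2, Nat.add_sub_cancel_left]
      exact ⟨_, hm, prod_replicate_plain χ m⟩
  · intro i j hi0 hi hj
    rw [List.length_map] at hi
    rw [cutLevel_pad] at hj ⊢
    rw [List.length_append, List.length_append] at hj
    rcases Slice.position_cases hj with hj' | ⟨a, ha, rfl⟩ | ⟨a, ha, rfl⟩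
    · obtain ⟨m, hm⟩ := Passage.left (w := V) l r hj'
        ((l ++ cutLevel V t i ++ r).getD j false) hi.le
      exact ⟨_, _, _, hm⟩
    · rw [getD_middle _ _ _ ha]
      obtain ⟨d', j', E, hE⟩ := h.inner i a hi0 hi ha
      exact ⟨_, _, _, hE.pad l r⟩
    · obtain ⟨m, hm⟩ := Passage.right h.fits l r a
        ((l ++ cutLevel V t i ++ r).getD (l.length + (cutLevel V t i).length + a) false) hi.le
      exact ⟨_, _, _, hm⟩

theorem prod_range_pad {M : Type*} [CommMonoid M] (l x r : List Bool) (g : Bool → ℕ → M) :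
    ∏ j ∈ Finset.range (l ++ x ++ r).length, g ((l ++ x ++ r).getD j false) j =
      (∏ j ∈ Finset.range l.length, g (l.getD j false) j) *
      (∏ j ∈ Finset.range x.length, g (x.getD j false) (l.length + j)) *
      ∏ j ∈ Finset.range r.length, g (r.getD j false) (l.length + x.length + j) := by
  rw [List.length_append, List.length_append, Finset.prod_range_add, Finset.prod_range_add]
  congr 1
  · congr 1
    · refine Finset.prod_congr rfl fun j hj => ?_
      rw [List.append_assoc, List.getD_append _ _ _ _ (Finset.mem_range.1 hj)]
    · refine Finset.prod_congr rfl fun j hj => ?_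
      rw [getD_middle _ _ _ (Finset.mem_range.1 hj)]
  · refine Finset.prod_congr rfl fun j hj => ?_
    rw [← List.length_append, getD_append_add]

/-- The added vertical lines only contribute counits. Their product `κ` does not depend on `R`, so
the same scalar comes out of the functionals of both words. -/
theorem entryProd_pad (l u t r : List Bool) (y : Bool × ℕ → C) :
    ∃ κ : k, ∀ (R : Type v) [CommRing R] [Algebra k R] (z : Bool × ℕ → Bead Q R),
      entryProd (l ++ u ++ r) (l ++ t ++ r) (fun e => (padBead l u t z e).val (y e)) =
        algebraMap k R κ *
          entryProd u t fun e => (z e).val (y (e.1, l.length + e.2)) := by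
  let ε : C → k := counit (R := k)
  refine ⟨((∏ j ∈ Finset.range l.length, if l.getD j false then ε (y (true, j)) else 1) *
      ∏ j ∈ Finset.range r.length, if r.getD j false then ε (y (true, l.length + u.length + j))
        else 1) *
    ((∏ j ∈ Finset.range l.length, if l.getD j false then 1 else ε (y (false, j))) *
      ∏ j ∈ Finset.range r.length, if r.getD j false then 1
        else ε (y (false, l.length + t.length + j))), fun R _ _ z => ?_⟩
  have hl : ∀ d, ∀ j ∈ Finset.range l.length,
      (padBead l u t z (d, j)).val (y (d, j)) = algebraMap k R (ε (y (d, j))) := by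
    intro d j hj
    rw [padBead, if_pos (Finset.mem_range.1 hj), Bead.one_val, LinearMap.convOne_apply]
  have hm : ∀ d, ∀ j ∈ Finset.range (if d then u else t).length,
      (padBead l u t z (d, l.length + j)).val (y (d, l.length + j)) =
        (z (d, j)).val (y (d, l.length + j)) := by
    intro d j hj
    have n1 : ¬ l.length + j < l.length := by omega
    have n2 := Nat.add_lt_add_left (Finset.mem_range.1 hj) l.length
    simp only [padBead, if_neg n1, if_pos n2, Nat.add_sub_cancel_left]
  have hr : ∀ d, ∀ j,
      (padBead l u t z (d, l.length + (if d then u else t).length + j)).val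
        (y (d, l.length + (if d then u else t).length + j)) =
        algebraMap k R (ε (y (d, l.length + (if d then u else t).length + j))) := by
    intro d j
    have n1 : ¬ l.length + (if d then u else t).length + j < l.length := by omega
    have n2 : ¬ l.length + (if d then u else t).length + j <
      l.length + (if d then u else t).length := by omega
    simp only [padBead, if_neg n1, if_neg n2, Bead.one_val, LinearMap.convOne_apply]
    rfl
  have e1 : (∏ j ∈ Finset.range l.length,
      if l.getD j false then (padBead l u t z (true, j)).val (y (true, j)) else 1) =
      algebraMap k R (∏ j ∈ Finset.range l.length,
        if l.getD j false then ε (y (true, j)) else 1) := by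
    rw [map_prod]
    refine Finset.prod_congr rfl fun j hj => ?_
    split_ifs
    · exact hl true j hj
    · rw [map_one]
  have e2 : (∏ j ∈ Finset.range u.length, if u.getD j false then
        (padBead l u t z (true, l.length + j)).val (y (true, l.length + j)) else 1) =
      ∏ j ∈ Finset.range u.length, if u.getD j false then
        (z (true, j)).val (y (true, l.length + j)) else 1 :=
    Finset.prod_congr rfl fun j hj => if_congr Iff.rfl (hm true j hj) rfl
  have e3 : (∏ j ∈ Finset.range r.length, if r.getD j false then
        (padBead l u t z (true, l.length + u.length + j)).val
          (y (true, l.length + u.length + j)) else 1) =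
      algebraMap k R (∏ j ∈ Finset.range r.length,
        if r.getD j false then ε (y (true, l.length + u.length + j)) else 1) := by
    rw [map_prod]
    refine Finset.prod_congr rfl fun j _ => ?_
    split_ifs
    · exact hr true j
    · rw [map_one]
  have e4 : (∏ j ∈ Finset.range l.length,
      if l.getD j false then 1 else (padBead l u t z (false, j)).val (y (false, j))) =
      algebraMap k R (∏ j ∈ Finset.range l.length,
        if l.getD j false then 1 else ε (y (false, j))) := by
    rw [map_prod]
    refine Finset.prod_congr rfl fun j hj => ?_
    split_ifs
    · rw [map_one]
    · exact hl false j hj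
  have e5 : (∏ j ∈ Finset.range t.length, if t.getD j false then 1 else
        (padBead l u t z (false, l.length + j)).val (y (false, l.length + j))) =
      ∏ j ∈ Finset.range t.length, if t.getD j false then 1 else
        (z (false, j)).val (y (false, l.length + j)) :=
    Finset.prod_congr rfl fun j hj => if_congr Iff.rfl rfl (hm false j hj)
  have e6 : (∏ j ∈ Finset.range r.length, if r.getD j false then 1 else
        (padBead l u t z (false, l.length + t.length + j)).val
          (y (false, l.length + t.length + j))) =
      algebraMap k R (∏ j ∈ Finset.range r.length,
        if r.getD j false then 1 else ε (y (false, l.length + t.length + j))) := by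
    rw [map_prod]
    refine Finset.prod_congr rfl fun j _ => ?_
    split_ifs
    · rw [map_one]
    · exact hr false j
  rw [entryProd, entryProd,
    prod_range_pad l u r fun d j => if d then (padBead l u t z (true, j)).val (y (true, j)) else 1,
    prod_range_pad l t r fun d j =>
      if d then 1 else (padBead l u t z (false, j)).val (y (false, j)), e1, e2, e3, e4, e5, e6,
    map_mul, map_mul, map_mul]
  ring

theorem padBead_deg {R' : Type v} [CommRing R'] [Algebra k R'] {u t : List Bool}
    {z : Bool × ℕ → Bead Q R} {z' : Bool × ℕ → Bead Q R'}
    (h : ∀ e, IsEntry u t e → (z e).deg = (z' e).deg) (l r : List Bool) (e : Bool × ℕ)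
    (he : IsEntry (l ++ u ++ r) (l ++ t ++ r) e) :
    (padBead l u t z e).deg = (padBead l u t z' e).deg := by
  obtain ⟨d, j⟩ := e
  rw [isEntry_iff] at he
  have e1 : (if d then l ++ u ++ r else l ++ t ++ r) = l ++ (if d then u else t) ++ r := by
    cases d <;> rfl
  rw [e1] at he
  by_cases h1 : j < l.length
  · simp only [padBead, if_pos h1]
    rfl
  obtain ⟨i, rfl⟩ := Nat.exists_eq_add_of_le (not_lt.1 h1)
  by_cases h2 : l.length + i < l.length + (if d then u else t).length
  · simp only [padBead, if_neg h1, if_pos h2, Nat.add_sub_cancel_left]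
    have hi : i < (if d then u else t).length := Nat.lt_of_add_lt_add_left h2
    refine h _ (isEntry_iff.2 ⟨hi, ?_⟩)
    rw [← getD_middle _ _ _ hi]
    exact he.2
  · simp only [padBead, if_neg h1, if_neg h2]
    rfl

theorem LocalEquiv.pad {u t : List Bool} {V V' : List Slice} {m : Model.{v} Q V}
    {m' : Model.{v} Q V'} {ex : Bool × ℕ → Bool × ℕ} {z : Bool × ℕ → Bead Q m.R}
    {z' : Bool × ℕ → Bead Q m'.R} (h : LocalEquiv Q u t m m' ex z z') (l r : List Bool) :
    LocalEquiv Q (l ++ u ++ r) (l ++ t ++ r) (m.pad l r) (m'.pad l r) (padExit l u t ex)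
      (padBead l u t z) (padBead l u t z') := by
  refine ⟨h.left.pad l r, h.right.pad l r, padBead_deg h.deg l r, fun y => ?_⟩
  obtain ⟨κ, hκ⟩ := entryProd_pad (Q := Q) l u t r y
  change m.Φ (entryProd _ _ fun e => (padBead l u t z e).val (y e)) =
    m'.Φ (entryProd _ _ fun e => (padBead l u t z' e).val (y e))
  rw [hκ m.R z, hκ m'.R z', ← Algebra.smul_def, ← Algebra.smul_def, map_smul, map_smul]
  exact congrArg (κ • ·) (h.pure fun e => y (e.1, l.length + e.2))

/-! ### Computing strands -/

/-- Follow the strand through `p` for at most `n` steps. -/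
def follow (w : List Slice) : ℕ → Bool → ℕ × ℕ → Option (Bool × ℕ × List Event)
  | 0, _, _ => none
  | n + 1, d, p =>
    if p.1 = (if d then w.length else 0) then some (d, p.2, [])
    else if (if d then decide (p.1 < w.length) else decide (0 < p.1) && decide (p.1 ≤ w.length)) then
      (follow w n (newDir d p.1 (dirStep w d p).1.1) (dirStep w d p).1).map fun r =>
        (r.1, r.2.1, (dirStep w d p).2 :: r.2.2)
    else none

theorem passage_of_follow {w : List Slice} {n : ℕ} {d : Bool} {p : ℕ × ℕ}
    {r : Bool × ℕ × List Event} (h : follow w n d p = some r) : Passage w d p r.1 r.2.1 r.2.2 := by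
  induction n generalizing d p r with
  | zero => simp [follow] at h
  | succ n ih =>
    rw [follow] at h
    by_cases h1 : p.1 = if d then w.length else 0
    · rw [if_pos h1] at h
      cases h
      exact Passage.exit h1
    rw [if_neg h1] at h
    obtain ⟨h2, h⟩ := Option.ite_none_right_eq_some.1 h
    obtain ⟨r', hr, rfl⟩ := Option.map_eq_some_iff.1 h
    refine Passage.step ?_ (ih hr)
    cases d
    · simpa [CanStep] using h2
    · simpa [CanStep] using h2

/-- The events met by the strand at an entry. -/
def strandEvents (w : List Slice) (e : Bool × ℕ) : List Event :=
  -- Five is the least bound for the moves considered: a strand of a zigzag makes four steps, plain,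
  -- two turns and plain, and one more unit is spent on noticing the exit.
  ((follow w 5 e.1 (if e.1 then 0 else w.length, e.2)).map fun r => r.2.2).getD []

/-- The exit of the strand at an entry. -/
def strandExit (w : List Slice) (e : Bool × ℕ) : Bool × ℕ :=
  ((follow w 5 e.1 (if e.1 then 0 else w.length, e.2)).map fun r => (r.1, r.2.1)).getD e

/-- The bead of the strand at an entry. -/
def strandBead (Q : StrictOrientedQuantumCoalgebra k C) (χ : ℕ × Bool → WithConv (C →ₗ[k] R))
    (w : List Slice) (e : Bool × ℕ) : Bead Q R := ((strandEvents w e).map (Event.bead Q χ)).prod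

/-- All strands of `w` can be followed to their exits. -/
def Followable (u : List Bool) (w : List Slice) (t : List Bool) : Prop :=
  (∀ d, ∀ j < (if d then u else t).length, (if d then u else t).getD j false = d →
    (follow w 5 d (if d then 0 else w.length, j)).isSome = true) ∧
  ∀ h < w.length, 0 < h → ∀ j < (cutLevel w t h).length,
    (follow w 5 ((cutLevel w t h).getD j false) (h, j)).isSome = true

instance (u : List Bool) (w : List Slice) (t : List Bool) : Decidable (Followable u w t) := by
  unfold Followable
  infer_instance

theorem Followable.passageSystem {u t : List Bool} {w : List Slice} (h : Followable u w t)
    (hw : Fits u w t) (χ : ℕ × Bool → WithConv (C →ₗ[k] R)) {ex : Bool × ℕ → Bool × ℕ}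
    (hex : ∀ e, IsEntry u t e → ex e = strandExit w e) :
    PassageSystem u w t χ ex (strandBead Q χ w) := by
  refine ⟨hw, ?_, fun i j h0 hi hj => ?_⟩
  · rintro ⟨d, j⟩ he
    rw [hex _ he]
    obtain ⟨h1, h2⟩ := isEntry_iff.1 he
    obtain ⟨r, hr⟩ := Option.isSome_iff_exists.1 (h.1 d j h1 h2)
    refine ⟨r.2.2, ?_, ?_⟩
    · simp only [strandExit, hr]
      exact passage_of_follow hr
    · simp only [strandBead, strandEvents, hr]
      rfl
  · obtain ⟨r, hr⟩ := Option.isSome_iff_exists.1 (h.2 i hi h0 j hj)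
    exact ⟨_, _, _, passage_of_follow hr⟩

/-- The strands of two words connect the same end points with the same degrees. -/
def SameStrands (u : List Bool) (w w' : List Slice) (t : List Bool) : Prop :=
  ∀ d, ∀ j < (if d then u else t).length, (if d then u else t).getD j false = d →
    strandExit w (d, j) = strandExit w' (d, j) ∧
    ((strandEvents w (d, j)).map Event.d).sum = ((strandEvents w' (d, j)).map Event.d).sum ∧
    ((strandEvents w (d, j)).map Event.u).sum = ((strandEvents w' (d, j)).map Event.u).sum

instance (u : List Bool) (w w' : List Slice) (t : List Bool) :
    Decidable (SameStrands u w w' t) := by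
  unfold SameStrands
  infer_instance

/-- For a concrete move the exits and degrees are finite decidable data; only the identity of values
`hp` needs an argument. -/
theorem SameStrands.localEquiv {u t : List Bool} {w w' : List Slice} (h : SameStrands u w w' t)
    (hw : Fits u w t) (hw' : Fits u w' t) (hf : Followable u w t) (hf' : Followable u w' t)
    {m : Model.{v} Q w} {m' : Model.{v} Q w'}
    (hp : ∀ y : Bool × ℕ → C,
      m.Φ (entryProd u t fun e => (strandBead Q m.χ w e).val (y e)) =
        m'.Φ (entryProd u t fun e => (strandBead Q m'.χ w' e).val (y e))) :
    LocalEquiv Q u t m m' (strandExit w) (strandBead Q m.χ w) (strandBead Q m'.χ w') := by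
  refine ⟨hf.passageSystem hw _ fun _ _ => rfl, hf'.passageSystem hw' _ ?_, ?_, hp⟩
  · rintro ⟨d, j⟩ he
    obtain ⟨h1, h2⟩ := isEntry_iff.1 he
    exact (h d j h1 h2).1
  · rintro ⟨d, j⟩ he
    obtain ⟨h1, h2⟩ := isEntry_iff.1 he
    obtain ⟨-, h3, h4⟩ := h d j h1 h2
    rw [strandBead, strandBead, prod_bead_deg, prod_bead_deg, h3, h4]

end Padding

/-! ### Zigzags, opposite crossings, the braid relation and slides. -/

section Moves

open Function WithConv

variable {k : Type u} {C : Type w} [Field k] [AddCommGroup C] [Module k C] [Coalgebra k C]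
variable {R : Type v} [CommRing R] [Algebra k R] {Q : StrictOrientedQuantumCoalgebra k C}

/-! ### Beads of strands with few crossing lines -/

theorem strandBead_val (χ : ℕ × Bool → WithConv (C →ₗ[k] R)) (w : List Slice) (e : Bool × ℕ) :
    (strandBead Q χ w e).val =
      ((crossingLines (strandEvents w e)).map fun u => Q.shift u.2 (χ u.1)).prod :=
  prod_bead_val Q χ _

theorem strandBead_no_line {χ : ℕ × Bool → WithConv (C →ₗ[k] R)} {w : List Slice} {e : Bool × ℕ}
    (h : crossingLines (strandEvents w e) = []) (x : C) :
    (strandBead Q χ w e).val x = algebraMap k R (counit (R := k) x) := by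
  rw [strandBead_val, h, List.map_nil, List.prod_nil, LinearMap.convOne_apply]

theorem strandBead_line {χ : ℕ × Bool → WithConv (C →ₗ[k] R)} {w : List Slice} {e : Bool × ℕ}
    {u : ℕ × Bool} {s : ℤ × ℤ} (h : crossingLines (strandEvents w e) = [(u, s)]) (x : C) :
    (strandBead Q χ w e).val x = χ u (Q.powEquiv s x) := by
  rw [strandBead_val, h, List.map_cons, List.map_nil, List.prod_cons, List.prod_nil, mul_one,
    Q.shift_apply]

/-- A downward strand meets the upper line `u'` first. Splitting the element into `lo` and `up`
gives one formula for both directions, in the shape of the identities for forms. -/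
theorem strandBead_two_lines {χ : ℕ × Bool → WithConv (C →ₗ[k] R)} {w : List Slice}
    {e : Bool × ℕ} {u u' : ℕ × Bool} {a : Bool}
    (h : crossingLines (strandEvents w e) = if a then [(u, 0), (u', 0)] else [(u', 0), (u, 0)])
    (x : C) : (strandBead Q χ w e).val x =
      ∑ i ∈ (ℛ k x).index, χ u (lo k a x i) * χ u' (up k a x i) := by
  rw [strandBead_val, h]
  cases a
  · simp only [Bool.false_eq_true, if_false, List.map_cons, List.map_nil, List.prod_cons,
      List.prod_nil, mul_one, Q.shift_zero]
    rw [(ℛ k x).convMul_apply]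
    exact Finset.sum_congr rfl fun i _ => mul_comm _ _
  · simp only [if_true, List.map_cons, List.map_nil, List.prod_cons, List.prod_nil, mul_one,
      Q.shift_zero]
    rw [(ℛ k x).convMul_apply]
    rfl

/-! ### Models of short words -/

theorem Model.apply_one (m : Model.{v} Q []) : m.Φ 1 = 1 := by
  simpa [crossingProduct] using m.pure 0

theorem Model.apply_noncrossing (p q : Slice) (hp : ∀ o a b, p.piece ≠ .cross o a b)
    (hq : ∀ o a b, q.piece ≠ .cross o a b) (m : Model.{v} Q [p, q]) : m.Φ 1 = 1 := by
  obtain ⟨l, p, r⟩ := p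
  obtain ⟨l', q, r'⟩ := q
  have := m.pure 0
  rcases p with _ | _ | _ <;> rcases q with _ | _ | _ <;>
    simp_all [crossingProduct, lineProduct, Finset.prod_range_succ]

theorem Model.apply_cross_cap {l l' r r' : List Bool} {o a b d : Bool}
    (m : Model.{v} Q [⟨l, .cross o a b, r⟩, ⟨l', .cap d, r'⟩]) (x y : C) :
    m.Φ (m.χ (0, true) x * m.χ (0, false) y) = crossingFactor Q o a b x y := by
  simpa [crossingProduct, lineProduct, Finset.prod_range_succ] using
    m.pure fun u => if u.2 then x else y

theorem Model.apply_cup_cross {l l' r r' : List Bool} {o a b d : Bool}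
    (m : Model.{v} Q [⟨l', .cup d, r'⟩, ⟨l, .cross o a b, r⟩]) (x y : C) :
    m.Φ (m.χ (1, true) x * m.χ (1, false) y) = crossingFactor Q o a b x y := by
  simpa [crossingProduct, lineProduct, Finset.prod_range_succ] using
    m.pure fun u => if u.2 then x else y

theorem Model.apply_cross_cross {l l' r r' : List Bool} {o a b o' a' b' : Bool}
    (m : Model.{v} Q [⟨l, .cross o a b, r⟩, ⟨l', .cross o' a' b', r'⟩]) (x y x' y' : C) :
    m.Φ (m.χ (0, true) x * m.χ (0, false) y * (m.χ (1, true) x' * m.χ (1, false) y')) =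
      crossingFactor Q o a b x y * crossingFactor Q o' a' b' x' y' := by
  simpa [crossingProduct, lineProduct, Finset.prod_range_succ] using
    m.pure fun u => match u with
      | (0, true) => x
      | (0, false) => y
      | (_, true) => x'
      | (_, false) => y'

theorem Model.apply_three {l l' l'' r r' r'' : List Bool} {o a b o' a' b' o'' a'' b'' : Bool}
    (m : Model.{v} Q [⟨l, .cross o a b, r⟩, ⟨l', .cross o' a' b', r'⟩, ⟨l'', .cross o'' a'' b'', r''⟩])
    (x y x' y' x'' y'' : C) :
    m.Φ (m.χ (0, true) x * m.χ (0, false) y * (m.χ (1, true) x' * m.χ (1, false) y') *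
      (m.χ (2, true) x'' * m.χ (2, false) y'')) =
      crossingFactor Q o a b x y * crossingFactor Q o' a' b' x' y' *
        crossingFactor Q o'' a'' b'' x'' y'' := by
  simpa [crossingProduct, lineProduct, Finset.prod_range_succ] using
    m.pure fun u => match u with
      | (0, true) => x
      | (0, false) => y
      | (1, true) => x'
      | (1, false) => y'
      | (_, true) => x''
      | (_, false) => y''

/-! ### Products over entries -/

theorem entryProd_one {M : Type*} [CommMonoid M] (a : Bool) (f : Bool × ℕ → M) :
    entryProd [a] [a] f = f (a, 0) := by
  cases a <;> simp [entryProd]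

theorem entryProd_two {M : Type*} [CommMonoid M] (a b : Bool) (f : Bool × ℕ → M) :
    entryProd [a, b] [a, b] f = f (a, 0) * f (b, 1) := by
  cases a <;> cases b <;> simp [entryProd, Finset.prod_range_succ, mul_comm]

theorem entryProd_three {M : Type*} [CommMonoid M] (a b c : Bool) (f : Bool × ℕ → M) :
    entryProd [a, b, c] [c, b, a] f =
      f (a, if a then 0 else 2) * f (b, 1) * f (c, if c then 2 else 0) := by
  cases a <;> cases b <;> cases c <;>
    simp [entryProd, Finset.prod_range_succ, mul_comm, mul_assoc]

theorem entryProd_max {M : Type*} [CommMonoid M] (a b : Bool) (f : Bool × ℕ → M) :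
    entryProd [a, b, !a] [b] f = f (true, if a then 0 else 2) * f (b, if b then 1 else 0) := by
  cases a <;> cases b <;> simp [entryProd, Finset.prod_range_succ, mul_comm]

theorem entryProd_min {M : Type*} [CommMonoid M] (a b : Bool) (f : Bool × ℕ → M) :
    entryProd [b] [!a, b, a] f = f (false, if a then 0 else 2) * f (b, if b then 0 else 1) := by
  cases a <;> cases b <;> simp [entryProd, Finset.prod_range_succ, mul_comm]

/-! ### Locally equivalent words -/

/-- Two words which may replace each other in a diagram. -/
def LocallyEquivalent (Q : StrictOrientedQuantumCoalgebra k C) (u : List Bool) (V V' : List Slice)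
    (t : List Bool) : Prop :=
  ∃ (m : Model.{max u w} Q V) (m' : Model.{max u w} Q V') (ex : Bool × ℕ → Bool × ℕ)
    (z : Bool × ℕ → Bead Q m.R) (z' : Bool × ℕ → Bead Q m'.R), LocalEquiv Q u t m m' ex z z'

theorem SameStrands.locallyEquivalent {u t : List Bool} {V V' : List Slice}
    (h : SameStrands u V V' t) (hw : Fits u V t) (hw' : Fits u V' t) (hf : Followable u V t)
    (hf' : Followable u V' t)
    (hp : ∀ (m : Model.{max u w} Q V) (m' : Model.{max u w} Q V') (y : Bool × ℕ → C),
      m.Φ (entryProd u t fun e => (strandBead Q m.χ V e).val (y e)) =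
        m'.Φ (entryProd u t fun e => (strandBead Q m'.χ V' e).val (y e))) :
    LocallyEquivalent Q u V V' t :=
  ⟨Model.ofWord Q V, Model.ofWord Q V', _, _, _,
    h.localEquiv hw hw' hf hf' (hp (Model.ofWord Q V) (Model.ofWord Q V'))⟩

/-- No crossing line is met, so both values are counits, and the exponents of the maximum and of the
minimum cancel. -/
theorem locallyEquivalent_zigzag_left (a : Bool) :
    LocallyEquivalent Q [a] [⟨[a], .cup a, []⟩, ⟨[], .cap a, [a]⟩] [] [a] := by
  have h₁ : crossingLines (strandEvents [⟨[a], .cup a, []⟩, ⟨[], .cap a, [a]⟩] (a, 0)) = [] := by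
    revert a; decide
  have h₂ : crossingLines (strandEvents [] (a, 0)) = [] := by revert a; decide
  refine SameStrands.locallyEquivalent (by clear h₁ h₂; revert a; decide) ⟨rfl, rfl, rfl⟩ rfl
    (by clear h₁ h₂; revert a; decide) (by clear h₁ h₂; revert a; decide) fun m m' y => ?_
  rw [entryProd_one, entryProd_one, strandBead_no_line h₁, strandBead_no_line h₂,
    Algebra.algebraMap_eq_smul_one, Algebra.algebraMap_eq_smul_one, map_smul, map_smul,
    m'.apply_one, m.apply_noncrossing _ _ (by simp) (by simp)]

theorem locallyEquivalent_zigzag_right (a : Bool) :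
    LocallyEquivalent Q [a] [⟨[], .cup (!a), [a]⟩, ⟨[a], .cap (!a), []⟩] [] [a] := by
  have h₁ : crossingLines (strandEvents [⟨[], .cup (!a), [a]⟩, ⟨[a], .cap (!a), []⟩] (a, 0)) =
      [] := by
    revert a; decide
  have h₂ : crossingLines (strandEvents [] (a, 0)) = [] := by revert a; decide
  refine SameStrands.locallyEquivalent (by clear h₁ h₂; revert a; decide)
    (by cases a <;> exact ⟨rfl, rfl, rfl⟩) rfl
    (by clear h₁ h₂; revert a; decide) (by clear h₁ h₂; revert a; decide) fun m m' y => ?_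
  rw [entryProd_one, entryProd_one, strandBead_no_line h₁, strandBead_no_line h₂,
    Algebra.algebraMap_eq_smul_one, Algebra.algebraMap_eq_smul_one, map_smul, map_smul,
    m'.apply_one, m.apply_noncrossing _ _ (by simp) (by simp)]

theorem locallyEquivalent_two (o a b : Bool) :
    LocallyEquivalent Q [a, b] [⟨[], .cross o a b, []⟩, ⟨[], .cross (!o) b a, []⟩] []
      [a, b] := by
  have h₁ : crossingLines (strandEvents [⟨[], .cross o a b, []⟩, ⟨[], .cross (!o) b a, []⟩]
      (a, 0)) = if a then [((0, true), 0), ((1, false), 0)] else [((1, false), 0), ((0, true), 0)] := by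
    revert o a b; decide
  have h₂ : crossingLines (strandEvents [⟨[], .cross o a b, []⟩, ⟨[], .cross (!o) b a, []⟩]
      (b, 1)) = if b then [((0, false), 0), ((1, true), 0)] else [((1, true), 0), ((0, false), 0)] := by
    clear h₁; revert o a b; decide
  have h₃ : crossingLines (strandEvents [] (a, 0)) = [] := by clear h₁ h₂; revert a; decide
  have h₄ : crossingLines (strandEvents [] (b, 1)) = [] := by clear h₁ h₂ h₃; revert b; decide
  refine SameStrands.locallyEquivalent (by clear h₁ h₂ h₃ h₄; revert o a b; decide)
    ⟨rfl, rfl, rfl⟩ rfl (by clear h₁ h₂ h₃ h₄; revert o a b; decide)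
    (by clear h₁ h₂ h₃ h₄; revert a b; decide) fun m m' y => ?_
  rw [entryProd_two, entryProd_two, strandBead_two_lines h₁, strandBead_two_lines h₂,
    strandBead_no_line h₃, strandBead_no_line h₄, ← map_mul,
    Algebra.algebraMap_eq_smul_one, map_smul, m'.apply_one, smul_eq_mul, mul_one,
    ← Q.crossingFactor_two o a b, Finset.sum_mul_sum, map_sum]
  refine Finset.sum_congr rfl fun i _ => ?_
  rw [map_sum]
  refine Finset.sum_congr rfl fun j _ => ?_
  rw [← m.apply_cross_cross]
  congr 1
  ring

theorem map_mul_sum_three {S : Type*} [CommRing S] [Algebra k S] (Φ : S →ₗ[k] k)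
    {ι₁ ι₂ ι₃ : Type*} (s₁ : Finset ι₁) (s₂ : Finset ι₂) (s₃ : Finset ι₃) (f₁ : ι₁ → S)
    (f₂ : ι₂ → S) (f₃ : ι₃ → S) :
    Φ ((∑ i ∈ s₁, f₁ i) * (∑ j ∈ s₂, f₂ j) * ∑ l ∈ s₃, f₃ l) =
      ∑ i ∈ s₁, ∑ j ∈ s₂, ∑ l ∈ s₃, Φ (f₁ i * f₂ j * f₃ l) := by
  rw [Finset.sum_mul_sum, Finset.sum_mul, map_sum]
  refine Finset.sum_congr rfl fun i _ => ?_
  rw [Finset.sum_mul_sum, map_sum]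
  exact Finset.sum_congr rfl fun j _ => map_sum _ _ _

theorem locallyEquivalent_three (o a b c : Bool) :
    LocallyEquivalent Q [a, b, c]
      [⟨[], .cross o a b, [c]⟩, ⟨[b], .cross o a c, []⟩, ⟨[], .cross o b c, [a]⟩]
      [⟨[a], .cross o b c, []⟩, ⟨[], .cross o a c, [b]⟩, ⟨[c], .cross o a b, []⟩] [c, b, a] := by
  have h : ∀ o a b c : Bool,
      let V : List Slice :=
        [⟨[], .cross o a b, [c]⟩, ⟨[b], .cross o a c, []⟩, ⟨[], .cross o b c, [a]⟩]
      let V' : List Slice :=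
        [⟨[a], .cross o b c, []⟩, ⟨[], .cross o a c, [b]⟩, ⟨[c], .cross o a b, []⟩]
      crossingLines (strandEvents V (a, if a then 0 else 2)) =
        (if a then [((0, true), 0), ((1, true), 0)] else [((1, true), 0), ((0, true), 0)]) ∧
      crossingLines (strandEvents V (b, 1)) =
        (if b then [((0, false), 0), ((2, true), 0)] else [((2, true), 0), ((0, false), 0)]) ∧
      crossingLines (strandEvents V (c, if c then 2 else 0)) =
        (if c then [((1, false), 0), ((2, false), 0)] else [((2, false), 0), ((1, false), 0)]) ∧
      crossingLines (strandEvents V' (a, if a then 0 else 2)) =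
        (if a then [((1, true), 0), ((2, true), 0)] else [((2, true), 0), ((1, true), 0)]) ∧
      crossingLines (strandEvents V' (b, 1)) =
        (if b then [((0, true), 0), ((2, false), 0)] else [((2, false), 0), ((0, true), 0)]) ∧
      crossingLines (strandEvents V' (c, if c then 2 else 0)) =
        (if c then [((0, false), 0), ((1, false), 0)] else [((1, false), 0), ((0, false), 0)]) := by
    intro o a b c
    dsimp only
    refine ⟨?_, ?_, ?_, ?_, ?_, ?_⟩ <;> revert o a b c <;> decide
  obtain ⟨h₁, h₂, h₃, h₄, h₅, h₆⟩ := h o a b c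
  refine SameStrands.locallyEquivalent (by clear * -; revert o a b c; decide) ⟨rfl, rfl, rfl, rfl⟩
    ⟨rfl, rfl, rfl, rfl⟩ (by clear * -; revert o a b c; decide)
    (by clear * -; revert o a b c; decide) fun m m' y => ?_
  rw [entryProd_three, entryProd_three, strandBead_two_lines h₁, strandBead_two_lines h₂,
    strandBead_two_lines h₃, strandBead_two_lines h₄, strandBead_two_lines h₅,
    strandBead_two_lines h₆, map_mul_sum_three, map_mul_sum_three]
  refine Eq.trans ?_ ((Q.crossingFactor_three o a b c (y (a, if a then 0 else 2)) (y (b, 1))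
    (y (c, if c then 2 else 0))).trans ?_)
  · refine Finset.sum_congr rfl fun i _ => Finset.sum_congr rfl fun j _ =>
      Finset.sum_congr rfl fun l _ => ?_
    rw [← m.apply_three]
    congr 1
    ring
  · refine Finset.sum_congr rfl fun i _ => Finset.sum_congr rfl fun j _ =>
      Finset.sum_congr rfl fun l _ => ?_
    rw [← m'.apply_three]
    congr 1
    ring

/-- Invariance of the forms. The factors for lines of opposite directions are made so that this and
the next identity hold, with the automorphism belonging to the extremum that is passed. -/
theorem crossingFactor_slide_up (o b : Bool) (x y : C) :
    crossingFactor Q o true b x y = crossingFactor Q (!o) b false y (Q.Tu x) := by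
  cases o <;> cases b <;> simp [crossingFactor, Q.bInv_Tu, ← Q.qc2_u]

theorem crossingFactor_slide_down (o b : Bool) (x y : C) :
    crossingFactor Q o false b x y = crossingFactor Q (!o) b true y (Q.Td x) := by
  cases o <;> cases b <;> simp [crossingFactor, Q.bInv_Td, ← Q.qc2_d]

/-- The bent line meets the crossing before the maximum on one side of the move and after it on the
other. The exponent `(0, -1)` or `(1, 0)` is that of this maximum. -/
theorem locallyEquivalent_slide_max (o a b : Bool) :
    LocallyEquivalent Q [a, b, !a] [⟨[], .cross o a b, [!a]⟩, ⟨[b], .cap a, []⟩]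
      [⟨[a], .cross (!o) b (!a), []⟩, ⟨[], .cap a, [b]⟩] [b] := by
  have h : ∀ o a b : Bool,
      let V : List Slice := [⟨[], .cross o a b, [!a]⟩, ⟨[b], .cap a, []⟩]
      let V' : List Slice := [⟨[a], .cross (!o) b (!a), []⟩, ⟨[], .cap a, [b]⟩]
      crossingLines (strandEvents V (true, if a then 0 else 2)) =
        [((0, true), if a then (0, -1) else 0)] ∧
      crossingLines (strandEvents V (b, if b then 1 else 0)) = [((0, false), 0)] ∧
      crossingLines (strandEvents V' (true, if a then 0 else 2)) =
        [((0, false), if a then 0 else (1, 0))] ∧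
      crossingLines (strandEvents V' (b, if b then 1 else 0)) = [((0, true), 0)] := by
    intro o a b
    dsimp only
    refine ⟨?_, ?_, ?_, ?_⟩ <;> revert o a b <;> decide
  obtain ⟨h₁, h₂, h₃, h₄⟩ := h o a b
  refine SameStrands.locallyEquivalent (by clear * -; revert o a b; decide) ⟨rfl, rfl, rfl⟩
    (by cases a <;> exact ⟨rfl, rfl, rfl⟩) (by clear * -; revert o a b; decide)
    (by clear * -; revert o a b; decide) fun m m' y => ?_
  rw [entryProd_max, entryProd_max, strandBead_line h₁, strandBead_line h₂, strandBead_line h₃,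
    strandBead_line h₄, m.apply_cross_cap, mul_comm (m'.χ _ _), m'.apply_cross_cap]
  cases a
  · exact (crossingFactor_slide_down o b _ _).trans (by simp [StrictOrientedQuantumCoalgebra.powEquiv])
  · exact (crossingFactor_slide_up o b _ _).trans (by simp [StrictOrientedQuantumCoalgebra.powEquiv])

theorem locallyEquivalent_slide_min (o a b : Bool) :
    LocallyEquivalent Q [b] [⟨[b], .cup a, []⟩, ⟨[], .cross (!o) b (!a), [a]⟩]
      [⟨[], .cup a, [b]⟩, ⟨[!a], .cross o a b, []⟩] [!a, b, a] := by
  have h : ∀ o a b : Bool,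
      let V : List Slice := [⟨[b], .cup a, []⟩, ⟨[], .cross (!o) b (!a), [a]⟩]
      let V' : List Slice := [⟨[], .cup a, [b]⟩, ⟨[!a], .cross o a b, []⟩]
      crossingLines (strandEvents V (false, if a then 0 else 2)) =
        [((1, false), if a then (0, 1) else 0)] ∧
      crossingLines (strandEvents V (b, if b then 0 else 1)) = [((1, true), 0)] ∧
      crossingLines (strandEvents V' (false, if a then 0 else 2)) =
        [((1, true), if a then 0 else (-1, 0))] ∧
      crossingLines (strandEvents V' (b, if b then 0 else 1)) = [((1, false), 0)] := by
    intro o a b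
    dsimp only
    refine ⟨?_, ?_, ?_, ?_⟩ <;> revert o a b <;> decide
  obtain ⟨h₁, h₂, h₃, h₄⟩ := h o a b
  refine SameStrands.locallyEquivalent (by clear * -; revert o a b; decide) ⟨rfl, rfl, rfl⟩
    ⟨rfl, rfl, rfl⟩ (by clear * -; revert o a b; decide)
    (by clear * -; revert o a b; decide) fun m m' y => ?_
  rw [entryProd_min, entryProd_min, strandBead_line h₁, strandBead_line h₂, strandBead_line h₃,
    strandBead_line h₄, m'.apply_cup_cross, mul_comm (m.χ _ _), m.apply_cup_cross]
  cases a
  · refine Eq.symm ((crossingFactor_slide_down o b _ _).trans ?_)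
    simp [StrictOrientedQuantumCoalgebra.powEquiv]
  · refine Eq.symm ((crossingFactor_slide_up o b _ _).trans ?_)
    simp [StrictOrientedQuantumCoalgebra.powEquiv]

end Moves

/-! ### Exchanging the heights of two pieces side by side. -/

section Exchange

open Function WithConv

/-! ### Passages through a word with two slices -/

theorem Passage.append {a w b : List Slice} {d d' d'' : Bool} {p : ℕ × ℕ} {j i : ℕ}
    {E E' : List Event} (hs : Passage w d p d' j E)
    (h : Passage (a ++ w ++ b) d' (a.length + if d' then w.length else 0, j) d'' i E') :
    Passage (a ++ w ++ b) d (a.length + p.1, p.2) d'' i (E.map (Event.raise a.length) ++ E') := by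
  induction hs with
  | exit hp => rwa [← hp] at h
  | @step d p d' j E hv _ ih =>
    have e := dirStep_append (a := a) (b := b) hv p.2
    have hv' : CanStep (a ++ w ++ b).length d (a.length + p.1) := by
      rw [List.length_append, List.length_append]
      cases d with
      | true =>
        have : p.1 < w.length := hv
        change a.length + p.1 < _
        omega
      | false =>
        have : 0 < p.1 ∧ p.1 ≤ w.length := hv
        change 0 < a.length + p.1 ∧ _
        omega
    have := Passage.step (w := a ++ w ++ b) (d := d) (p := (a.length + p.1, p.2)) hv'
      (by rw [e, newDir_add]; exact ih h)
    rwa [e] at this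

/-- A vertical line through a slice, at position `i` below and `j` above. -/
def Slice.Vertical (s : Slice) (i j : ℕ) : Prop :=
  ∀ d : Bool, ∃ n, Passage [s] d (if d then 0 else 1, if d then i else j) d (if d then j else i)
    (List.replicate n .plain)

theorem Slice.vertical_left {l r : List Bool} {p : Piece} {j : ℕ} (hj : j < l.length) :
    Slice.Vertical ⟨l, p, r⟩ j j := by
  intro d
  obtain ⟨n, hn⟩ := Passage.left (w := [⟨[], p, []⟩]) l r hj d (h := if d then 0 else 1)
    (by cases d <;> simp)
  refine ⟨n, ?_⟩
  rw [ite_self]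
  simpa [Slice.pad] using hn

theorem Slice.vertical_right (l r : List Bool) (p : Piece) (i : ℕ) :
    Slice.Vertical ⟨l, p, r⟩ (l.length + p.bot.length + i) (l.length + p.top.length + i) := by
  intro d
  have hw : Fits p.bot [⟨[], p, []⟩] p.top := ⟨by simp [Slice.bot], by simp [Slice.top, Fits]⟩
  obtain ⟨n, hn⟩ := Passage.right hw l r i d (h := if d then 0 else 1) (by cases d <;> simp)
  refine ⟨n, ?_⟩
  cases d <;> simpa [Slice.pad, cutLevel, Slice.bot] using hn

theorem map_raise_plain (H n : ℕ) :
    (List.replicate n Event.plain).map (Event.raise H) = List.replicate n .plain :=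
  List.map_replicate

variable {s₀ s₁ : Slice}

theorem Passage.lower {d d' : Bool} {j i i' : ℕ} {E : List Event}
    (hs : Passage [s₀] d (if d then 0 else 1, j) d' i E)
    (hi : if d' then s₁.Vertical i i' else i' = i) :
    ∃ n, Passage [s₀, s₁] d (if d then 0 else 1, j) d' i'
      (E.map (Event.raise 0) ++ List.replicate n .plain) := by
  have hend : ∃ n, Passage [s₀, s₁] d' (0 + if d' then 1 else 0, i) d' i'
      (List.replicate n .plain) := by
    cases d' with
    | true =>
      obtain ⟨n, hn⟩ := hi true
      refine ⟨n, ?_⟩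
      have := hn.append (a := [s₀]) (b := []) (Passage.exit rfl)
      rw [map_raise_plain, List.append_nil, List.append_nil] at this
      exact this
    | false =>
      obtain rfl : i' = i := hi
      exact ⟨0, Passage.exit rfl⟩
  obtain ⟨n, hn⟩ := hend
  have := hs.append (a := []) (b := [s₁]) hn
  exact ⟨n, by simpa using this⟩

theorem Passage.upper {d d' : Bool} {j i i' : ℕ} {E : List Event}
    (hs : Passage [s₁] d (if d then 0 else 1, j) d' i E)
    (hi : if d' then i' = i else s₀.Vertical i' i) :
    ∃ n, Passage [s₀, s₁] d (if d then 1 else 2, j) d' i'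
      (E.map (Event.raise 1) ++ List.replicate n .plain) := by
  have hend : ∃ n, Passage [s₀, s₁] d' (1 + if d' then 1 else 0, i) d' i'
      (List.replicate n .plain) := by
    cases d' with
    | true =>
      obtain rfl : i' = i := hi
      exact ⟨0, Passage.exit rfl⟩
    | false =>
      obtain ⟨n, hn⟩ := hi false
      refine ⟨n, ?_⟩
      have := hn.append (a := []) (b := [s₁]) (Passage.exit rfl)
      rw [map_raise_plain, List.append_nil] at this
      exact this
  obtain ⟨n, hn⟩ := hend
  have := hs.append (a := [s₀]) (b := []) hn
  refine ⟨n, ?_⟩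
  cases d <;> exact this

/-! ### Strands of a piece -/

/-- The number of end points of a piece where a strand enters in direction `d`. -/
def Piece.ends (p : Piece) (d : Bool) : ℕ := (if d then p.bot else p.top).length

theorem Piece.strand (p : Piece) (l r : List Bool) {d : Bool} {j : ℕ} (hj : j < p.ends d) :
    Passage [⟨l, p, r⟩] d (if d then 0 else 1, l.length + j) (strandExit [⟨[], p, []⟩] (d, j)).1
        (l.length + (strandExit [⟨[], p, []⟩] (d, j)).2) (strandEvents [⟨[], p, []⟩] (d, j)) ∧
      (strandExit [⟨[], p, []⟩] (d, j)).2 < p.ends (!(strandExit [⟨[], p, []⟩] (d, j)).1) := by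
  have h : ∃ x, follow [⟨[], p, []⟩] 5 d (if d then 0 else 1, j) = some x ∧
      x.2.1 < p.ends !x.1 := by
    have hj2 : j < 2 := by
      refine hj.trans_le ?_
      cases d <;> rcases p with _ | _ | _ <;> simp [Piece.ends, Piece.bot, Piece.top]
    interval_cases j <;> cases d <;> rcases p with _ | _ | _ <;>
      first
      | exact ⟨_, rfl, Nat.one_lt_two⟩
      | exact ⟨_, rfl, Nat.zero_lt_two⟩
      | exact absurd hj (Nat.not_lt_zero _)
  obtain ⟨x, hx, hb⟩ := h
  have e₁ : strandExit [⟨[], p, []⟩] (d, j) = (x.1, x.2.1) := by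
    simp only [strandExit, List.length_singleton, hx]
    rfl
  have e₂ : strandEvents [⟨[], p, []⟩] (d, j) = x.2.2 := by
    simp only [strandEvents, List.length_singleton, hx]
    rfl
  rw [e₁, e₂]
  refine ⟨?_, hb⟩
  simpa [Slice.pad] using (passage_of_follow hx).pad l r

/-- The strands of `p` in a word with two slices, where `p` lies in the slice `H` and the
positions of its end points are shifted by `L₀` below and by `L₁` above. -/
def Piece.Contained (p : Piece) (w : List Slice) (H L₀ L₁ : ℕ) : Prop :=
  ∀ d, ∀ j < p.ends d, ∃ n n', Passage w d (if d then 0 else 2, (if d then L₀ else L₁) + j)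
    (strandExit [⟨[], p, []⟩] (d, j)).1
    ((if (strandExit [⟨[], p, []⟩] (d, j)).1 then L₁ else L₀) +
      (strandExit [⟨[], p, []⟩] (d, j)).2)
    (List.replicate n .plain ++ ((strandEvents [⟨[], p, []⟩] (d, j)).map (Event.raise H) ++
      List.replicate n' .plain))

/-- The traversal leaves `w` from the point `p`, in both directions. -/
def Leaves (w : List Slice) (p : ℕ × ℕ) : Prop := ∀ d, ∃ d' i E, Passage w d p d' i E

variable {p : Piece} {l r : List Bool} {L : ℕ}

theorem Passage.lower_strand (h : ∀ j < p.top.length, s₁.Vertical (l.length + j) (L + j)) {d : Bool}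
    {j : ℕ} (hj : j < p.ends d) :
    ∃ n, Passage [⟨l, p, r⟩, s₁] d (if d then 0 else 1, l.length + j)
      (strandExit [⟨[], p, []⟩] (d, j)).1
      ((if (strandExit [⟨[], p, []⟩] (d, j)).1 then L else l.length) +
        (strandExit [⟨[], p, []⟩] (d, j)).2)
      ((strandEvents [⟨[], p, []⟩] (d, j)).map (Event.raise 0) ++ List.replicate n .plain) := by
  obtain ⟨h₁, h₂⟩ := p.strand l r hj
  generalize strandExit [⟨[], p, []⟩] (d, j) = x at h₁ h₂ ⊢
  obtain ⟨d', i⟩ := x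
  refine h₁.lower ?_
  cases d' with
  | true => exact h i h₂
  | false => rfl

theorem Passage.upper_strand (h : ∀ j < p.bot.length, s₀.Vertical (L + j) (l.length + j)) {d : Bool}
    {j : ℕ} (hj : j < p.ends d) :
    ∃ n, Passage [s₀, ⟨l, p, r⟩] d (if d then 1 else 2, l.length + j)
      (strandExit [⟨[], p, []⟩] (d, j)).1
      ((if (strandExit [⟨[], p, []⟩] (d, j)).1 then l.length else L) +
        (strandExit [⟨[], p, []⟩] (d, j)).2)
      ((strandEvents [⟨[], p, []⟩] (d, j)).map (Event.raise 1) ++ List.replicate n .plain) := by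
  obtain ⟨h₁, h₂⟩ := p.strand l r hj
  generalize strandExit [⟨[], p, []⟩] (d, j) = x at h₁ h₂ ⊢
  obtain ⟨d', i⟩ := x
  refine h₁.upper ?_
  cases d' with
  | true => rfl
  | false => exact h i h₂

theorem Piece.contained_lower (h : ∀ j < p.top.length, s₁.Vertical (l.length + j) (L + j)) :
    p.Contained [⟨l, p, r⟩, s₁] 0 l.length L := by
  intro d j hj
  obtain ⟨n', hn'⟩ := Passage.lower_strand (r := r) h hj
  cases d with
  | true => exact ⟨0, n', hn'⟩
  | false =>
    obtain ⟨n, hn⟩ := h j hj false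
    have := hn.append (a := [⟨l, p, r⟩]) (b := []) hn'
    rw [map_raise_plain] at this
    exact ⟨n, n', this⟩

theorem Piece.contained_upper (h : ∀ j < p.bot.length, s₀.Vertical (L + j) (l.length + j)) :
    p.Contained [s₀, ⟨l, p, r⟩] 1 L l.length := by
  intro d j hj
  obtain ⟨n', hn'⟩ := Passage.upper_strand (r := r) h hj
  cases d with
  | false => exact ⟨0, n', hn'⟩
  | true =>
    obtain ⟨n, hn⟩ := h j hj true
    have := hn.append (a := []) (b := [⟨l, p, r⟩]) hn'
    rw [List.length_nil, map_raise_plain] at this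
    exact ⟨n, n', by simpa using this⟩

theorem leaves_lower (h : ∀ j < p.top.length, s₁.Vertical (l.length + j) (L + j)) {j : ℕ}
    (hj : j < p.top.length) : Leaves [⟨l, p, r⟩, s₁] (1, l.length + j) := by
  intro d
  cases d with
  | true =>
    obtain ⟨n, hn⟩ := h j hj true
    obtain ⟨n', hn'⟩ := hn.upper (s₀ := ⟨l, p, r⟩) (i' := L + j) rfl
    exact ⟨_, _, _, hn'⟩
  | false =>
    obtain ⟨n, hn⟩ := Passage.lower_strand (r := r) (d := false) h hj
    exact ⟨_, _, _, hn⟩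

theorem leaves_upper (h : ∀ j < p.bot.length, s₀.Vertical (L + j) (l.length + j)) {j : ℕ}
    (hj : j < p.bot.length) : Leaves [s₀, ⟨l, p, r⟩] (1, l.length + j) := by
  intro d
  cases d with
  | false =>
    obtain ⟨n, hn⟩ := h j hj false
    obtain ⟨n', hn'⟩ := hn.lower (s₁ := ⟨l, p, r⟩) (i' := L + j) rfl
    exact ⟨_, _, _, hn'⟩
  | true =>
    obtain ⟨n, hn⟩ := Passage.upper_strand (r := r) (d := true) h hj
    exact ⟨_, _, _, hn⟩

theorem Passage.vertical_two {a b c : ℕ} (h₀ : s₀.Vertical a b) (h₁ : s₁.Vertical b c) (d : Bool) :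
    ∃ n, Passage [s₀, s₁] d (if d then 0 else 2, if d then a else c) d (if d then c else a)
      (List.replicate n .plain) := by
  cases d with
  | true =>
    obtain ⟨n, hn⟩ := h₀ true
    obtain ⟨n', hn'⟩ := hn.lower (s₁ := s₁) (i' := c) h₁
    rw [map_raise_plain, ← List.replicate_add] at hn'
    exact ⟨_, hn'⟩
  | false =>
    obtain ⟨n, hn⟩ := h₁ false
    obtain ⟨n', hn'⟩ := hn.upper (s₀ := s₀) (i' := a) h₀
    rw [map_raise_plain, ← List.replicate_add] at hn'
    exact ⟨_, hn'⟩

theorem leaves_vertical {a b c : ℕ} (h₀ : s₀.Vertical a b) (h₁ : s₁.Vertical b c) :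
    Leaves [s₀, s₁] (1, b) := by
  intro d
  cases d with
  | true =>
    obtain ⟨n, hn⟩ := h₁ true
    obtain ⟨n', hn'⟩ := hn.upper (s₀ := s₀) (i' := c) rfl
    exact ⟨_, _, _, hn'⟩
  | false =>
    obtain ⟨n, hn⟩ := h₀ false
    obtain ⟨n', hn'⟩ := hn.lower (s₁ := s₁) (i' := a) rfl
    exact ⟨_, _, _, hn'⟩

/-! ### Exchanging heights -/

variable {k : Type u} {C : Type w} [Field k] [AddCommGroup C] [Module k C] [Coalgebra k C]
variable {R : Type v} [CommRing R] [Algebra k R] {Q : StrictOrientedQuantumCoalgebra k C}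

/-- The exits of two pieces side by side, separated by `n` vertical lines. -/
def pairExit (p q : Piece) (n : ℕ) (e : Bool × ℕ) : Bool × ℕ :=
  if e.2 < p.ends e.1 then strandExit [⟨[], p, []⟩] e
  else if e.2 < p.ends e.1 + n then (e.1, p.ends (!e.1) + (e.2 - p.ends e.1))
  else
    ((strandExit [⟨[], q, []⟩] (e.1, e.2 - (p.ends e.1 + n))).1,
      p.ends (!(strandExit [⟨[], q, []⟩] (e.1, e.2 - (p.ends e.1 + n))).1) + n +
        (strandExit [⟨[], q, []⟩] (e.1, e.2 - (p.ends e.1 + n))).2)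

/-- The beads of two pieces side by side, separated by `n` vertical lines. -/
def pairBead (Q : StrictOrientedQuantumCoalgebra k C) (χp χq : Bool → WithConv (C →ₗ[k] R))
    (p q : Piece) (n : ℕ) (e : Bool × ℕ) : Bead Q R :=
  if e.2 < p.ends e.1 then strandBead Q (fun u => χp u.2) [⟨[], p, []⟩] e
  else if e.2 < p.ends e.1 + n then 1
  else strandBead Q (fun u => χq u.2) [⟨[], q, []⟩] (e.1, e.2 - (p.ends e.1 + n))

theorem prod_bead_strand (χ : ℕ × Bool → WithConv (C →ₗ[k] R)) (H n n' : ℕ) {d : Bool} {j : ℕ}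
    (hj : j < p.ends d) :
    ((List.replicate n Event.plain ++ ((strandEvents [⟨[], p, []⟩] (d, j)).map (Event.raise H) ++
      List.replicate n' Event.plain)).map (Event.bead Q χ)).prod =
      strandBead Q (fun u => χ (H, u.2)) [⟨[], p, []⟩] (d, j) := by
  rw [List.map_append, List.map_append, List.prod_append, List.prod_append,
    prod_replicate_plain, prod_replicate_plain, one_mul, mul_one, strandBead, List.map_map]
  congr 1
  refine List.map_congr_left fun e he => ?_
  have := (p.strand [] [] hj).1.line e he
  cases e with
  | line h s =>
    obtain rfl : h = 0 := Nat.lt_one_iff.1 (this h s rfl)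
    rfl
  | _ => rfl

/-- Exits and beads are described piece by piece; the heights of the pieces enter only through the
slice numbers `H` and `H'` of their crossing lines. So both orders of the two pieces fit the same
description. -/
theorem passageSystem_pair {p q : Piece} {m : List Bool} {w : List Slice}
    (hw : Fits (p.bot ++ m ++ q.bot) w (p.top ++ m ++ q.top)) (hl : w.length = 2) {H H' : ℕ}
    (hp : p.Contained w H 0 0)
    (hq : q.Contained w H' (p.bot.length + m.length) (p.top.length + m.length))
    (hm : ∀ i < m.length, ∀ d, ∃ n,
      Passage w d (if d then 0 else 2, p.ends d + i) d (p.ends (!d) + i) (List.replicate n .plain))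
    (hin : ∀ j < (cutLevel w (p.top ++ m ++ q.top) 1).length, Leaves w (1, j))
    (χ : ℕ × Bool → WithConv (C →ₗ[k] R)) :
    PassageSystem (p.bot ++ m ++ q.bot) w (p.top ++ m ++ q.top) χ (pairExit p q m.length)
      (pairBead Q (fun s => χ (H, s)) (fun s => χ (H', s)) p q m.length) := by
  refine ⟨hw, ?_, ?_⟩
  · rintro ⟨d, j⟩ he
    have hj : j < p.ends d + m.length + q.ends d := by
      have := (isEntry_iff.1 he).1
      cases d <;> simpa [Piece.ends, add_assoc] using this
    rw [hl]
    rcases Slice.position_cases hj with hj | ⟨i, hi, rfl⟩ | ⟨i, hi, rfl⟩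
    · obtain ⟨n, n', h⟩ := hp d j hj
      simp only [pairExit, pairBead, if_pos hj]
      simp only [ite_self, zero_add] at h
      exact ⟨_, h, prod_bead_strand χ H n n' hj⟩
    · obtain ⟨n, h⟩ := hm i hi d
      have n1 : ¬ p.ends d + i < p.ends d := by omega
      have n2 : p.ends d + i < p.ends d + m.length := by omega
      simp only [pairExit, pairBead, if_neg n1, if_pos n2, Nat.add_sub_cancel_left]
      exact ⟨_, h, prod_replicate_plain χ n⟩
    · obtain ⟨n, n', h⟩ := hq d i hi
      have n1 : ¬ p.ends d + m.length + i < p.ends d := by omega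
      have n2 : ¬ p.ends d + m.length + i < p.ends d + m.length := by omega
      simp only [pairExit, pairBead, if_neg n1, if_neg n2, Nat.add_sub_cancel_left]
      refine ⟨_, ?_, prod_bead_strand χ H' n n' hi⟩
      have key : ∀ b : Bool, (if b then p.bot.length + m.length else p.top.length + m.length) =
          p.ends b + m.length := by
        intro b
        cases b <;> rfl
      have key' : ∀ b : Bool, (if b then p.top.length + m.length else p.bot.length + m.length) =
          p.ends (!b) + m.length := by
        intro b
        cases b <;> rfl
      rwa [key, key'] at h
  · intro h j h0 hlt hj
    obtain rfl : h = 1 := by omega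
    exact hin j hj _

/-- Exchange the two slices. -/
def Model.swap {s₀ s₁ s₀' s₁' : Slice} (m : Model.{v} Q [s₀, s₁]) (h₀ : s₀'.piece = s₁.piece)
    (h₁ : s₁'.piece = s₀.piece) : Model.{v} Q [s₀', s₁'] where
  R := m.R
  χ u := m.χ (1 - u.1, u.2)
  Φ := m.Φ
  pure c := by
    have := m.pure fun u => c (1 - u.1, u.2)
    simp only [List.length_cons, List.length_nil, zero_add, Nat.reduceAdd, crossingProduct,
      lineProduct, Finset.prod_range_succ, Finset.prod_range_zero, one_mul, List.getElem?_cons_zero,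
      List.getElem?_cons_succ, Option.map_some, h₀, h₁, Nat.sub_zero, Nat.sub_self] at this ⊢
    exact (congrArg m.Φ (mul_comm _ _)).trans (this.trans (mul_comm _ _))

/-- The second word receives the model of the first with the two slices renumbered. Exits, beads and
functional then coincide literally, and no identity between forms is needed. -/
theorem locallyEquivalent_exchange (p q : Piece) (m : List Bool) :
    LocallyEquivalent Q (p.bot ++ m ++ q.bot)
      [⟨[], p, m ++ q.bot⟩, ⟨p.top ++ m, q, []⟩] [⟨p.bot ++ m, q, []⟩, ⟨[], p, m ++ q.top⟩]
      (p.top ++ m ++ q.top) := by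
  have vp : ∀ r, ∀ i, Slice.Vertical ⟨[], p, r⟩ (p.bot.length + i) (p.top.length + i) := by
    intro r i
    simpa using Slice.vertical_right [] r p i
  let m₀ : Model.{max u w} Q [⟨[], p, m ++ q.bot⟩, ⟨p.top ++ m, q, []⟩] := Model.ofWord Q _
  have left : PassageSystem (p.bot ++ m ++ q.bot) [⟨[], p, m ++ q.bot⟩, ⟨p.top ++ m, q, []⟩]
      (p.top ++ m ++ q.top) m₀.χ
      (pairExit p q m.length)
      (pairBead Q (fun s => m₀.χ (0, s)) (fun s => m₀.χ (1, s)) p q m.length) := by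
    have a₁ : ∀ j < p.top.length,
        Slice.Vertical ⟨p.top ++ m, q, []⟩ (([] : List Bool).length + j) (0 + j) := by
      intro j hj
      simpa using Slice.vertical_left (l := p.top ++ m) (by simp; omega)
    have a₂ : ∀ j < q.bot.length, Slice.Vertical ⟨[], p, m ++ q.bot⟩
        (p.bot.length + m.length + j) ((p.top ++ m).length + j) := by
      intro j _
      rw [List.length_append, add_assoc, add_assoc]
      exact vp _ _
    have a₃ : ∀ i < m.length, Slice.Vertical ⟨p.top ++ m, q, []⟩ (p.top.length + i)
        (p.top.length + i) := by
      intro i hi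
      exact Slice.vertical_left (by simp; omega)
    refine passageSystem_pair (by simp [Fits, Slice.bot, Slice.top]) rfl
      (Piece.contained_lower a₁) ?_ ?_ ?_ _
    · rw [← List.length_append (as := p.top)]
      exact Piece.contained_upper a₂
    · intro i hi d
      have := Passage.vertical_two (vp (m ++ q.bot) i) (a₃ i hi) d
      cases d <;> exact this
    · intro j hj
      have hj : j < p.top.length + m.length + q.bot.length := by
        simpa [cutLevel, Slice.bot, add_assoc] using hj
      rcases Slice.position_cases hj with hj | ⟨i, hi, rfl⟩ | ⟨i, hi, rfl⟩
      · simpa using leaves_lower (r := m ++ q.bot) a₁ hj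
      · exact leaves_vertical (vp _ i) (a₃ i hi)
      · simpa using leaves_upper (r := []) a₂ hi
  have right : PassageSystem (p.bot ++ m ++ q.bot) [⟨p.bot ++ m, q, []⟩, ⟨[], p, m ++ q.top⟩]
      (p.top ++ m ++ q.top)
      (m₀.swap (s₀' := ⟨p.bot ++ m, q, []⟩) (s₁' := ⟨[], p, m ++ q.top⟩) rfl rfl).χ
      (pairExit p q m.length)
      (pairBead Q (fun s => m₀.χ (0, s)) (fun s => m₀.χ (1, s)) p q m.length) := by
    have a₁ : ∀ j < p.bot.length,
        Slice.Vertical ⟨p.bot ++ m, q, []⟩ (0 + j) (([] : List Bool).length + j) := by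
      intro j hj
      simpa using Slice.vertical_left (l := p.bot ++ m) (by simp; omega)
    have a₂ : ∀ j < q.top.length, Slice.Vertical ⟨[], p, m ++ q.top⟩
        ((p.bot ++ m).length + j) (p.top.length + m.length + j) := by
      intro j _
      rw [List.length_append, add_assoc, add_assoc]
      exact vp _ _
    have a₃ : ∀ i < m.length, Slice.Vertical ⟨p.bot ++ m, q, []⟩ (p.bot.length + i)
        (p.bot.length + i) := by
      intro i hi
      exact Slice.vertical_left (by simp; omega)
    refine passageSystem_pair (H := 1) (H' := 0) (by simp [Fits, Slice.bot, Slice.top]) rfl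
      (Piece.contained_upper a₁) ?_ ?_ ?_ _
    · rw [← List.length_append (as := p.bot)]
      exact Piece.contained_lower a₂
    · intro i hi d
      have := Passage.vertical_two (a₃ i hi) (vp (m ++ q.top) i) d
      cases d <;> exact this
    · intro j hj
      have hj : j < p.bot.length + m.length + q.top.length := by
        simpa [cutLevel, Slice.bot, add_assoc] using hj
      rcases Slice.position_cases hj with hj | ⟨i, hi, rfl⟩ | ⟨i, hi, rfl⟩
      · simpa using leaves_upper (r := m ++ q.top) a₁ hj
      · exact leaves_vertical (a₃ i hi) (vp _ i)
      · simpa using leaves_lower (r := []) a₂ hi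
  exact ⟨_, _, _, _, _, left, right, fun _ _ => rfl, fun _ => rfl⟩

end Exchange

/-! ### Invariance under regular isotopy. -/

section Invariance

variable {k : Type u} {C : Type w} [Field k] [AddCommGroup C] [Module k C] [Coalgebra k C]

/-- Words related by a local move may replace each other. -/
theorem LocalMove.locallyEquivalent {V V' : List Slice} (h : LocalMove V V')
    (Q : StrictOrientedQuantumCoalgebra k C) :
    V ≠ [] ∧ ∃ u t, LocallyEquivalent Q u V V' t := by
  cases h with
  | zigzag_left a => exact ⟨by simp, _, _, locallyEquivalent_zigzag_left a⟩
  | zigzag_right a => exact ⟨by simp, _, _, locallyEquivalent_zigzag_right a⟩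
  | two o a b => exact ⟨by simp, _, _, locallyEquivalent_two o a b⟩
  | three o a b c => exact ⟨by simp, _, _, locallyEquivalent_three o a b c⟩
  | slide_max o a b => exact ⟨by simp, _, _, locallyEquivalent_slide_max o a b⟩
  | slide_min o a b => exact ⟨by simp, _, _, locallyEquivalent_slide_min o a b⟩
  | exchange p q m => exact ⟨by simp, _, _, locallyEquivalent_exchange p q m⟩

/-- The boundaries of a nonempty word are unique. -/
theorem Fits.unique {u u' t t' : List Bool} {V : List Slice} (hne : V ≠ []) (h : Fits u V t)
    (h' : Fits u' V t') : u = u' ∧ t = t' := by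
  induction V generalizing u u' with
  | nil => exact absurd rfl hne
  | cons s V ih =>
    refine ⟨h.1.trans h'.1.symm, ?_⟩
    cases V with
    | nil => exact h.2.symm.trans h'.2
    | cons s' V => exact (ih (by simp) h.2 h'.2).2

variable (Q : TwistOrientedQuantumCoalgebra k C) {c : C}

/-- The value of a diagram, for starting points on upward lines. -/
def linkInvariant (c : C) (D : OrientedLinkDiagram) : k :=
  linkScalar Q c D (exists_startingList_up D).choose

theorem linkInvariant_eq_linkValue (hc : IsCocommutative k c) (D : OrientedLinkDiagram)
    (m : Model.{v} Q.toStrictOrientedQuantumCoalgebra D.word) {S : List (ℕ × ℕ)}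
    (hS : IsStartingList D S) : linkInvariant Q c D = linkValue Q c D.word m S := by
  obtain ⟨h₁, h₂⟩ := (exists_startingList_up D).choose_spec
  rw [linkInvariant, linkScalar_eq_linkValue Q c D m h₁ (.inl ⟨true, h₂⟩),
    linkValue_eq Q hc D m h₁ hS]

/-- The value does not depend on the admissible starting points. -/
theorem linkInvariant_eq_linkScalar (hc : IsCocommutative k c) (D : OrientedLinkDiagram)
    {S : List (ℕ × ℕ)} (hS : IsStartingList D S)
    (hadm : (∃ up : Bool, ∀ p ∈ S, direction D.word p = up) ∨ Q.Tu c = c) :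
    linkInvariant Q c D = linkScalar Q c D S := by
  rw [linkInvariant_eq_linkValue Q hc D (Model.ofWord _ _) hS,
    linkScalar_eq_linkValue Q c D (Model.ofWord _ _) hS hadm]

/-- The unchanged slices form a frame whose window contains the padded move. Since the invariant can
be computed from any model and any starting points, those supplied by the replacement theorem are
good enough. -/
theorem Move.linkInvariant_eq (hc : IsCocommutative k c) {D D' : OrientedLinkDiagram}
    (h : Move D D') : linkInvariant Q c D = linkInvariant Q c D' := by
  obtain ⟨V, V', l, r, below, above, hmove, hD, hD'⟩ := h
  obtain ⟨hne, u, t, m, m', ex, z, z', he⟩ :=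
    hmove.locallyEquivalent Q.toStrictOrientedQuantumCoalgebra
  have hfits := D.fits
  rw [hD] at hfits
  obtain ⟨t₀, h₁, hab⟩ := fits_append.1 hfits
  obtain ⟨u₀, hbe, hV⟩ := fits_append.1 h₁
  have hne' : V.map (Slice.pad l r) ≠ [] := by simpa using hne
  -- A nonempty word determines its boundaries, so those found in `D` are the padded boundaries of
  -- the local equivalence.
  obtain ⟨rfl, rfl⟩ := Fits.unique hne' hV (he.left.fits.pad l r)
  let F : Frame := ⟨below, above, _, _, hbe, hab⟩
  obtain ⟨S, S', hS, hS', e⟩ := LocalEquiv.linkValue_eq (F := F) c hne'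
    (Model.ofWord _ below) (Model.ofWord _ above) (he.pad l r)
  obtain ⟨w, hw⟩ := D
  obtain ⟨w', hw'⟩ := D'
  obtain rfl : w = F.fill (V.map (Slice.pad l r)) := hD
  obtain rfl : w' = F.fill (V'.map (Slice.pad l r)) := hD'
  rw [linkInvariant_eq_linkValue Q hc _ _ hS, linkInvariant_eq_linkValue Q hc _ _ hS']
  exact e

theorem RegularlyIsotopic.linkInvariant_eq (hc : IsCocommutative k c) {D D' : OrientedLinkDiagram}
    (h : RegularlyIsotopic D D') : linkInvariant Q c D = linkInvariant Q c D' := by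
  induction h with
  | rel D D' h => exact h.linkInvariant_eq Q hc
  | refl D => rfl
  | symm D D' _ ih => exact ih.symm
  | trans D D' D'' _ _ ih ih' => exact ih.trans ih'

end Invariance

end OQC

end

theorem mainTheorem4 {k C : Type*} [Field k] [AddCommGroup C] [Module k C] [Coalgebra k C]
    (Q : OQC.TwistOrientedQuantumCoalgebra k C) (c : C) (hc : OQC.IsCocommutative k c)
    (hT : Q.Td (Q.Tu c) = c) :
    (∀ D : OQC.OrientedLinkDiagram, ∃ S : List (ℕ × ℕ),
      OQC.IsStartingList D S ∧ ∀ p ∈ S, OQC.direction D.word p = true) ∧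
    ∃ f : OQC.OrientedLinkDiagram → k,
      (∀ (D : OQC.OrientedLinkDiagram) (S : List (ℕ × ℕ)), OQC.IsStartingList D S →
        ((∃ up : Bool, ∀ p ∈ S, OQC.direction D.word p = up) ∨ Q.Tu c = c) →
        f D = OQC.linkScalar Q c D S) ∧
      ∀ D D' : OQC.OrientedLinkDiagram, OQC.RegularlyIsotopic D D' → f D = f D' :=
  ⟨OQC.exists_startingList_up, OQC.linkInvariant Q c,
    fun D _ hS hadm => OQC.linkInvariant_eq_linkScalar Q hc D hS hadm,
    fun _ _ h => h.linkInvariant_eq Q hc⟩
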